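/- Write $\mathbb{T}^3=(\mathbb{R}/2\pi\mathbb{Z})^3$ and let $Q_R\subset\mathbb{R}^3$ be the closed ball of radius $R$ centred at the origin. \textbf{Alpha-unstable fields.} Let $U\in C^\infty(\mathbb{T}^3;\mathbb{R}^3)$ be mean-free and divergence-free with $\|\nabla U\|_{L^\infty}<1$. For $v\in\mathbb{C}^3$ let $\mathcal{S}(v)\in L^2(\mathbb{T}^3;\mathbb{C}^3)$ be the unique distributional solution of $\nabla\times(U\times S)+\Delta S=\nabla\times(v\times U)$ with $\int_{\mathbb{T}^3}S\,dx=0$, and for $\boldsymbol{j}\in\mathbb{R}^3\setminus\{0\}$ let $A=A(U,\boldsymbol{j})\in\mathbb{C}^{3\times3}$ be the matrix with $Av=i\frac{\boldsymbol{j}}{|\boldsymbol{j}|}\times\frac{1}{|\mathbb{T}^3|}\int_{\mathbb{T}^3}U\times\mathcal{S}(v)\,dx$. The field $U$ is alpha-unstable if, for some $\boldsymbol{j}\neq0$, the matrix $A(U,\boldsymbol{j})$ has an (algebraically) simple eigenvalue $\mu$ with $\operatorname{Re}\mu>0$. \textbf{Solution semigroup.} For $\varepsilon>0$, a bounded Lipschitz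 divergence-free field $u:\mathbb{R}^3\to\mathbb{R}^3$ and a divergence-free $F\in L^2(\mathbb{R}^3;\mathbb{R}^3)$, let $S^u_\varepsilon(t)F=B(t)$, where $B\in C([0,\infty);L^2(\mathbb{R}^3))\cap L^2_{loc}([0,\infty);H^1(\mathbb{R}^3))$ is the unique weak solution of $\partial_tB=\nabla\times(u\times B)+\varepsilon\Delta B$, $\nabla\cdot B=0$, $B(0)=F$. \textbf{Theorem.} Let $\Psi\in C^\infty(\mathbb{T}^3;\mathbb{R}^3)$ be such that $U=\nabla\times\Psi$ is alpha-unstable, extended periodically to $\mathbb{R}^3$. Then there exist $\zeta\in(1/2,1)$ and $\gamma>0$ such that the fields $U_n(x)=\zeta^{n/2}U(\zeta^{-n/2}x)$, $n\in\{0,1,2,\dots\}$, which satisfy $U_n=\nabla\times\Psi_n$ with $\Psi_n(x)=\zeta^{n}\Psi(\zeta^{-n/2}x)$, have the following properties. For every $\varepsilon\in(0,1]$ there is a divergence-free $F^\varepsilon\in L^2(\mathbb{R}^3;\mathbb{R}^3)$ with $\|F^\varepsilon\|_{L^2(\mathbb{R}^3)}=1$ such that \begin{itemize} \item if $n\in\{0,1,2,\dots\}$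 and $\varepsilon\in(\zeta^{n+1},\zeta^n]$, then $\|S^{U_n}_\varepsilon(t)F^\varepsilon\|_{L^2(\mathbb{R}^3)}\ge e^{2\gamma t}$ for all $t\ge0$; \item for every $\delta\in(0,1)$ there is $R>0$, independent of $\varepsilon$, such that $\|F^\varepsilon\|_{L^2(Q_R)}\ge1-\delta$ for all $\varepsilon\in(0,1]$. \end{itemize} -/

import Mathlib

open MeasureTheory
open scoped ContDiff

namespace Dynamo

/-- Euclidean space `ℝ³`. -/
abbrev E3 : Type := EuclideanSpace ℝ (Fin 3)

/-- Hermitian space `ℂ³`. -/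
abbrev C3 : Type := EuclideanSpace ℂ (Fin 3)

/-- `L²(ℝ³; ℝ³)`, with the Euclidean norm on the values. -/
abbrev L2 : Type := Lp E3 2 (volume : Measure E3)

/-! ### Vector calculus -/

/-- The `i`-th vector of the standard basis of `ℝ³`. -/
noncomputable def basisVec (i : Fin 3) : E3 := EuclideanSpace.single i 1

/-- The partial derivative `∂ᵢ f`. -/
noncomputable def pderiv {F : Type*} [NormedAddCommGroup F] [NormedSpace ℝ F]
    (i : Fin 3) (f : E3 → F) (x : E3) : F :=
  fderiv ℝ f x (basisVec i)

/-- The cross product of two vectors of `ℝ³` or of `ℂ³` (bilinear, without conjugation). -/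
def cross {𝕜 : Type*} [RCLike 𝕜] (a b : EuclideanSpace 𝕜 (Fin 3)) : EuclideanSpace 𝕜 (Fin 3) :=
  WithLp.toLp 2 (crossProduct (WithLp.ofLp a) (WithLp.ofLp b))

/-- The curl `∇ × f` of a real or complex vector field on `ℝ³`. -/
noncomputable def curl {𝕜 : Type*} [RCLike 𝕜] (f : E3 → EuclideanSpace 𝕜 (Fin 3)) (x : E3) :
    EuclideanSpace 𝕜 (Fin 3) :=
  !₂[pderiv 1 (fun y => f y 2) x - pderiv 2 (fun y => f y 1) x,
    pderiv 2 (fun y => f y 0) x - pderiv 0 (fun y => f y 2) x,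
    pderiv 0 (fun y => f y 1) x - pderiv 1 (fun y => f y 0) x]

/-- The divergence `∇ · f` of a real vector field on `ℝ³`. -/
noncomputable def divergence (f : E3 → E3) (x : E3) : ℝ :=
  ∑ i : Fin 3, pderiv i (fun y => f y i) x

/-- The bilinear (unconjugated) pairing on `ℂ³`. -/
def cdot (a b : C3) : ℂ := ∑ i : Fin 3, a i * b i

/-- A real vector seen as a complex vector. -/
def toC3 (a : E3) : C3 := WithLp.toLp 2 (fun i => (a i : ℂ))

/-! ### The torus `𝕋³ = (ℝ / 2πℤ)³` and alpha-unstable velocity fields -/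

/-- `f` is `2π`-periodic in each variable, that is, a function on `𝕋³`. -/
def TorusPeriodic {F : Type*} (f : E3 → F) : Prop :=
  ∀ (x : E3) (i : Fin 3), f (x + (2 * Real.pi) • basisVec i) = f x

/-- The fundamental cell `(-π, π]³` of `𝕋³`. -/
def cell : Set E3 := {x | ∀ i : Fin 3, x i ∈ Set.Ioc (-Real.pi) Real.pi}

/-- `S ∈ L²(𝕋³; ℂ³)` solves, in the sense of distributions on `𝕋³`,
`∇ × (U × S) + Δ S = ∇ × (v × U)` and has zero integral over `𝕋³`.
Only the values of `S` on the cell matter. -/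
structure IsCellSolution (U : E3 → E3) (v : C3) (S : E3 → C3) : Prop where
  memLp : MemLp S 2 (volume.restrict cell)
  equation : ∀ φ : E3 → C3, ContDiff ℝ ∞ φ → TorusPeriodic φ →
    ∫ x in cell, (cdot (cross (toC3 (U x)) (S x)) (curl φ x)
        + cdot (S x) (Laplacian.laplacian φ x))
      = ∫ x in cell, cdot (cross v (toC3 (U x))) (curl φ x)
  mean_zero : ∫ x in cell, S x = 0

open Classical in
/-- The solution map `v ↦ 𝒮(v)` of the cell problem. -/
noncomputable def cellSolution (U : E3 → E3) (v : C3) : E3 → C3 :=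
  if h : ∃ S : E3 → C3, IsCellSolution U v S then h.choose else 0

/-- The vector `A v = i (j / |j|) × ⨍ U × 𝒮(v)`. -/
noncomputable def alphaMap (U : E3 → E3) (j : E3) (v : C3) : C3 :=
  Complex.I • cross (toC3 (‖j‖⁻¹ • j)) (⨍ x in cell, cross (toC3 (U x)) (cellSolution U v x))

/-- The matrix `A = A(U, j)`; its `k`-th column is `A eₖ`. -/
noncomputable def alphaMatrix (U : E3 → E3) (j : E3) : Matrix (Fin 3) (Fin 3) ℂ :=
  Matrix.of fun i k => alphaMap U j (EuclideanSpace.single k 1) i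

/-- Alpha-unstable velocity fields. The last field says that for some `j ≠ 0` the matrix
`A(U, j)` has a simple eigenvalue with positive real part. -/
structure AlphaUnstable (U : E3 → E3) : Prop where
  smooth : ContDiff ℝ ∞ U
  periodic : TorusPeriodic U
  mean_zero : ∫ x in cell, U x = 0
  div_free : ∀ x, divergence U x = 0
  grad_lt_one : ∃ c : ℝ, c < 1 ∧ ∀ x, ‖fderiv ℝ U x‖ ≤ c
  unstable : ∃ j : E3, j ≠ 0 ∧ ∃ μ : ℂ, 0 < μ.re ∧
    (alphaMatrix U j).charpoly.rootMultiplicity μ = 1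

/-! ### The kinematic dynamo equation on `ℝ³` -/

/-- Test fields: smooth and compactly supported. -/
def IsTest {F : Type*} [NormedAddCommGroup F] [NormedSpace ℝ F] (φ : E3 → F) : Prop :=
  ContDiff ℝ ∞ φ ∧ HasCompactSupport φ

/-- `f ∈ L²(ℝ³; ℝ³)` is divergence-free in the sense of distributions. -/
def WeaklyDivFree (f : L2) : Prop :=
  ∀ φ : E3 → ℝ, IsTest φ → ∫ x, inner ℝ (f x) (gradient φ x) = 0

/-- `g = ∂ᵢ f` in the sense of distributions. -/
def IsWeakPDeriv (i : Fin 3) (f g : L2) : Prop :=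
  ∀ φ : E3 → E3, IsTest φ →
    ∫ x, inner ℝ (f x) (pderiv i φ x) = - ∫ x, inner ℝ (g x) (φ x)

/-- `B` is a weak solution on `[0, ∞) × ℝ³`, in the class
`C([0, ∞); L²) ∩ L²_loc([0, ∞); H¹)`, of
`∂ₜ B = ∇ × (u × B) + ε Δ B`, `∇ · B = 0`, `B(0) = F`.
The values of `B` at negative times are irrelevant. -/
structure IsKDESolution (u : E3 → E3) (ε : ℝ) (F : L2) (B : ℝ → L2) : Prop where
  initial : B 0 = F
  continuousOn : ContinuousOn B (Set.Ici 0)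
  gradient_L2 : ∃ G : Fin 3 → ℝ → L2,
    (∀ i, ∀ᵐ t ∂(volume.restrict (Set.Ioi (0 : ℝ))), IsWeakPDeriv i (B t) (G i t)) ∧
    ∀ i, ∀ T : ℝ, 0 < T → MemLp (G i) 2 (volume.restrict (Set.Ioc 0 T))
  div_free : ∀ t, 0 ≤ t → WeaklyDivFree (B t)
  equation : ∀ φ : E3 → E3, IsTest φ → ∀ t, 0 ≤ t →
    ∫ x, inner ℝ (B t x) (φ x) = (∫ x, inner ℝ (F x) (φ x)) +
      ∫ s in (0 : ℝ)..t, ∫ x, (inner ℝ (cross (u x) (B s x)) (curl φ x)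
        + ε * inner ℝ (B s x) (Laplacian.laplacian φ x))

open Classical in
/-- `kdeFlow u ε t F` is `S_ε^u(t) F`: the value at time `t` of the weak solution that starts
from `F`, and `0` if there is no weak solution. -/
noncomputable def kdeFlow (u : E3 → E3) (ε t : ℝ) (F : L2) : L2 :=
  if h : ∃ B : ℝ → L2, IsKDESolution u ε F B then h.choose t else 0

/-! ### Rescaled fields -/

/-- `Uₙ(x) = ζ^{n/2} U(ζ^{-n/2} x)`. -/
noncomputable def rescaledField (ζ : ℝ) (n : ℕ) (U : E3 → E3) (x : E3) : E3 :=
  (ζ ^ ((n : ℝ) / 2)) • U ((ζ ^ (-((n : ℝ) / 2))) • x)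

/-- The stream function `Ψₙ(x) = ζ^n Ψ(ζ^{-n/2} x)` of `Uₙ`. -/
noncomputable def rescaledPotential (ζ : ℝ) (n : ℕ) (Ψ : E3 → E3) (x : E3) : E3 :=
  (ζ ^ n) • Ψ ((ζ ^ (-((n : ℝ) / 2))) • x)

end Dynamo

/-! The growing solutions are wave packets of Bloch modes. A field exp(iκ·x) h(x) with h periodic
lives on the wave vectors m + κ, m in the lattice, and is an eigenmode with growth rate λ when λ
h(m) = i(m+κ) × (û * h)(m) − ε|m+κ|² h(m), which is `IsMode`.

For κ = δk with δ small, split h into its mean v and a fluctuation w(m)/|m|, write λ = δσ, divide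
the equation at m = 0 by δ and the equation at m ≠ 0 by |m|. The resulting system `modeMap` extends
smoothly to δ = 0, where for ε = 1 it consists of the cell problem for w together with A v = σ v.
The implicit function theorem applies there for two reasons. The fluctuation block 1 − `cellOp` is
invertible because ‖∇U‖ < 1: for divergence-free S one has ∇ × (U × S) = (S·∇)U − (U·∇)S, the
advection term is skew, and the stretching term is bounded by sup ‖∇U‖ · ‖S‖² (`re_inner_cellOp_le`,
`bijective_one_sub_cellOp`). Eliminating w leaves A − μ bordered by the eigenvector, which is
invertible because μ is simple (`exists_eigenvector_of_rootMultiplicity_eq_one`,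
`bijective_modeDeriv`). The outcome, `exists_mode_family`, is a family of modes with Re λ ≥ 2γ,
continuous in (κ, ε) for κ in a small closed ball K and ε in [ζ, 1].

Superposing the modes over κ ∈ K gives a field in L²(ℝ³). Multiplication by the periodic field U
moves wave vectors by lattice vectors and leaves the quasi-momentum κ fixed, so the fibres evolve
independently, each with factor exp(tλ(κ)) (`fourierL2_velOp_packet`, `isKDESolution_packet`);
Plancherel then yields the growth of the norm. Since K and −K are disjoint modulo the lattice, a
packet is orthogonal to its complex conjugate, and taking the real part multiplies all norms by the
same factor 1/√2 (`norm_sq_reOp`). As `kdeFlow` selects some weak solution, uniqueness is also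
needed; it comes from an energy estimate for mollified solutions and Gronwall's inequality
(`IsKDESolution.unique`).

Dilating by a = ζ^{n/2} turns a solution for (U, ε') into one for (a U(·/a), a²ε') with the same
growth rate, so every ε in (0, 1] reduces to ε' in [ζ, 1]. The packets with ε' in [ζ, 1] form a
compact, hence tight, subset of L², and dilations with a ≤ 1 only concentrate them; this gives an R
independent of ε. -/

namespace Dynamo

/-! ### The cross product as a bilinear map -/

/-- Extensionality for vectors with three coordinates. -/
theorem vec_ext {𝕜 : Type*} {a b : EuclideanSpace 𝕜 (Fin 3)} (h0 : a 0 = b 0) (h1 : a 1 = b 1)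
    (h2 : a 2 = b 2) : a = b := by
  ext i; fin_cases i <;> assumption

section CrossProduct

variable {𝕜 : Type*} [RCLike 𝕜]

theorem cross_apply_zero (a b : EuclideanSpace 𝕜 (Fin 3)) :
    cross a b 0 = a 1 * b 2 - a 2 * b 1 := by
  simp [cross, cross_apply]

theorem cross_apply_one (a b : EuclideanSpace 𝕜 (Fin 3)) :
    cross a b 1 = a 2 * b 0 - a 0 * b 2 := by
  simp [cross, cross_apply]

theorem cross_apply_two (a b : EuclideanSpace 𝕜 (Fin 3)) :
    cross a b 2 = a 0 * b 1 - a 1 * b 0 := by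
  simp [cross, cross_apply]

variable (𝕜) in
/-- The cross product as a continuous bilinear map. -/
noncomputable def crossCLM :
    EuclideanSpace 𝕜 (Fin 3) →L[𝕜] EuclideanSpace 𝕜 (Fin 3) →L[𝕜] EuclideanSpace 𝕜 (Fin 3) :=
  LinearMap.toContinuousLinearMap
    ((LinearMap.toContinuousLinearMap (𝕜 := 𝕜) (E := EuclideanSpace 𝕜 (Fin 3))
        (F' := EuclideanSpace 𝕜 (Fin 3))).toLinearMap ∘ₗ
      LinearMap.mk₂ 𝕜 cross
        (by intros; apply vec_ext <;>
          simp [cross_apply_zero, cross_apply_one, cross_apply_two] <;> ring)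
        (by intros; apply vec_ext <;>
          simp [cross_apply_zero, cross_apply_one, cross_apply_two] <;> ring)
        (by intros; apply vec_ext <;>
          simp [cross_apply_zero, cross_apply_one, cross_apply_two] <;> ring)
        (by intros; apply vec_ext <;>
          simp [cross_apply_zero, cross_apply_one, cross_apply_two] <;> ring))

@[simp]
theorem crossCLM_apply (a b : EuclideanSpace 𝕜 (Fin 3)) : crossCLM 𝕜 a b = cross a b := rfl

theorem norm_cross_le (a b : EuclideanSpace 𝕜 (Fin 3)) :
    ‖cross a b‖ ≤ ‖crossCLM 𝕜‖ * ‖a‖ * ‖b‖ := (crossCLM 𝕜).le_opNorm₂ a b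

theorem cross_add_left (a b c : EuclideanSpace 𝕜 (Fin 3)) :
    cross (a + b) c = cross a c + cross b c := by
  simp only [← crossCLM_apply, map_add, add_apply]

theorem cross_add_right (a b c : EuclideanSpace 𝕜 (Fin 3)) :
    cross a (b + c) = cross a b + cross a c := by
  simp only [← crossCLM_apply, map_add]

theorem cross_smul_left (t : 𝕜) (a b : EuclideanSpace 𝕜 (Fin 3)) :
    cross (t • a) b = t • cross a b := by
  simp only [← crossCLM_apply, map_smul, smul_apply]

theorem cross_smul_right (t : 𝕜) (a b : EuclideanSpace 𝕜 (Fin 3)) :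
    cross a (t • b) = t • cross a b := by
  simp only [← crossCLM_apply, map_smul]

@[simp] theorem cross_zero_left (a : EuclideanSpace 𝕜 (Fin 3)) : cross 0 a = 0 := by
  simp only [← crossCLM_apply, map_zero, zero_apply]

@[simp] theorem cross_zero_right (a : EuclideanSpace 𝕜 (Fin 3)) : cross a 0 = 0 := by
  simp only [← crossCLM_apply, map_zero]

theorem cross_anticomm' (a b : EuclideanSpace 𝕜 (Fin 3)) : cross a b = -cross b a := by
  apply vec_ext <;> simp [cross_apply_zero, cross_apply_one, cross_apply_two] <;> ring

end CrossProduct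

@[simp] theorem toC3_apply (a : E3) (i : Fin 3) : toC3 a i = (a i : ℂ) := rfl

/-- The inclusion of `ℝ³` in `ℂ³` as a real linear map. -/
noncomputable def toC3CLM : E3 →L[ℝ] C3 :=
  LinearMap.toContinuousLinearMap
    { toFun := toC3
      map_add' := fun a b => by ext i; simp
      map_smul' := fun t a => by ext i; simp }

@[simp] theorem toC3CLM_apply (a : E3) : toC3CLM a = toC3 a := rfl

@[simp] theorem norm_toC3 (a : E3) : ‖toC3 a‖ = ‖a‖ := by
  simp [EuclideanSpace.norm_eq]

theorem cross_toC3 (a b : E3) : cross (toC3 a) (toC3 b) = toC3 (cross a b) := by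
  apply vec_ext <;> simp [cross_apply_zero, cross_apply_one, cross_apply_two]

theorem inner_toC3 (a b : E3) : inner ℂ (toC3 a) (toC3 b) = ((inner ℝ a b : ℝ) : ℂ) := by
  simp [PiLp.inner_apply, Fin.sum_univ_three]

/-! ### Square-summable sequences of vectors indexed by the integer lattice -/

/-- The lattice of frequencies of the torus. -/
abbrev Z3 : Type := Fin 3 → ℤ

/-- Square-summable families of complex vectors indexed by the lattice. -/
abbrev Seq : Type := lp (fun _ : Z3 => C3) 2

theorem summable_seq (w : Seq) : Summable fun m => ‖w m‖ ^ 2 := by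
  have := (lp.hasSum_norm (p := 2) (by norm_num) w).summable
  simpa using this

theorem seq_norm_sq (w : Seq) : ‖w‖ ^ 2 = ∑' m, ‖w m‖ ^ 2 := by
  have := lp.norm_rpow_eq_tsum (p := 2) (by norm_num) w
  simpa using this

theorem memSeq_of_summable {f : Z3 → C3} (h : Summable fun m => ‖f m‖ ^ 2) : Memℓp f 2 :=
  memℓp_gen (by simpa using h)

theorem norm_seq_le {v w : Seq} {C : ℝ} (hC : 0 ≤ C)
    (h : ∑' m, ‖v m‖ ^ 2 ≤ C ^ 2 * ∑' m, ‖w m‖ ^ 2) : ‖v‖ ≤ C * ‖w‖ := by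
  refine abs_le_of_sq_le_sq' ?_ (by positivity) |>.2
  rwa [seq_norm_sq, mul_pow, seq_norm_sq]

/-- The operator acting on the value at `m` by the linear map `A m`. -/
noncomputable def diagOp (A : Z3 → C3 →L[ℂ] C3) (C : ℝ) (hC : 0 ≤ C) (hA : ∀ m, ‖A m‖ ≤ C) :
    Seq →L[ℂ] Seq :=
  have key (w : Seq) (m : Z3) : ‖A m (w m)‖ ^ 2 ≤ C ^ 2 * ‖w m‖ ^ 2 := by
    rw [← mul_pow]
    gcongr
    exact (A m).le_of_opNorm_le (hA m) _
  have hs (w : Seq) : Summable fun m => ‖A m (w m)‖ ^ 2 :=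
    Summable.of_nonneg_of_le (fun m => by positivity) (key w) ((summable_seq w).mul_left _)
  LinearMap.mkContinuous
    { toFun := fun w => ⟨fun m => A m (w m), memSeq_of_summable (hs w)⟩
      map_add' := fun v w => by ext m : 2; exact map_add (A m) _ _
      map_smul' := fun c w => by ext m : 2; exact map_smul (A m) _ _ } C (fun w =>
        norm_seq_le hC (by
          rw [← tsum_mul_left]
          exact (hs w).tsum_le_tsum (key w) ((summable_seq w).mul_left _)))

@[simp] theorem diagOp_apply (A : Z3 → C3 →L[ℂ] C3) (C : ℝ) (hC : 0 ≤ C) (hA : ∀ m, ‖A m‖ ≤ C)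
    (w : Seq) (m : Z3) : diagOp A C hC hA w m = A m (w m) := rfl

theorem norm_diagOp_le (A : Z3 → C3 →L[ℂ] C3) (C : ℝ) (hC : 0 ≤ C) (hA : ∀ m, ‖A m‖ ≤ C) :
    ‖diagOp A C hC hA‖ ≤ C := by
  unfold diagOp
  exact LinearMap.mkContinuous_norm_le _ hC _

/-- The translation of sequences by `l`. -/
noncomputable def shiftOp (l : Z3) : Seq →L[ℂ] Seq :=
  have hs (w : Seq) : Summable fun m => ‖w (m - l)‖ ^ 2 :=
    (Equiv.subRight l).summable_iff.mpr (summable_seq w)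
  LinearMap.mkContinuous
    { toFun := fun w => ⟨fun m => w (m - l), memSeq_of_summable (hs w)⟩
      map_add' := fun v w => rfl
      map_smul' := fun c w => rfl } 1 (fun w => norm_seq_le zero_le_one (by
        rw [one_pow, one_mul]
        exact ((Equiv.subRight l).tsum_eq (fun m => ‖w m‖ ^ 2)).le))

@[simp] theorem shiftOp_apply (l : Z3) (w : Seq) (m : Z3) : shiftOp l w m = w (m - l) := rfl

theorem norm_shiftOp_le (l : Z3) : ‖shiftOp l‖ ≤ 1 := by
  unfold shiftOp
  exact LinearMap.mkContinuous_norm_le _ zero_le_one _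

/-- Pointwise vector product with a fixed vector. -/
noncomputable def crossOp (a : C3) : Seq →L[ℂ] Seq :=
  diagOp (fun _ => crossCLM ℂ a) ‖crossCLM ℂ a‖ (norm_nonneg _) (fun _ => le_rfl)

theorem norm_crossOp_le (a : C3) : ‖crossOp a‖ ≤ ‖crossCLM ℂ‖ * ‖a‖ :=
  (norm_diagOp_le _ _ _ _).trans ((crossCLM ℂ).le_opNorm a)

/-- Convolution, with respect to the cross product, with a family of vectors. -/
noncomputable def convOp (a : Z3 → C3) : Seq →L[ℂ] Seq := ∑' l, (crossOp (a l)).comp (shiftOp l)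

theorem summable_convOp {a : Z3 → C3} (ha : Summable fun l => ‖a l‖) :
    Summable fun l => (crossOp (a l)).comp (shiftOp l) := by
  refine Summable.of_norm_bounded (ha.mul_left ‖crossCLM ℂ‖) fun l => ?_
  calc _ ≤ ‖crossOp (a l)‖ * ‖shiftOp l‖ := ContinuousLinearMap.opNorm_comp_le _ _
    _ ≤ (‖crossCLM ℂ‖ * ‖a l‖) * 1 :=
      mul_le_mul (norm_crossOp_le _) (norm_shiftOp_le l) (norm_nonneg _) (by positivity)
    _ = _ := mul_one _

theorem hasSum_convOp {a : Z3 → C3} (ha : Summable fun l => ‖a l‖) (w : Seq) (m : Z3) :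
    HasSum (fun l => cross (a l) (w (m - l))) (convOp a w m) := by
  have h := (summable_convOp ha).hasSum
  have h1 := h.mapL (ContinuousLinearMap.apply ℂ Seq w)
  exact h1.mapL (lp.evalCLM ℂ (fun _ : Z3 => C3) 2 m)

theorem convOp_single {a : Z3 → C3} (ha : Summable fun l => ‖a l‖) (v : C3) (m : Z3) :
    convOp a (lp.single 2 0 v) m = cross (a m) v := by
  refine (hasSum_convOp ha _ m).unique ?_
  have := hasSum_single (f := fun l => cross (a l) ((lp.single 2 (0 : Z3) v : Seq) (m - l))) m
    (fun l hl => by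
      rw [lp.single_apply_ne _ _ _ (sub_ne_zero.mpr (Ne.symm hl)), cross_zero_right])
  simpa using this

/-- A lattice point as a complex vector. -/
noncomputable def latVec (m : Z3) : C3 := WithLp.toLp 2 fun i => (m i : ℂ)

@[simp] theorem latVec_apply (m : Z3) (i : Fin 3) : latVec m i = m i := rfl

theorem latVec_sub (m n : Z3) : latVec (m - n) = latVec m - latVec n := by ext i; simp

theorem norm_latVec_sq (m : Z3) : ‖latVec m‖ ^ 2 = ∑ i, (m i : ℝ) ^ 2 := by
  rw [EuclideanSpace.norm_sq_eq]
  simp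

@[simp] theorem latVec_zero : latVec 0 = 0 := by ext i; simp

theorem one_le_norm_latVec {m : Z3} (hm : m ≠ 0) : 1 ≤ ‖latVec m‖ := by
  obtain ⟨i, hi⟩ := Function.ne_iff.mp hm
  have h1 : (1 : ℝ) ≤ (m i : ℝ) ^ 2 := by
    have : (1 : ℤ) ≤ (m i) ^ 2 := by
      have := sq_pos_of_ne_zero (a := m i) hi
      omega
    exact_mod_cast this
  have h2 : (m i : ℝ) ^ 2 ≤ ‖latVec m‖ ^ 2 := by
    rw [norm_latVec_sq]
    exact Finset.single_le_sum (f := fun i => (m i : ℝ) ^ 2) (fun i _ => sq_nonneg _)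
      (Finset.mem_univ i)
  nlinarith [norm_nonneg (latVec m)]

/-- Nonzero lattice points have length at least one, and at m = 0 the convention `0⁻¹ = 0` gives
zero. The same convention makes multiplication by 1/|m| annihilate the mean. -/
theorem inv_norm_latVec_le_one (m : Z3) : ‖latVec m‖⁻¹ ≤ 1 := by
  rcases eq_or_ne m 0 with rfl | hm
  · simp
  · exact inv_le_one_of_one_le₀ (one_le_norm_latVec hm)


/-! ### Fourier series on the cell -/

-- The Haar measure of total mass one is the normalization under which the exponentials
-- `UnitAddTorus.mFourier` are orthonormal.
noncomputable local instance : MeasureSpace UnitAddCircle := ⟨AddCircle.haarAddCircle⟩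

local instance : Measure.IsAddHaarMeasure (volume : Measure UnitAddCircle) :=
  inferInstanceAs (Measure.IsAddHaarMeasure AddCircle.haarAddCircle)

local instance : IsProbabilityMeasure (volume : Measure UnitAddCircle) :=
  inferInstanceAs (IsProbabilityMeasure AddCircle.haarAddCircle)

/-- The exponential `exp (i n · x)`. -/
noncomputable def ech (n : Z3) (x : E3) : ℂ :=
  Complex.exp (((∑ i, (n i : ℝ) * x i : ℝ) : ℂ) * Complex.I)

/-- The normalized Lebesgue measure of the cell. -/
noncomputable def cellProb : Measure E3 :=
  (volume.restrict cell Set.univ)⁻¹ • volume.restrict cell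

theorem average_cell {F : Type*} [NormedAddCommGroup F] [NormedSpace ℝ F] (f : E3 → F) :
    ⨍ x in cell, f x = ∫ x, f x ∂cellProb := rfl

theorem measurableSet_cell : MeasurableSet cell := by
  have : cell = ⋂ i : Fin 3, {x : E3 | x i ∈ Set.Ioc (-Real.pi) Real.pi} := by
    ext; simp [cell]
  rw [this]
  exact MeasurableSet.iInter fun i =>
    (EuclideanSpace.proj (𝕜 := ℝ) i).continuous.measurable measurableSet_Ioc

/-- The representative in the cell of a point of the torus. -/
noncomputable def rep (θ : UnitAddTorus (Fin 3)) : E3 :=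
  (2 * Real.pi) • WithLp.toLp 2 fun i => (AddCircle.equivIoc 1 (-(1 / 2)) (θ i) : ℝ)

/-- The projection to the torus. -/
noncomputable def torusProj (x : E3) : UnitAddTorus (Fin 3) :=
  fun i => (((2 * Real.pi)⁻¹ * x i : ℝ) : UnitAddCircle)

theorem torusProj_rep (θ : UnitAddTorus (Fin 3)) : torusProj (rep θ) = θ := by
  funext i
  have h : (2 * Real.pi)⁻¹ * (rep θ) i = (AddCircle.equivIoc 1 (-(1 / 2)) (θ i) : ℝ) := by
    simp only [rep, PiLp.smul_apply, smul_eq_mul]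
    field_simp
  simp only [torusProj, h]
  exact (AddCircle.equivIoc 1 (-(1 / 2))).symm_apply_apply (θ i)

theorem torusProj_add (x y : E3) : torusProj (x + y) = torusProj x + torusProj y := by
  funext i
  simp [torusProj, mul_add]

theorem mFourier_torusProj (n : Z3) (x : E3) :
    UnitAddTorus.mFourier n (torusProj x) = ech n x := by
  simp only [UnitAddTorus.mFourier, torusProj, ContinuousMap.coe_mk, fourier_coe_apply, ech,
    Fin.sum_univ_three, Fin.prod_univ_three, ← Complex.exp_add]
  congr 1
  push_cast
  field_simp

theorem measurable_rep : Measurable rep := by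
  unfold rep
  have h : Measurable fun θ : UnitAddTorus (Fin 3) =>
      fun i => (AddCircle.equivIoc 1 (-(1 / 2)) (θ i) : ℝ) :=
    measurable_pi_lambda _ fun i => measurable_subtype_coe.comp
      ((AddCircle.measurableEquivIoc 1 (-(1 / 2))).measurable.comp (measurable_pi_apply i))
  have h2 : Measurable fun y : Fin 3 → ℝ => (2 * Real.pi) • (WithLp.toLp 2 y : E3) :=
    (by fun_prop : Continuous fun y : Fin 3 → ℝ => (2 * Real.pi) • (WithLp.toLp 2 y : E3)).measurable
  exact h2.comp h

/-- The representative map is a parametrization of a unit cube followed by the homothety of ratio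
2π. Proportionality is enough: the constant is recovered later from the total mass. -/
theorem exists_map_rep : ∃ c : ENNReal,
    (volume : Measure (UnitAddTorus (Fin 3))).map rep = c • volume.restrict cell := by
  set a : Fin 3 → ℝ := fun _ => -(1 / 2)
  set D : Set (Fin 3 → ℝ) := {x | ∀ i, x i ∈ Set.Ioc (a i) (a i + 1)}
  have hD : MeasurableSet D := MeasurableSet.univ_pi' fun i => measurableSet_Ioc
  have h1 : (volume : Measure (UnitAddTorus (Fin 3))).map
      (fun θ => (UnitAddTorus.measurableEquivPiIoc a θ : Fin 3 → ℝ)) = volume.restrict D := by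
    have := (UnitAddTorus.measurePreserving_equivPiIoc (d := Fin 3) a).map_eq
    have h2 := congrArg (Measure.map Subtype.val) this
    rw [Measure.map_map measurable_subtype_coe (MeasurableEquiv.measurable _)] at h2
    exact h2.trans (map_comap_subtype_coe hD volume)
  set G : (Fin 3 → ℝ) → E3 := fun y => (2 * Real.pi) • WithLp.toLp 2 y with hG
  have hGm : Measurable G := (by fun_prop : Continuous G).measurable
  have hrep : rep = G ∘ fun θ => (UnitAddTorus.measurableEquivPiIoc a θ : Fin 3 → ℝ) := rfl
  have hpre : D = G ⁻¹' cell := by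
    ext y
    simp only [D, a, cell, Set.mem_Ioc, Set.mem_preimage, Set.mem_ofPred_eq, hG, PiLp.smul_apply,
      smul_eq_mul]
    refine forall_congr' fun i => ?_
    constructor <;> rintro ⟨h1, h2⟩ <;> constructor <;> nlinarith [Real.pi_pos]
  refine ⟨ENNReal.ofReal |((2 * Real.pi) ^ Module.finrank ℝ E3)⁻¹|, ?_⟩
  have hm : Measurable fun θ => (UnitAddTorus.measurableEquivPiIoc a θ : Fin 3 → ℝ) :=
    measurable_subtype_coe.comp (MeasurableEquiv.measurable _)
  rw [hrep, ← Measure.map_map hGm hm, h1, hpre,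
    ← Measure.restrict_map hGm measurableSet_cell]
  have : (volume : Measure (Fin 3 → ℝ)).map G
      = ENNReal.ofReal |((2 * Real.pi) ^ Module.finrank ℝ E3)⁻¹| • (volume : Measure E3) := by
    rw [← Measure.map_addHaar_smul (volume : Measure E3) (by positivity : 2 * Real.pi ≠ 0),
      ← (PiLp.volume_preserving_toLp (Fin 3)).map_eq,
      Measure.map_map (measurable_const_smul _) (PiLp.volume_preserving_toLp (Fin 3)).measurable]
    rfl
  rw [this, Measure.restrict_smul]

theorem volume_cell_pos_finite : volume cell ≠ 0 ∧ volume cell ≠ ⊤ := by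
  obtain ⟨c, hc⟩ := exists_map_rep
  have h1 : (volume : Measure (UnitAddTorus (Fin 3))).map rep Set.univ = 1 := by
    rw [Measure.map_apply measurable_rep MeasurableSet.univ]; simp
  rw [hc] at h1
  simp only [Measure.smul_apply, Measure.restrict_apply_univ, smul_eq_mul] at h1
  constructor
  · intro h; simp [h] at h1
  · have : Bornology.IsBounded cell := by
      rw [Metric.isBounded_iff_subset_closedBall 0]
      refine ⟨3 * Real.pi, fun x hx => ?_⟩
      rw [mem_closedBall_zero_iff, EuclideanSpace.norm_eq, Real.sqrt_le_left (by positivity)]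
      have hb : ∀ i, ‖x i‖ ^ 2 ≤ Real.pi ^ 2 := fun i => by
        rw [Real.norm_eq_abs, sq_abs]
        nlinarith [(hx i).1, (hx i).2]
      rw [Fin.sum_univ_three]
      nlinarith [hb 0, hb 1, hb 2, sq_nonneg Real.pi]
    exact this.measure_lt_top.ne

instance : IsProbabilityMeasure cellProb := by
  constructor
  simp only [cellProb, Measure.smul_apply, Measure.restrict_apply_univ, smul_eq_mul]
  exact ENNReal.inv_mul_cancel volume_cell_pos_finite.1 volume_cell_pos_finite.2

theorem measurePreserving_rep : MeasurePreserving rep volume cellProb := by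
  refine ⟨measurable_rep, ?_⟩
  obtain ⟨c, hc⟩ := exists_map_rep
  have h1 : (volume : Measure (UnitAddTorus (Fin 3))).map rep Set.univ = 1 := by
    rw [Measure.map_apply measurable_rep MeasurableSet.univ]; simp
  rw [hc] at h1 ⊢
  simp only [Measure.smul_apply, Measure.restrict_apply_univ, smul_eq_mul] at h1
  rw [cellProb, Measure.restrict_apply_univ, ENNReal.eq_inv_of_mul_eq_one_left h1]

theorem memLp_cellProb_iff {F : Type*} [NormedAddCommGroup F] {f : E3 → F} :
    MemLp f 2 cellProb ↔ MemLp f 2 (volume.restrict cell) := by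
  have h := volume_cell_pos_finite
  rw [cellProb, Measure.restrict_apply_univ]
  constructor
  · intro hf
    have := hf.smul_measure (c := volume cell) h.2
    rwa [smul_smul, ENNReal.mul_inv_cancel h.1 h.2, one_smul] at this
  · intro hf
    exact hf.smul_measure (ENNReal.inv_ne_top.mpr h.1)

/-! ### Periodic functions -/

theorem TorusPeriodic.add_lattice {F : Type*} {g : E3 → F} (hg : TorusPeriodic g) (x : E3)
    (n : Z3) : g (x + (2 * Real.pi) • WithLp.toLp 2 fun i => (n i : ℝ)) = g x := by
  have h1 : ∀ (i : Fin 3) (k : ℤ) (x : E3), g (x + (k : ℝ) • (2 * Real.pi) • basisVec i) = g x := by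
    intro i k
    induction k using Int.induction_on with
    | zero => simp
    | succ k ih =>
      intro x
      have := hg (x + (k : ℝ) • (2 * Real.pi) • basisVec i) i
      rw [← ih x]
      push_cast at this ⊢
      rw [← this]
      congr 1
      module
    | pred k ih =>
      intro x
      have := hg (x + ((-k - 1 : ℤ) : ℝ) • (2 * Real.pi) • basisVec i) i
      rw [← ih x, ← this]
      congr 1
      push_cast
      module
  have h2 : (WithLp.toLp 2 fun i => (n i : ℝ) : E3)
      = (n 0 : ℝ) • basisVec 0 + (n 1 : ℝ) • basisVec 1 + (n 2 : ℝ) • basisVec 2 := by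
    apply vec_ext <;> simp [basisVec]
  rw [h2, ← h1 0 (n 0) x, ← h1 1 (n 1) (x + (n 0 : ℝ) • (2 * Real.pi) • basisVec 0),
    ← h1 2 (n 2) (x + (n 0 : ℝ) • (2 * Real.pi) • basisVec 0 + (n 1 : ℝ) • (2 * Real.pi) • basisVec 1)]
  congr 1
  module

theorem TorusPeriodic.eq_of_torusProj_eq {F : Type*} {g : E3 → F} (hg : TorusPeriodic g)
    {x y : E3} (h : torusProj x = torusProj y) : g x = g y := by
  have h1 : ∀ i, ∃ k : ℤ, x i = y i + 2 * Real.pi * k := by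
    intro i
    have hi : (((2 * Real.pi)⁻¹ * y i : ℝ) : UnitAddCircle)
      = (((2 * Real.pi)⁻¹ * x i : ℝ) : UnitAddCircle) := (congrFun h i).symm
    rw [QuotientAddGroup.eq, AddSubgroup.mem_zmultiples_iff] at hi
    obtain ⟨k, hk⟩ := hi
    refine ⟨k, ?_⟩
    simp only [zsmul_eq_mul, mul_one] at hk
    field_simp at hk
    linarith
  choose k hk using h1
  rw [← hg.add_lattice y k]
  congr 1
  ext i
  simp [hk]

theorem TorusPeriodic.comp_rep_torusProj {F : Type*} {g : E3 → F} (hg : TorusPeriodic g) (x : E3) :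
    g (rep (torusProj x)) = g x :=
  hg.eq_of_torusProj_eq (torusProj_rep _)

theorem isOpenQuotientMap_torusProj : IsOpenQuotientMap torusProj := by
  have h1 : IsOpenQuotientMap (Pi.map fun (_ : Fin 3) (t : ℝ) => (t : UnitAddCircle)) :=
    IsOpenQuotientMap.piMap fun _ => QuotientAddGroup.isOpenQuotientMap_mk
  have h2 : IsOpenQuotientMap fun x : E3 => fun i => (2 * Real.pi)⁻¹ * x i := by
    have := ((Homeomorph.smulOfNeZero (α := E3) ((2 * Real.pi)⁻¹) (by positivity)).trans
      (EuclideanSpace.equiv (Fin 3) ℝ).toHomeomorph).isOpenQuotientMap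
    exact this
  exact h1.comp h2

/-- Although `rep` jumps at the boundary of the cell, `torusProj` is a quotient map and g ∘ `rep` ∘
`torusProj` = g for periodic g. -/
theorem TorusPeriodic.continuous_comp_rep {F : Type*} [TopologicalSpace F] {g : E3 → F}
    (hg : TorusPeriodic g) (hc : Continuous g) : Continuous (g ∘ rep) := by
  rw [isOpenQuotientMap_torusProj.isQuotientMap.continuous_iff]
  convert! hc using 1
  funext x
  exact hg.comp_rep_torusProj x

theorem TorusPeriodic.bounded {F : Type*} [NormedAddCommGroup F] {g : E3 → F}
    (hg : TorusPeriodic g) (hc : Continuous g) : ∃ C, 0 ≤ C ∧ ∀ x, ‖g x‖ ≤ C := by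
  obtain ⟨C, hC⟩ := isCompact_univ.exists_bound_of_continuousOn
    (hg.continuous_comp_rep hc).continuousOn
  refine ⟨C, (norm_nonneg _).trans (hC 0 trivial), fun x => ?_⟩
  rw [← hg.comp_rep_torusProj x]
  exact hC _ trivial

theorem TorusPeriodic.memLp {F : Type*} [NormedAddCommGroup F] {g : E3 → F}
    (hg : TorusPeriodic g) (hc : Continuous g) {p : ENNReal} : MemLp g p cellProb := by
  obtain ⟨C, -, hC⟩ := hg.bounded hc
  exact MemLp.of_bound hc.aestronglyMeasurable C (Filter.Eventually.of_forall hC)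

theorem TorusPeriodic.integrable {F : Type*} [NormedAddCommGroup F] {g : E3 → F}
    (hg : TorusPeriodic g) (hc : Continuous g) : Integrable g cellProb :=
  memLp_one_iff_integrable.mp (hg.memLp hc)

theorem integral_rep {F : Type*} [NormedAddCommGroup F] [NormedSpace ℝ F] {f : E3 → F}
    (hf : AEStronglyMeasurable f cellProb) : ∫ θ, f (rep θ) = ∫ x, f x ∂cellProb := by
  rw [← measurePreserving_rep.map_eq] at hf ⊢
  exact (integral_map measurable_rep.aemeasurable hf).symm

/-- Integration over the cell of a periodic function is invariant under translations. -/
theorem TorusPeriodic.integral_add {F : Type*} [NormedAddCommGroup F] [NormedSpace ℝ F]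
    {g : E3 → F} (hg : TorusPeriodic g) (hc : Continuous g) (y : E3) :
    ∫ x, g (x + y) ∂cellProb = ∫ x, g x ∂cellProb := by
  rw [← integral_rep hc.aestronglyMeasurable,
    ← integral_rep (f := fun x => g (x + y))
      (hc.comp (continuous_id.add continuous_const)).aestronglyMeasurable,
    ← integral_add_right_eq_self (fun θ => g (rep θ)) (torusProj y)]
  congr 1
  funext θ
  apply hg.eq_of_torusProj_eq
  rw [torusProj_rep, torusProj_add, torusProj_rep]

/-! ### Exponentials and Fourier coefficients -/

section pderiv

variable {F : Type*} [NormedAddCommGroup F] [NormedSpace ℝ F]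

theorem contDiff_pderiv {f : E3 → F} (hf : ContDiff ℝ ∞ f) (i : Fin 3) :
    ContDiff ℝ ∞ (pderiv i f) :=
  (hf.fderiv_right (m := ∞) le_rfl).clm_apply contDiff_const

theorem TorusPeriodic.partialDeriv {f : E3 → F} (hf : TorusPeriodic f) (i : Fin 3) :
    TorusPeriodic (pderiv i f) := by
  intro x j
  have : f = fun x => f (x + (2 * Real.pi) • basisVec j) := funext fun x => (hf x j).symm
  conv_rhs => rw [pderiv, this, fderiv_comp_add_right]
  rfl

theorem hasDerivAt_add_smul_basisVec {f : E3 → F} (hf : ContDiff ℝ ∞ f) (i : Fin 3) (x : E3)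
    (t : ℝ) : HasDerivAt (fun t : ℝ => f (x + t • basisVec i)) (pderiv i f (x + t • basisVec i)) t := by
  have h1 : HasDerivAt (fun t : ℝ => x + t • basisVec i) (basisVec i) t := by
    simpa using ((hasDerivAt_id t).smul_const (basisVec i)).const_add x
  exact ((hf.differentiable (by simp)).differentiableAt.hasFDerivAt).comp_hasDerivAt t h1

/-- The integral of a translate does not depend on the translation; differentiate this under the
integral sign. It replaces integration by parts on the torus. -/
theorem TorusPeriodic.integral_pderiv_eq_zero {g : E3 → F} (hg : TorusPeriodic g)
    (hc : ContDiff ℝ ∞ g) (i : Fin 3) : ∫ x, pderiv i g x ∂cellProb = 0 := by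
  obtain ⟨C, -, hC⟩ := (hg.partialDeriv i).bounded (contDiff_pderiv hc i).continuous
  have h := hasDerivAt_integral_of_dominated_loc_of_deriv_le (μ := cellProb)
    (F := fun (t : ℝ) x => g (x + t • basisVec i)) (F' := fun t x => pderiv i g (x + t • basisVec i))
    (x₀ := 0) (s := Set.univ) (bound := fun _ => C) Filter.univ_mem
    (Filter.Eventually.of_forall fun t =>
      (hc.continuous.comp (continuous_id.add continuous_const)).aestronglyMeasurable)
    (by simpa using hg.integrable hc.continuous)
    ((contDiff_pderiv hc i).continuous.comp
      (continuous_id.add continuous_const)).aestronglyMeasurable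
    (Filter.Eventually.of_forall fun x t _ => hC _) (integrable_const C)
    (Filter.Eventually.of_forall fun x t _ => hasDerivAt_add_smul_basisVec hc i x t)
  have h2 : (fun t : ℝ => ∫ x, g (x + t • basisVec i) ∂cellProb)
      = fun _ => ∫ x, g x ∂cellProb := funext fun t => hg.integral_add hc.continuous _
  have h3 := h.2
  rw [h2] at h3
  simpa using h3.unique (hasDerivAt_const _ _)

end pderiv

theorem ech_zero (x : E3) : ech 0 x = 1 := by simp [ech]

theorem ech_add (m n : Z3) (x : E3) : ech (m + n) x = ech m x * ech n x := by
  rw [ech, ech, ech, ← Complex.exp_add]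
  congr 1
  simp only [Fin.sum_univ_three, Pi.add_apply]
  push_cast
  ring

theorem norm_ech (n : Z3) (x : E3) : ‖ech n x‖ = 1 := Complex.norm_exp_ofReal_mul_I _

theorem conj_ech (n : Z3) (x : E3) : (starRingEnd ℂ) (ech n x) = ech (-n) x := by
  simp only [ech, ← Complex.exp_conj, map_mul, Complex.conj_ofReal, Complex.conj_I]
  congr 1
  simp only [Fin.sum_univ_three, Pi.neg_apply]
  push_cast
  ring

theorem contDiff_ech (n : Z3) : ContDiff ℝ ∞ (ech n) := by
  unfold ech
  have : ContDiff ℝ ∞ fun x : E3 => (∑ i, (n i : ℝ) * x i) := by fun_prop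
  exact ((Complex.ofRealCLM.contDiff.comp this).mul contDiff_const).cexp

theorem continuous_ech (n : Z3) : Continuous (ech n) := (contDiff_ech n).continuous

theorem periodic_ech (n : Z3) : TorusPeriodic (ech n) := by
  intro x i
  rw [ech, ech, Complex.exp_eq_exp_iff_exists_int]
  refine ⟨n i, ?_⟩
  have : ∑ j, (n j : ℝ) * (x + (2 * Real.pi) • basisVec i) j
      = (∑ j, (n j : ℝ) * x j) + 2 * Real.pi * n i := by
    simp only [PiLp.add_apply, PiLp.smul_apply, mul_add, Finset.sum_add_distrib, basisVec,
      smul_eq_mul]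
    congr 1
    rw [Finset.sum_eq_single i]
    · simp; ring
    · intro j _ hj; simp [hj]
    · simp
  rw [this]
  push_cast
  ring

theorem pderiv_ech (n : Z3) (i : Fin 3) (x : E3) :
    pderiv i (ech n) x = Complex.I * n i * ech n x := by
  have h := hasDerivAt_add_smul_basisVec (contDiff_ech n) i x 0
  simp only [zero_smul, add_zero] at h
  refine h.unique ?_
  have h1 : ∀ t : ℝ, ech n (x + t • basisVec i) = ech n x * Complex.exp ((t * n i : ℂ) * Complex.I) := by
    intro t
    rw [ech, ech, ← Complex.exp_add]
    congr 1
    have : ∑ j, (n j : ℝ) * (x + t • basisVec i) j = (∑ j, (n j : ℝ) * x j) + t * n i := by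
      simp only [PiLp.add_apply, PiLp.smul_apply, mul_add, Finset.sum_add_distrib, basisVec,
        smul_eq_mul]
      congr 1
      rw [Finset.sum_eq_single i]
      · simp; ring
      · intro j _ hj; simp [hj]
      · simp
    rw [this]
    push_cast
    ring
  simp only [h1]
  have h2 : HasDerivAt (fun t : ℝ => ((t : ℂ) * n i) * Complex.I) (n i * Complex.I) 0 := by
    simpa using ((Complex.ofRealCLM.hasDerivAt (x := (0 : ℝ))).mul_const (n i : ℂ)).mul_const Complex.I
  convert! (h2.cexp.const_mul (ech n x)) using 1
  simp
  ring

/-- The Fourier coefficients of a function on the cell. -/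
noncomputable def coef {F : Type*} [NormedAddCommGroup F] [NormedSpace ℂ F] (g : E3 → F) (n : Z3) :
    F := ∫ x, ech (-n) x • g x ∂cellProb

section coef

variable {F : Type*} [NormedAddCommGroup F] [NormedSpace ℂ F]

theorem integrable_ech_smul {g : E3 → F} (hg : Integrable g cellProb) (n : Z3) :
    Integrable (fun x => ech n x • g x) cellProb :=
  hg.bdd_smul 1 (continuous_ech n).aestronglyMeasurable
    (Filter.Eventually.of_forall fun x => (norm_ech n x).le)

theorem coef_comp_clm {G : Type*} [NormedAddCommGroup G] [NormedSpace ℂ G] [CompleteSpace F]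
    [CompleteSpace G] (L : F →L[ℂ] G) {g : E3 → F} (hg : Integrable g cellProb) (n : Z3) :
    coef (fun x => L (g x)) n = L (coef g n) := by
  rw [coef, coef, ← L.integral_comp_comm (integrable_ech_smul hg _)]
  simp

theorem coef_apply {g : E3 → C3} (hg : Integrable g cellProb) (n : Z3) (i : Fin 3) :
    coef g n i = coef (fun x => g x i) n :=
  (coef_comp_clm (EuclideanSpace.proj (𝕜 := ℂ) i) hg n).symm

theorem coef_eq_mFourierCoeff {g : E3 → F} (hg : AEStronglyMeasurable g cellProb) (n : Z3) :
    coef g n = UnitAddTorus.mFourierCoeff (g ∘ rep) n := by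
  rw [coef, UnitAddTorus.mFourierCoeff, ← integral_rep]
  · congr 1
    funext θ
    rw [← mFourier_torusProj, torusProj_rep]
    rfl
  · exact (continuous_ech (-n)).aestronglyMeasurable.smul hg

theorem integral_ech (n : Z3) : ∫ x, ech n x ∂cellProb = if n = 0 then 1 else 0 := by
  split_ifs with h
  · simp [h, ech_zero]
  · obtain ⟨i, hi⟩ := Function.ne_iff.mp h
    have := (periodic_ech n).integral_pderiv_eq_zero (contDiff_ech n) i
    simp only [pderiv_ech] at this
    rw [integral_const_mul] at this
    simpa [show n i ≠ 0 from hi] using this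

/-- The derivative of exp(−in·x) g has zero integral; expand it by the product rule. -/
theorem coef_pderiv {g : E3 → F} (hg : TorusPeriodic g) (hc : ContDiff ℝ ∞ g)
    (i : Fin 3) (n : Z3) : coef (pderiv i g) n = (Complex.I * n i) • coef g n := by
  have hp : TorusPeriodic fun x => ech (-n) x • g x := fun x j => by
    simp only [periodic_ech (-n) x j, hg x j]
  have hs : ContDiff ℝ ∞ fun x => ech (-n) x • g x := (contDiff_ech _).smul hc
  have h0 := hp.integral_pderiv_eq_zero hs i
  have h1 : ∀ x, pderiv i (fun x => ech (-n) x • g x) x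
      = ech (-n) x • pderiv i g x - (Complex.I * n i) • (ech (-n) x • g x) := by
    intro x
    have e1 := ((contDiff_ech (-n)).differentiable (by simp)).differentiableAt (x := x)
    have e2 := (hc.differentiable (by simp)).differentiableAt (x := x)
    have e3 := pderiv_ech (-n) i x
    unfold pderiv at e3 ⊢
    rw [fderiv_fun_smul e1 e2]
    simp only [add_apply, smul_apply, ContinuousLinearMap.smulRight_apply, e3, smul_smul]
    rw [sub_eq_add_neg, ← neg_smul]
    congr 2
    simp
  simp only [h1] at h0
  rw [integral_sub (g := fun x => (Complex.I * n i : ℂ) • (ech (-n) x • g x))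
    (integrable_ech_smul ((hg.partialDeriv i).integrable (contDiff_pderiv hc i).continuous) _)
    ((integrable_ech_smul (hg.integrable hc.continuous) _).smul (Complex.I * n i : ℂ)),
    integral_smul, sub_eq_zero] at h0
  exact h0

theorem norm_coef_le {g : E3 → F} {C : ℝ} (hC : ∀ x, ‖g x‖ ≤ C) (n : Z3) : ‖coef g n‖ ≤ C := by
  have := norm_integral_le_of_norm_le_const (μ := cellProb) (f := fun x => ech (-n) x • g x) (C := C)
    (Filter.Eventually.of_forall fun x => by rw [norm_smul, norm_ech, one_mul]; exact hC x)
  simpa [coef] using this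

end coef

theorem memLp_comp_rep {f : E3 → ℂ} (hf : MemLp f 2 cellProb) :
    MemLp (f ∘ rep) 2 (volume : Measure (UnitAddTorus (Fin 3))) :=
  hf.comp_measurePreserving measurePreserving_rep

/-- Parseval's identity, carried from the torus to the cell by the measure-preserving map `rep`. -/
theorem hasSum_conj_coef_mul_coef {f g : E3 → ℂ} (hf : MemLp f 2 cellProb)
    (hg : MemLp g 2 cellProb) :
    HasSum (fun n => (starRingEnd ℂ) (coef f n) * coef g n)
      (∫ x, (starRingEnd ℂ) (f x) * g x ∂cellProb) := by
  have hF := memLp_comp_rep hf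
  have hG := memLp_comp_rep hg
  have h := UnitAddTorus.hasSum_prod_mFourierCoeff (hF.toLp _) (hG.toLp _)
  have e1 : ∀ {k : E3 → ℂ} (hk : MemLp k 2 cellProb) (n : Z3),
      UnitAddTorus.mFourierCoeff ((memLp_comp_rep hk).toLp _) n = coef k n := by
    intro k hk n
    rw [coef_eq_mFourierCoeff hk.1]
    refine integral_congr_ae ?_
    filter_upwards [(memLp_comp_rep hk).coeFn_toLp] with x hx
    rw [hx]
  simp only [e1 hf, e1 hg] at h
  convert! h using 1
  rw [← integral_rep (f := fun x => (starRingEnd ℂ) (f x) * g x)]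
  · refine integral_congr_ae ?_
    filter_upwards [hF.coeFn_toLp, hG.coeFn_toLp] with x hx hy
    rw [hx, hy]; rfl
  · exact (Complex.continuous_conj.comp_aestronglyMeasurable hf.1).mul hg.1

theorem measurePreserving_torusProj : MeasurePreserving torusProj cellProb volume := by
  have hm : Measurable torusProj := isOpenQuotientMap_torusProj.continuous.measurable
  refine ⟨hm, ?_⟩
  rw [← measurePreserving_rep.map_eq, Measure.map_map hm measurable_rep]
  have : torusProj ∘ rep = id := funext torusProj_rep
  rw [this, Measure.map_id]

/-- Riesz–Fischer: the Hilbert basis on the torus supplies the function, pulled back to the cell by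
`torusProj`. -/
theorem exists_memLp_coef_eq {c : Z3 → ℂ} (hc : Summable fun n => ‖c n‖ ^ 2) :
    ∃ f : E3 → ℂ, MemLp f 2 cellProb ∧ ∀ n, coef f n = c n := by
  have hm : Memℓp c 2 := memℓp_gen (by simpa using hc)
  set F := (UnitAddTorus.mFourierBasis (d := Fin 3)).repr.symm ⟨c, hm⟩
  have hF : MemLp (F ∘ torusProj) 2 cellProb :=
    (Lp.memLp F).comp_measurePreserving measurePreserving_torusProj
  refine ⟨F ∘ torusProj, hF, fun n => ?_⟩
  rw [coef_eq_mFourierCoeff hF.1]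
  have : (⇑F ∘ torusProj) ∘ rep = F := by
    funext θ; simp [torusProj_rep]
  rw [this, ← UnitAddTorus.mFourierBasis_repr]
  simp [F]

/-- The exponent 4 exceeds the rank 3 of the lattice; this is why four derivatives are used for the
decay of Fourier coefficients. -/
theorem summable_lattice_rpow : Summable fun n : Z3 => (‖(fun i => (n i : ℝ))‖ ^ 4)⁻¹ := by
  set L : Submodule ℤ (Fin 3 → ℝ) := Submodule.span ℤ (Set.range (Pi.basisFun ℝ (Fin 3)))
  have hr : Module.finrank ℤ L = 3 := by
    rw [ZLattice.rank ℝ L]; simp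
  have h := ZLattice.summable_norm_pow_inv L 4 (by rw [hr]; norm_num)
  have hmem : ∀ n : Z3, (fun i => (n i : ℝ)) ∈ L := by
    intro n
    rw [(Pi.basisFun ℝ (Fin 3)).mem_span_iff_repr_mem ℤ]
    intro i
    exact ⟨n i, by simp⟩
  have hinj : Function.Injective fun n : Z3 => (⟨fun i => (n i : ℝ), hmem n⟩ : L) := by
    intro a b hab
    funext i
    exact Int.cast_injective (α := ℝ) (congrFun (congrArg Subtype.val hab) i)
  simpa [Function.comp_def] using h.comp_injective hinj

theorem summable_norm_coef {F : Type*} [NormedAddCommGroup F] [NormedSpace ℂ F]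
    {g : E3 → F} (hg : TorusPeriodic g) (hc : ContDiff ℝ ∞ g) : Summable fun n => ‖coef g n‖ := by
  have h4 : ∀ i, ∃ C, ∀ n : Z3, ‖(n i : ℝ)‖ ^ 4 * ‖coef g n‖ ≤ C := by
    intro i
    have p1 := hg.partialDeriv i
    have c1 := contDiff_pderiv hc i
    have p2 := p1.partialDeriv i
    have c2 := contDiff_pderiv c1 i
    have p3 := p2.partialDeriv i
    have c3 := contDiff_pderiv c2 i
    obtain ⟨C, -, hC⟩ := (p3.partialDeriv i).bounded (contDiff_pderiv c3 i).continuous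
    refine ⟨C, fun n => ?_⟩
    have := norm_coef_le hC n
    rw [coef_pderiv p3 c3, coef_pderiv p2 c2, coef_pderiv p1 c1, coef_pderiv hg hc] at this
    simp only [norm_smul, norm_mul, Complex.norm_I, one_mul, Complex.norm_intCast] at this
    rw [Real.norm_eq_abs]
    linarith
  choose C hC using h4
  obtain ⟨C0, hC0, hb⟩ := hg.bounded hc.continuous
  have hCn : ∀ i, 0 ≤ C i := fun i => le_trans (by positivity) (hC i 0)
  refine Summable.of_norm_bounded_eventually
    (g := fun n : Z3 => (∑ i, C i) * (‖(fun i => (n i : ℝ))‖ ^ 4)⁻¹)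
    (summable_lattice_rpow.mul_left _) ?_
  rw [Filter.eventually_cofinite]
  refine (Set.finite_singleton (0 : Z3)).subset fun n hn => ?_
  by_contra h0
  apply hn
  have hne : (fun i => (n i : ℝ)) ≠ 0 := by
    intro h
    apply h0
    rw [Set.mem_singleton_iff]
    funext i
    exact Int.cast_injective (α := ℝ) (by simpa using congrFun h i)
  have hpos : 0 < ‖(fun i => (n i : ℝ))‖ := norm_pos_iff.mpr hne
  rw [norm_norm, ← div_eq_mul_inv, le_div_iff₀ (by positivity)]
  -- Four derivatives in the direction of the largest coordinate of n control the fourth power of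
  -- the sup norm of n.
  obtain ⟨i, hi⟩ := Finite.exists_max (fun i => ‖(n i : ℝ)‖)
  have hle : ‖(fun i => (n i : ℝ))‖ ≤ ‖(n i : ℝ)‖ := (pi_norm_le_iff_of_nonneg (norm_nonneg _)).mpr hi
  rw [mul_comm]
  refine (mul_le_mul_of_nonneg_right (pow_le_pow_left₀ (norm_nonneg _) hle 4) (norm_nonneg _)).trans ?_
  exact (hC i n).trans (Finset.single_le_sum (fun i _ => hCn i) (Finset.mem_univ i))

theorem hasSum_coef_smul_ech {g : E3 → ℂ} (hg : TorusPeriodic g) (hc : ContDiff ℝ ∞ g) (x : E3) :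
    HasSum (fun n => coef g n * ech n x) (g x) := by
  set G : C(UnitAddTorus (Fin 3), ℂ) := ⟨g ∘ rep, hg.continuous_comp_rep hc.continuous⟩
  have e : ∀ n, UnitAddTorus.mFourierCoeff G n = coef g n := fun n =>
    (coef_eq_mFourierCoeff hc.continuous.aestronglyMeasurable n).symm
  have h := UnitAddTorus.hasSum_mFourier_series_apply_of_summable (f := G)
    (by simpa only [funext e] using (summable_norm_coef hg hc).of_norm) (torusProj x)
  simp only [e, mFourier_torusProj, smul_eq_mul] at h
  convert! h using 1
  exact (hg.comp_rep_torusProj x).symm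

/-! ### The bilinear pairing -/

theorem cdot_comm' (a b : C3) : cdot a b = cdot b a := by
  simp only [cdot]; exact Finset.sum_congr rfl fun i _ => mul_comm _ _

theorem cdot_add_right (a b c : C3) : cdot a (b + c) = cdot a b + cdot a c := by
  simp [cdot, mul_add, Finset.sum_add_distrib]

theorem cdot_add_left (a b c : C3) : cdot (a + b) c = cdot a c + cdot b c := by
  simp [cdot, add_mul, Finset.sum_add_distrib]

theorem cdot_sub_left (a b c : C3) : cdot (a - b) c = cdot a c - cdot b c := by
  simp [cdot, sub_mul, Finset.sum_sub_distrib]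

theorem cdot_smul_right (t : ℂ) (a b : C3) : cdot a (t • b) = t * cdot a b := by
  simp [cdot, Finset.mul_sum, mul_left_comm]

theorem cdot_smul_left (t : ℂ) (a b : C3) : cdot (t • a) b = t * cdot a b := by
  simp [cdot, Finset.mul_sum, mul_assoc]

@[simp] theorem cdot_zero_left (a : C3) : cdot 0 a = 0 := by simp [cdot]

@[simp] theorem cdot_zero_right (a : C3) : cdot a 0 = 0 := by simp [cdot]

theorem cross_cross_eq (a b c : C3) :
    cross a (cross b c) = cdot a c • b - cdot a b • c := by
  apply vec_ext <;>
  simp only [cross_apply_zero, cross_apply_one, cross_apply_two, cdot, Fin.sum_univ_three,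
    PiLp.sub_apply, PiLp.smul_apply, smul_eq_mul] <;> ring

theorem cdot_cross_self (a b : C3) : cdot a (cross a b) = 0 := by
  simp only [cross_apply_zero, cross_apply_one, cross_apply_two, cdot, Fin.sum_univ_three]
  ring

theorem cdot_cross_right (a b c : C3) : cdot a (cross b c) = -cdot (cross b a) c := by
  simp only [cross_apply_zero, cross_apply_one, cross_apply_two, cdot, Fin.sum_univ_three]
  ring

theorem eq_zero_of_cdot_eq_zero {a : C3} (h : ∀ e, cdot a e = 0) : a = 0 := by
  ext i
  have := h (EuclideanSpace.single i 1)
  rw [cdot, Finset.sum_eq_single i] at this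
  · simpa using this
  · intro j _ hj; simp [hj]
  · simp

theorem cdot_latVec (m : Z3) (v : C3) : cdot (latVec m) v = inner ℂ (latVec m) v := by
  simp [cdot, PiLp.inner_apply, mul_comm]

theorem inner_eq_sum (a b : C3) : inner ℂ a b = ∑ i, (starRingEnd ℂ) (a i) * b i := by
  simp [PiLp.inner_apply, mul_comm]

/-! ### The Fourier coefficients of the velocity field -/

/-- The Fourier coefficients of a real field. -/
noncomputable def uhat (U : E3 → E3) : Z3 → C3 := coef fun x => toC3 (U x)

section uhat

variable {U : E3 → E3}

theorem contDiff_toC3 (hU : ContDiff ℝ ∞ U) : ContDiff ℝ ∞ fun x => toC3 (U x) :=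
  toC3CLM.contDiff.comp hU

theorem periodic_toC3 (hU : TorusPeriodic U) : TorusPeriodic fun x => toC3 (U x) :=
  fun x i => by simp only [hU x i]

theorem pderiv_toC3 (hU : ContDiff ℝ ∞ U) (i : Fin 3) (x : E3) :
    pderiv i (fun x => toC3 (U x)) x = toC3 (pderiv i U x) := by
  have := (toC3CLM.hasFDerivAt (x := U x)).comp x
    (hU.differentiable (by simp)).differentiableAt.hasFDerivAt
  unfold pderiv
  rw [show (fun x => toC3 (U x)) = toC3CLM ∘ U from rfl, this.fderiv]
  rfl

theorem pderiv_apply {𝕜 : Type*} [RCLike 𝕜] {f : E3 → EuclideanSpace 𝕜 (Fin 3)} {x : E3}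
    (hf : DifferentiableAt ℝ f x) (i j : Fin 3) :
    pderiv i (fun x => f x j) x = pderiv i f x j := by
  have := ((PiLp.proj 2 (𝕜 := ℝ) (fun _ : Fin 3 => 𝕜) j).hasFDerivAt (x := f x)).comp x
    hf.hasFDerivAt
  unfold pderiv
  rw [show (fun x => f x j) = PiLp.proj 2 (𝕜 := ℝ) (fun _ : Fin 3 => 𝕜) j ∘ f from rfl, this.fderiv]
  rfl

theorem summable_uhat (hp : TorusPeriodic U) (hU : ContDiff ℝ ∞ U) :
    Summable fun n => ‖uhat U n‖ :=
  summable_norm_coef (periodic_toC3 hp) (contDiff_toC3 hU)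

theorem integrable_toC3 (hp : TorusPeriodic U) (hU : ContDiff ℝ ∞ U) :
    Integrable (fun x => toC3 (U x)) cellProb :=
  (periodic_toC3 hp).integrable (contDiff_toC3 hU).continuous

theorem hasSum_ech_smul_uhat (hp : TorusPeriodic U) (hU : ContDiff ℝ ∞ U) (x : E3) :
    HasSum (fun n => ech n x • uhat U n) (toC3 (U x)) := by
  have hc : ∀ i, HasSum (fun n => (ech n x • uhat U n) i) (toC3 (U x) i) := by
    intro i
    have h1 : TorusPeriodic fun x => toC3 (U x) i := fun x j => by simp only [hp x j]
    have h2 : ContDiff ℝ ∞ fun x => toC3 (U x) i :=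
      (EuclideanSpace.proj (𝕜 := ℂ) i).restrictScalars ℝ |>.contDiff.comp (contDiff_toC3 hU)
    convert! hasSum_coef_smul_ech h1 h2 x using 2 with n
    rw [PiLp.smul_apply, smul_eq_mul, mul_comm, uhat, coef_apply (integrable_toC3 hp hU)]
  have := (Pi.hasSum (f := fun n i => (ech n x • uhat U n) i)).mpr hc
  exact this.mapL ((EuclideanSpace.equiv (Fin 3) ℂ).symm : (Fin 3 → ℂ) →L[ℂ] C3)

theorem conj_uhat (hp : TorusPeriodic U) (hU : ContDiff ℝ ∞ U) (n : Z3) (i : Fin 3) :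
    (starRingEnd ℂ) (uhat U n i) = uhat U (-n) i := by
  rw [uhat, coef_apply (integrable_toC3 hp hU), coef_apply (integrable_toC3 hp hU), coef, coef,
    ← integral_conj]
  congr 1
  funext x
  simp only [smul_eq_mul, map_mul, conj_ech, toC3_apply, Complex.conj_ofReal]

theorem coef_pderiv_toC3 (hp : TorusPeriodic U) (hU : ContDiff ℝ ∞ U) (i : Fin 3) (n : Z3) :
    coef (fun x => toC3 (pderiv i U x)) n = (Complex.I * n i) • uhat U n := by
  rw [uhat, ← coef_pderiv (periodic_toC3 hp) (contDiff_toC3 hU)]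
  congr 1
  funext x
  rw [pderiv_toC3 hU]

theorem cdot_latVec_uhat (hp : TorusPeriodic U) (hU : ContDiff ℝ ∞ U)
    (hdiv : ∀ x, divergence U x = 0) (n : Z3) : cdot (latVec n) (uhat U n) = 0 := by
  have h1 : ∀ i, (Complex.I * n i) * uhat U n i = coef (fun x => ((pderiv i U x i : ℝ) : ℂ)) n := by
    intro i
    rw [← smul_eq_mul, ← PiLp.smul_apply, ← coef_pderiv_toC3 hp hU, coef_apply]
    · rfl
    · exact integrable_toC3 (hp.partialDeriv i) (contDiff_pderiv hU i)
  have h2 : ∑ i, coef (fun x => ((pderiv i U x i : ℝ) : ℂ)) n = 0 := by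
    simp only [coef]
    rw [← integral_finsetSum]
    · rw [← integral_zero E3 ℂ (μ := cellProb)]
      congr 1
      funext x
      rw [← Finset.smul_sum]
      have := hdiv x
      rw [divergence] at this
      have h3 : ∑ i, ((pderiv i U x i : ℝ) : ℂ) = 0 := by
        rw [← Complex.ofReal_sum, ← Complex.ofReal_zero, ← this]
        congr 1
        refine Finset.sum_congr rfl fun i _ => ?_
        rw [pderiv_apply (hU.differentiable (by simp)).differentiableAt]
      rw [h3, smul_zero]
    · intro i _
      apply integrable_ech_smul
      have := integrable_toC3 (hp.partialDeriv i) (contDiff_pderiv hU i)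
      exact (EuclideanSpace.proj (𝕜 := ℂ) i).integrable_comp this
  have h4 : Complex.I * cdot (latVec n) (uhat U n) = 0 := by
    rw [cdot, Finset.mul_sum, ← h2]
    refine Finset.sum_congr rfl fun i _ => ?_
    rw [← h1, latVec_apply]; ring
  exact (mul_eq_zero.mp h4).resolve_left Complex.I_ne_zero

/-- The derivative of a real field in a complex direction. -/
noncomputable def complexDeriv (U : E3 → E3) (x : E3) (z : C3) : C3 :=
  ∑ i, z i • toC3 (pderiv i U x)

/-- A real matrix acts separately on real and imaginary parts, and these add by Pythagoras, so
complexification does not increase the operator norm. -/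
theorem norm_complexDeriv_le {c : ℝ} (hc : ∀ x, ‖fderiv ℝ U x‖ ≤ c) (x : E3) (z : C3) :
    ‖complexDeriv U x z‖ ≤ c * ‖z‖ := by
  have hc0 : 0 ≤ c := (norm_nonneg _).trans (hc x)
  set a : E3 := WithLp.toLp 2 fun i => (z i).re
  set b : E3 := WithLp.toLp 2 fun i => (z i).im
  have hlin : ∀ y : E3, fderiv ℝ U x y = ∑ i, y i • pderiv i U x := by
    intro y
    have : y = ∑ i, y i • basisVec i := by
      apply vec_ext <;> simp [Fin.sum_univ_three, basisVec]
    conv_lhs => rw [this, map_sum]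
    simp [pderiv]
  have hz : complexDeriv U x z = toC3 (fderiv ℝ U x a) + Complex.I • toC3 (fderiv ℝ U x b) := by
    rw [hlin, hlin]
    ext j
    simp only [complexDeriv, Fin.sum_univ_three, PiLp.add_apply, PiLp.smul_apply, smul_eq_mul,
      toC3_apply, a, b]
    conv_lhs => rw [← Complex.re_add_im (z 0), ← Complex.re_add_im (z 1), ← Complex.re_add_im (z 2)]
    push_cast
    ring
  have hsq : ∀ p q : E3, ‖toC3 p + Complex.I • toC3 q‖ ^ 2 = ‖p‖ ^ 2 + ‖q‖ ^ 2 := by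
    intro p q
    simp only [EuclideanSpace.norm_sq_eq, PiLp.add_apply, PiLp.smul_apply, toC3_apply, smul_eq_mul,
      ← Finset.sum_add_distrib]
    refine Finset.sum_congr rfl fun i _ => ?_
    rw [← Complex.normSq_eq_norm_sq, mul_comm, Complex.normSq_add_mul_I]
    simp
  have hz2 : ‖z‖ ^ 2 = ‖a‖ ^ 2 + ‖b‖ ^ 2 := by
    rw [← hsq]
    congr 2
    ext i
    simp only [PiLp.add_apply, PiLp.smul_apply, toC3_apply, smul_eq_mul, a, b]
    rw [mul_comm, Complex.re_add_im]
  have h1 : ∀ y : E3, ‖fderiv ℝ U x y‖ ^ 2 ≤ c ^ 2 * ‖y‖ ^ 2 := fun y => by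
    rw [← mul_pow]
    gcongr
    exact (fderiv ℝ U x).le_of_opNorm_le (hc x) y
  refine abs_le_of_sq_le_sq' ?_ (by positivity) |>.2
  rw [hz, hsq, mul_pow, hz2]
  linarith [h1 a, h1 b]

end uhat

/-! ### Coercivity of the cell problem -/

theorem ofReal_norm_sq {E : Type*} [NormedAddCommGroup E] [InnerProductSpace ℂ E] (v : E) :
    ((‖v‖ ^ 2 : ℝ) : ℂ) = inner ℂ v v := by
  rw [inner_self_eq_norm_sq_to_K]; norm_cast

section coercivity

variable {U : E3 → E3}

/-- A trigonometric polynomial. -/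
noncomputable def trigPoly (T : Finset Z3) (s : Z3 → C3) (x : E3) : C3 := ∑ m ∈ T, ech m x • s m

theorem continuous_trigPoly (T : Finset Z3) (s : Z3 → C3) : Continuous (trigPoly T s) := by
  unfold trigPoly
  exact continuous_finsetSum _ fun m _ => (continuous_ech m).smul continuous_const

theorem inner_trigPoly_left (T : Finset Z3) (s : Z3 → C3) (x : E3) (z : C3) :
    inner ℂ (trigPoly T s x) z = ∑ m ∈ T, ech (-m) x * inner ℂ (s m) z := by
  rw [trigPoly, sum_inner]
  exact Finset.sum_congr rfl fun m _ => by rw [inner_smul_left, conj_ech]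

theorem integral_norm_sq_trigPoly (T : Finset Z3) (s : Z3 → C3) :
    ∫ x, ‖trigPoly T s x‖ ^ 2 ∂cellProb = ∑ m ∈ T, ‖s m‖ ^ 2 := by
  have h : ∀ x, ((‖trigPoly T s x‖ ^ 2 : ℝ) : ℂ)
      = ∑ m ∈ T, ∑ k ∈ T, inner ℂ (s m) (s k) * ech (k - m) x := by
    intro x
    rw [ofReal_norm_sq, inner_trigPoly_left]
    refine Finset.sum_congr rfl fun m _ => ?_
    rw [trigPoly, inner_sum, Finset.mul_sum]
    refine Finset.sum_congr rfl fun k _ => ?_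
    rw [inner_smul_right, sub_eq_add_neg, ech_add]
    ring
  have h2 : ((∫ x, ‖trigPoly T s x‖ ^ 2 ∂cellProb : ℝ) : ℂ) = ((∑ m ∈ T, ‖s m‖ ^ 2 : ℝ) : ℂ) := by
    rw [← integral_complex_ofReal]
    simp only [h]
    rw [integral_finsetSum]
    · rw [Complex.ofReal_sum]
      refine Finset.sum_congr rfl fun m hm => ?_
      rw [integral_finsetSum]
      · rw [Finset.sum_eq_single_of_mem m hm]
        · rw [integral_const_mul, integral_ech, if_pos (sub_self m), mul_one, ofReal_norm_sq]
        · intro k _ hk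
          rw [integral_const_mul, integral_ech, if_neg (sub_ne_zero.mpr hk), mul_zero]
      · intro k _
        exact ((periodic_ech _).integrable (continuous_ech _)).const_mul _
    · intro m _
      exact integrable_finsetSum _ fun k _ =>
        ((periodic_ech _).integrable (continuous_ech _)).const_mul _
  exact_mod_cast h2

/-- The left side is ∫ S̄ · (S·∇)U for a trigonometric polynomial S. Expanding leaves the Fourier
coefficients of ∇U at the differences m − k. -/
theorem integral_inner_complexDeriv (hp : TorusPeriodic U) (hU : ContDiff ℝ ∞ U) (T : Finset Z3)
    (s : Z3 → C3) :
    ∫ x, inner ℂ (trigPoly T s x) (complexDeriv U x (trigPoly T s x)) ∂cellProb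
      = ∑ m ∈ T, ∑ k ∈ T, Complex.I * cdot (latVec (m - k)) (s k)
          * inner ℂ (s m) (uhat U (m - k)) := by
  have hint : ∀ i, Integrable (fun x => toC3 (pderiv i U x)) cellProb := fun i =>
    integrable_toC3 (hp.partialDeriv i) (contDiff_pderiv hU i)
  have h : ∀ x, inner ℂ (trigPoly T s x) (complexDeriv U x (trigPoly T s x))
      = ∑ m ∈ T, ∑ k ∈ T, ∑ i, s k i * inner ℂ (s m) (ech (-(m - k)) x • toC3 (pderiv i U x)) := by
    intro x
    rw [inner_trigPoly_left]
    refine Finset.sum_congr rfl fun m _ => ?_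
    rw [complexDeriv, inner_sum, Finset.mul_sum, Finset.sum_comm]
    refine Finset.sum_congr rfl fun i _ => ?_
    have : trigPoly T s x i = ∑ k ∈ T, ech k x * s k i := by
      simp [trigPoly]
    rw [this, Finset.sum_smul, inner_sum, Finset.mul_sum]
    refine Finset.sum_congr rfl fun k _ => ?_
    rw [inner_smul_right, inner_smul_right, neg_sub, sub_eq_add_neg, ech_add]
    ring
  have hI : ∀ m k i, Integrable (fun x => s k i * inner ℂ (s m)
      (ech (-(m - k)) x • toC3 (pderiv i U x))) cellProb := fun m k i =>
    ((integrable_ech_smul (hint i) _).const_inner (s m)).const_mul _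
  simp only [h]
  rw [integral_finsetSum _ fun m _ => integrable_finsetSum _ fun k _ =>
    integrable_finsetSum _ fun i _ => hI m k i]
  refine Finset.sum_congr rfl fun m _ => ?_
  rw [integral_finsetSum _ fun k _ => integrable_finsetSum _ fun i _ => hI m k i]
  refine Finset.sum_congr rfl fun k _ => ?_
  rw [integral_finsetSum _ fun i _ => hI m k i, cdot, Finset.mul_sum, Finset.sum_mul]
  refine Finset.sum_congr rfl fun i _ => ?_
  rw [integral_const_mul, integral_inner (integrable_ech_smul (hint i) _)]
  have : ∫ x, ech (-(m - k)) x • toC3 (pderiv i U x) ∂cellProb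
      = (Complex.I * (m - k) i) • uhat U (m - k) := coef_pderiv_toC3 hp hU i (m - k)
  rw [this, inner_smul_right, latVec_apply]
  ring

/-- The double sum is the pairing of S with (U·∇)S. Conjugating and exchanging m and k changes its
sign, because û(−n) is the conjugate of û(n) and (m − k)·û(m − k) = 0. -/
theorem re_sum_advection_eq_zero (hp : TorusPeriodic U) (hU : ContDiff ℝ ∞ U)
    (hdiv : ∀ x, divergence U x = 0) (T : Finset Z3) (s : Z3 → C3) :
    (∑ m ∈ T, ∑ k ∈ T, Complex.I * cdot (latVec m) (uhat U (m - k)) * inner ℂ (s m) (s k)).re = 0 := by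
  set Y := ∑ m ∈ T, ∑ k ∈ T, Complex.I * cdot (latVec m) (uhat U (m - k)) * inner ℂ (s m) (s k)
    with hY
  have hconj : (starRingEnd ℂ) Y = -Y := by
    rw [hY, map_sum, Finset.sum_congr rfl fun m _ => map_sum _ _ _, Finset.sum_comm,
      ← Finset.sum_neg_distrib]
    refine Finset.sum_congr rfl fun m _ => ?_
    rw [← Finset.sum_neg_distrib]
    refine Finset.sum_congr rfl fun k _ => ?_
    have h1 : (starRingEnd ℂ) (cdot (latVec k) (uhat U (k - m)))
        = cdot (latVec m) (uhat U (m - k)) := by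
      have h2 : (starRingEnd ℂ) (cdot (latVec k) (uhat U (k - m)))
          = cdot (latVec k) (uhat U (m - k)) := by
        simp only [cdot, map_sum, map_mul, conj_uhat hp hU, latVec_apply, neg_sub]
        simp
      have h3 := cdot_latVec_uhat hp hU hdiv (m - k)
      rw [latVec_sub, cdot_sub_left, sub_eq_zero] at h3
      rw [h2, h3]
    rw [map_mul, map_mul, h1, Complex.conj_I, inner_conj_symm]
    ring
  have := congrArg Complex.re hconj
  simp only [Complex.conj_re, Complex.neg_re] at this
  linarith

/-- By the double cross product formula i m × (û(m−k) × s(k)) splits into i (m·s(k)) û(m−k), where m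
may be replaced by m − k since k·s(k) = 0, and an advection term. The first is the stretching
(S·∇)U, bounded by ‖∇U‖; the second is skew. -/
theorem re_sum_inner_le (hp : TorusPeriodic U) (hU : ContDiff ℝ ∞ U)
    (hdiv : ∀ x, divergence U x = 0) {c : ℝ} (hc : ∀ x, ‖fderiv ℝ U x‖ ≤ c) (T : Finset Z3)
    (s : Z3 → C3) (hs : ∀ m, cdot (latVec m) (s m) = 0) :
    (∑ m ∈ T, ∑ k ∈ T, inner ℂ (s m)
      (Complex.I • cross (latVec m) (cross (uhat U (m - k)) (s k)))).re
      ≤ c * ∑ m ∈ T, ‖s m‖ ^ 2 := by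
  have h1 : ∀ m k, inner ℂ (s m) (Complex.I • cross (latVec m) (cross (uhat U (m - k)) (s k)))
      = Complex.I * cdot (latVec (m - k)) (s k) * inner ℂ (s m) (uhat U (m - k))
        - Complex.I * cdot (latVec m) (uhat U (m - k)) * inner ℂ (s m) (s k) := by
    intro m k
    rw [cross_cross_eq, latVec_sub, cdot_sub_left, hs k, sub_zero, inner_smul_right, inner_sub_right,
      inner_smul_right, inner_smul_right]
    ring
  simp only [h1, Finset.sum_sub_distrib, Complex.sub_re]
  rw [re_sum_advection_eq_zero hp hU hdiv, sub_zero, ← integral_inner_complexDeriv hp hU,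
    ← integral_norm_sq_trigPoly, ← integral_const_mul]
  have hcont : Continuous fun x => ‖trigPoly T s x‖ ^ 2 := (continuous_trigPoly T s).norm.pow 2
  refine (Complex.re_le_norm _).trans ((norm_integral_le_integral_norm _).trans ?_)
  have hper : TorusPeriodic (trigPoly T s) := fun x i => by
    simp only [trigPoly, periodic_ech _ x i]
  refine integral_mono_of_nonneg (Filter.Eventually.of_forall fun x => norm_nonneg _)
    ((TorusPeriodic.integrable (fun x i => by simp only [hper x i]) hcont).const_mul c)
    (Filter.Eventually.of_forall fun x => ?_)
  refine (norm_inner_le_norm _ _).trans ?_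
  calc ‖trigPoly T s x‖ * ‖complexDeriv U x (trigPoly T s x)‖
      ≤ ‖trigPoly T s x‖ * (c * ‖trigPoly T s x‖) := by
        gcongr
        exact norm_complexDeriv_le hc x _
    _ = c * ‖trigPoly T s x‖ ^ 2 := by ring

end coercivity

/-! ### The operators of the cell problem -/

theorem norm_ofReal_smul_id_le {r C : ℝ} (h0 : 0 ≤ r) (h : r ≤ C) :
    ‖(r : ℂ) • ContinuousLinearMap.id ℂ C3‖ ≤ C := by
  rw [norm_smul, Complex.norm_real, Real.norm_of_nonneg h0]
  calc r * ‖ContinuousLinearMap.id ℂ C3‖ ≤ r * 1 := by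
        gcongr; exact ContinuousLinearMap.norm_id_le
    _ ≤ C := by linarith

/-- Division by the length of the frequency. -/
noncomputable def invNormOp : Seq →L[ℂ] Seq :=
  diagOp (fun m => ((‖latVec m‖⁻¹ : ℝ) : ℂ) • ContinuousLinearMap.id ℂ C3) 1 zero_le_one
    fun m => norm_ofReal_smul_id_le (by positivity) (inv_norm_latVec_le_one m)

theorem invNormOp_apply (w : Seq) (m : Z3) :
    invNormOp w m = ((‖latVec m‖⁻¹ : ℝ) : ℂ) • w m := rfl

/-- The normalized curl `(i m / |m|) ×`. -/
noncomputable def unitCurlOp : Seq →L[ℂ] Seq :=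
  diagOp (fun m => (Complex.I * ((‖latVec m‖⁻¹ : ℝ) : ℂ)) • crossCLM ℂ (latVec m)) ‖crossCLM ℂ‖
    (crossCLM ℂ).opNorm_nonneg fun m => by
      rw [norm_smul, norm_mul, Complex.norm_I, one_mul, Complex.norm_real,
        Real.norm_of_nonneg (by positivity)]
      rcases eq_or_ne m 0 with rfl | hm
      · rw [latVec_zero, map_zero]
        simp only [norm_zero, mul_zero]
        exact (crossCLM ℂ).opNorm_nonneg
      · have h1 := one_le_norm_latVec hm
        calc ‖latVec m‖⁻¹ * ‖crossCLM ℂ (latVec m)‖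
            ≤ ‖latVec m‖⁻¹ * (‖crossCLM ℂ‖ * ‖latVec m‖) := by
              gcongr; exact (crossCLM ℂ).le_opNorm _
          _ = ‖crossCLM ℂ‖ := by field_simp

theorem unitCurlOp_apply (w : Seq) (m : Z3) :
    unitCurlOp w m = (Complex.I * ((‖latVec m‖⁻¹ : ℝ) : ℂ)) • cross (latVec m) (w m) := rfl

/-- The orthogonal projection on the divergence-free sequences. -/
noncomputable def divFreeProj : Seq →L[ℂ] Seq :=
  diagOp (fun m => (Submodule.span ℂ {latVec m})ᗮ.starProjection) 1 zero_le_one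
    fun _ => Submodule.starProjection_norm_le _

theorem divFreeProj_apply (w : Seq) (m : Z3) :
    divFreeProj w m = (Submodule.span ℂ {latVec m})ᗮ.starProjection (w m) := rfl

theorem cdot_divFreeProj (w : Seq) (m : Z3) : cdot (latVec m) (divFreeProj w m) = 0 := by
  rw [cdot_latVec, divFreeProj_apply]
  exact Submodule.mem_orthogonal_singleton_iff_inner_right.mp (Submodule.starProjection_apply_mem _ _)

theorem divFreeProj_eq_self {w : Seq} (hw : ∀ m, cdot (latVec m) (w m) = 0) : divFreeProj w = w := by
  ext m : 2
  rw [divFreeProj_apply, Submodule.starProjection_eq_self_iff,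
    Submodule.mem_orthogonal_singleton_iff_inner_right, ← cdot_latVec]
  exact hw m

theorem divFreeProj_idem (w : Seq) : divFreeProj (divFreeProj w) = divFreeProj w :=
  divFreeProj_eq_self (cdot_divFreeProj w)

theorem inner_divFreeProj (v w : Seq) : inner ℂ (divFreeProj v) w = inner ℂ v (divFreeProj w) := by
  rw [lp.inner_eq_tsum, lp.inner_eq_tsum]
  congr 1
  funext m
  exact Submodule.inner_starProjection_left_eq_right _ _ _

theorem norm_divFreeProj_apply_le (w : Seq) (m : Z3) : ‖divFreeProj w m‖ ≤ ‖w m‖ :=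
  ((Submodule.span ℂ {latVec m})ᗮ.starProjection.le_of_opNorm_le
    (Submodule.starProjection_norm_le _) _).trans_eq (one_mul _)

/-- The operator `w ↦ (i m / |m|) × (u * (w / |m|))`. -/
noncomputable def cellOp (u : Z3 → C3) : Seq →L[ℂ] Seq := unitCurlOp ∘L convOp u ∘L invNormOp

theorem cellOp_apply (u : Z3 → C3) (w : Seq) (m : Z3) :
    cellOp u w m = (Complex.I * ((‖latVec m‖⁻¹ : ℝ) : ℂ)) •
      cross (latVec m) (convOp u (invNormOp w) m) := rfl

theorem cdot_unitCurlOp (w : Seq) (m : Z3) : cdot (latVec m) (unitCurlOp w m) = 0 := by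
  rw [unitCurlOp_apply, cdot_smul_right, cdot_cross_self, mul_zero]

theorem divFreeProj_cellOp (u : Z3 → C3) (w : Seq) : divFreeProj (cellOp u w) = cellOp u w :=
  divFreeProj_eq_self (cdot_unitCurlOp _)

theorem convOp_apply_of_finite {u : Z3 → C3} (hu : Summable fun l => ‖u l‖) {T : Finset Z3}
    {s : Seq} (hs : ∀ m ∉ T, s m = 0) (m : Z3) :
    convOp u s m = ∑ k ∈ T, cross (u (m - k)) (s k) := by
  have h := hasSum_convOp hu s m
  rw [← (Equiv.subLeft m).hasSum_iff] at h
  refine h.unique ?_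
  have h2 : ((fun l => cross (u l) (s (m - l))) ∘ ⇑(Equiv.subLeft m))
      = fun k => cross (u (m - k)) (s k) := by
    funext k
    simp
  rw [h2]
  exact hasSum_sum_of_ne_finset_zero fun k hk => by rw [hs k hk, cross_zero_right]

section

variable {U : E3 → E3} {c : ℝ}

/-- With s = P w/|m| and P = `divFreeProj`, the pairing is that of s with the coefficients of ∇ × (U
× s), because `cellOp` has divergence-free values. The stretching bound applies and |s(m)| ≤ |w(m)|.
-/
theorem re_inner_cellOp_le (hp : TorusPeriodic U) (hU : ContDiff ℝ ∞ U)
    (hdiv : ∀ x, divergence U x = 0) (hc : ∀ x, ‖fderiv ℝ U x‖ ≤ c) (w : Seq) :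
    (inner ℂ w (cellOp (uhat U) (divFreeProj w))).re ≤ c * ‖w‖ ^ 2 := by
  have hc0 : 0 ≤ c := (norm_nonneg _).trans (hc 0)
  have hfin : ∀ T : Finset Z3, ∀ w : Seq, (∀ m ∉ T, w m = 0) →
      (inner ℂ w (cellOp (uhat U) (divFreeProj w))).re ≤ c * ‖w‖ ^ 2 := by
    intro T w hw
    have hPw : ∀ m ∉ T, divFreeProj w m = 0 := fun m hm => by
      rw [divFreeProj_apply, hw m hm, map_zero]
    set s : Seq := invNormOp (divFreeProj w)
    have hs : ∀ m ∉ T, s m = 0 := fun m hm => by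
      simp only [s]; rw [invNormOp_apply, hPw m hm, smul_zero]
    have hsd : ∀ m, cdot (latVec m) (s m) = 0 := fun m => by
      simp only [s]; rw [invNormOp_apply, cdot_smul_right, cdot_divFreeProj, mul_zero]
    rw [← divFreeProj_cellOp, ← inner_divFreeProj, lp.inner_eq_tsum,
      tsum_eq_sum (s := T) fun m hm => by rw [hPw m hm, inner_zero_left]]
    have h1 : ∀ m ∈ T, inner ℂ (divFreeProj w m) (cellOp (uhat U) (divFreeProj w) m)
        = ∑ k ∈ T, inner ℂ (s m)
      (Complex.I • cross (latVec m) (cross (uhat U (m - k)) (s k))) := by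
      intro m _
      rw [cellOp_apply, convOp_apply_of_finite (summable_uhat hp hU) hs, ← crossCLM_apply, map_sum,
        Finset.smul_sum, inner_sum]
      refine Finset.sum_congr rfl fun k _ => ?_
      simp only [s]
      rw [invNormOp_apply _ m, inner_smul_left, Complex.conj_ofReal, inner_smul_right, crossCLM_apply,
        inner_smul_right]
      ring
    rw [Finset.sum_congr rfl h1]
    refine (re_sum_inner_le hp hU hdiv hc T s hsd).trans ?_
    gcongr
    rw [seq_norm_sq]
    refine le_trans ?_ ((summable_seq w).sum_le_tsum T fun m _ => by positivity)
    refine Finset.sum_le_sum fun m _ => ?_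
    have : ‖s m‖ ≤ ‖w m‖ := by
      simp only [s]
      rw [invNormOp_apply, norm_smul, Complex.norm_real, Real.norm_of_nonneg (by positivity)]
      calc ‖latVec m‖⁻¹ * ‖divFreeProj w m‖ ≤ 1 * ‖w m‖ := by
            gcongr
            · exact inv_norm_latVec_le_one m
            · exact norm_divFreeProj_apply_le w m
        _ = _ := one_mul _
    gcongr
  -- Finitely supported sequences are dense and both sides of the inequality are continuous.
  have hlim := lp.hasSum_single (p := 2) (by norm_num) w
  have hcl : IsClosed {w : Seq | (inner ℂ w (cellOp (uhat U) (divFreeProj w))).re ≤ c * ‖w‖ ^ 2} := by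
    refine isClosed_le ?_ (by fun_prop)
    exact Complex.continuous_re.comp (continuous_id.inner
      ((cellOp (uhat U)).continuous.comp divFreeProj.continuous))
  refine hcl.mem_of_tendsto hlim (Filter.Eventually.of_forall fun T => ?_)
  refine hfin T _ fun m hm => ?_
  rw [lp.coeFn_sum, Finset.sum_apply]
  exact Finset.sum_eq_zero fun k hk => lp.single_apply_ne _ _ _ (by rintro rfl; exact hm hk)

/-- Lax–Milgram: Re⟨w, (1 − cellOp P)w⟩ ≥ (1 − c)‖w‖² with c < 1. The projection P is inserted
because the stretching bound holds only on divergence-free fields. -/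
theorem isUnit_one_sub_cellOp_comp (hp : TorusPeriodic U) (hU : ContDiff ℝ ∞ U)
    (hdiv : ∀ x, divergence U x = 0) (hc1 : c < 1) (hc : ∀ x, ‖fderiv ℝ U x‖ ≤ c) :
    IsUnit (1 - cellOp (uhat U) ∘L divFreeProj) := by
  refine ContinuousLinearMap.isUnit_of_forall_le_norm_inner_map _ (c := ⟨1 - c, by linarith⟩)
    (by change (0 : ℝ) < 1 - c; linarith) fun w => ?_
  have h := re_inner_cellOp_le hp hU hdiv hc w
  rw [norm_inner_symm]
  refine le_trans ?_ (Complex.re_le_norm _)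
  change ‖w‖ ^ 2 * (1 - c) ≤ (inner ℂ w (w - cellOp (uhat U) (divFreeProj w))).re
  rw [inner_sub_right, Complex.sub_re]
  have : (inner ℂ w w).re = ‖w‖ ^ 2 := by
    rw [← ofReal_norm_sq, Complex.ofReal_re]
  rw [this]
  linarith

/-- `cellOp` takes divergence-free values, so 1 − cellOp is triangular for the splitting by P =
`divFreeProj`: it agrees with 1 − cellOp P on the range of P and induces the identity on the
quotient. -/
theorem bijective_one_sub_cellOp (hp : TorusPeriodic U) (hU : ContDiff ℝ ∞ U)
    (hdiv : ∀ x, divergence U x = 0) (hc1 : c < 1) (hc : ∀ x, ‖fderiv ℝ U x‖ ≤ c) :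
    Function.Bijective (1 - cellOp (uhat U) : Seq →L[ℂ] Seq) := by
  have hunit := ContinuousLinearMap.isUnit_iff_bijective.mp
    (isUnit_one_sub_cellOp_comp hp hU hdiv hc1 hc)
  have happ : ∀ w, (1 - cellOp (uhat U) ∘L divFreeProj) w
      = w - cellOp (uhat U) (divFreeProj w) := fun w => rfl
  constructor
  · rw [injective_iff_map_eq_zero]
    intro w hw
    have h1 : w = cellOp (uhat U) w := by
      have : w - cellOp (uhat U) w = 0 := hw
      exact sub_eq_zero.mp this
    have h2 : divFreeProj w = w := by
      conv_lhs => rw [h1]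
      rw [divFreeProj_cellOp, ← h1]
    apply hunit.1
    rw [map_zero, happ, h2]
    exact hw
  · intro g
    -- The component g − P g of the solution is known in advance; its image under `cellOp` is
    -- divergence-free and joins the right-hand side of the equation for w.
    obtain ⟨w, hw⟩ := hunit.2 (divFreeProj g + cellOp (uhat U) (g - divFreeProj g))
    rw [happ] at hw
    have h2 : divFreeProj w = w := by
      have : w = cellOp (uhat U) (divFreeProj w)
        + (divFreeProj g + cellOp (uhat U) (g - divFreeProj g)) := by rw [← hw]; abel
      conv_lhs => rw [this]
      rw [map_add, map_add, divFreeProj_cellOp, divFreeProj_idem, divFreeProj_cellOp, ← this]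
    rw [h2] at hw
    refine ⟨g - divFreeProj g + w, ?_⟩
    change (g - divFreeProj g + w) - cellOp (uhat U) (g - divFreeProj g + w) = g
    rw [map_add]
    have : w = cellOp (uhat U) w
      + (divFreeProj g + cellOp (uhat U) (g - divFreeProj g)) := by rw [← hw]; abel
    rw [show g - divFreeProj g + w - (cellOp (uhat U) (g - divFreeProj g) + cellOp (uhat U) w)
      = (w - cellOp (uhat U) w) + g - divFreeProj g - cellOp (uhat U) (g - divFreeProj g) by abel, hw]
    abel

end

/-! ### The cell problem on the Fourier side -/

section cell

variable {U : E3 → E3}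

theorem memLp_apply {S : E3 → C3} (hS : MemLp S 2 cellProb) (i : Fin 3) :
    MemLp (fun x => S x i) 2 cellProb :=
  (EuclideanSpace.proj (𝕜 := ℂ) i).comp_memLp' hS

theorem memLp_cross_toC3 (hp : TorusPeriodic U) (hU : ContDiff ℝ ∞ U) {S : E3 → C3}
    (hS : MemLp S 2 cellProb) : MemLp (fun x => cross (toC3 (U x)) (S x)) 2 cellProb := by
  obtain ⟨C, hC0, hC⟩ := hp.bounded hU.continuous
  have hm : AEStronglyMeasurable (fun x => cross (toC3 (U x)) (S x)) cellProb :=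
    (crossCLM ℂ).aestronglyMeasurable_comp₂ (contDiff_toC3 hU).continuous.aestronglyMeasurable hS.1
  have hb : ∀ x, ‖cross (toC3 (U x)) (S x)‖ ≤ ‖crossCLM ℂ‖ * C * ‖S x‖ := fun x =>
    (norm_cross_le _ _).trans <| by
      rw [norm_toC3]
      exact mul_le_mul_of_nonneg_right
        (mul_le_mul_of_nonneg_left (hC x) (crossCLM ℂ).opNorm_nonneg) (norm_nonneg _)
  exact hS.of_le_mul hm (Filter.Eventually.of_forall hb)

theorem summable_norm_sq_coef {S : E3 → C3} (hS : MemLp S 2 cellProb) :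
    Summable fun n => ‖coef S n‖ ^ 2 := by
  have h : ∀ i, Summable fun n => ‖coef S n i‖ ^ 2 := by
    intro i
    have := (hasSum_conj_coef_mul_coef (memLp_apply hS i) (memLp_apply hS i)).summable.norm
    refine this.congr fun n => ?_
    rw [coef_apply (hS.integrable (by norm_num)), norm_mul, RCLike.norm_conj, sq]
  simp only [EuclideanSpace.norm_sq_eq, Fin.sum_univ_three]
  exact ((h 0).add (h 1)).add (h 2)

/-- The sequence of Fourier coefficients. -/
noncomputable def coefSeq {S : E3 → C3} (hS : MemLp S 2 cellProb) : Seq :=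
  ⟨coef S, memSeq_of_summable (summable_norm_sq_coef hS)⟩

@[simp] theorem coefSeq_apply {S : E3 → C3} (hS : MemLp S 2 cellProb) (n : Z3) :
    coefSeq hS n = coef S n := rfl

/-- Absolute summability of û allows the Fourier series of U to be integrated term by term against
S. -/
theorem coef_cross (hp : TorusPeriodic U) (hU : ContDiff ℝ ∞ U) {S : E3 → C3}
    (hS : MemLp S 2 cellProb) (n : Z3) :
    coef (fun x => cross (toC3 (U x)) (S x)) n = convOp (uhat U) (coefSeq hS) n := by
  have hSi : Integrable S cellProb := hS.integrable (by norm_num)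
  refine HasSum.unique ?_ (hasSum_convOp (summable_uhat hp hU) (coefSeq hS) n)
  have hF : ∀ l, ∫ x, ech (-n) x • ech l x • cross (uhat U l) (S x) ∂cellProb
      = cross (uhat U l) (coefSeq hS (n - l)) := by
    intro l
    rw [coefSeq_apply, coef, ← crossCLM_apply, ← ContinuousLinearMap.integral_comp_comm]
    · congr 1
      funext x
      rw [map_smul, crossCLM_apply, smul_smul, ← ech_add, neg_sub, sub_eq_add_neg, add_comm]
    · exact integrable_ech_smul hSi _
  simp only [← hF, coef]
  have hmeas : ∀ l, Integrable (fun x => ech (-n) x • ech l x • cross (uhat U l) (S x)) cellProb :=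
    fun l => integrable_ech_smul (integrable_ech_smul
      ((crossCLM ℂ (uhat U l)).integrable_comp hSi) _) _
  have hsum : Summable fun l => ∫ x, ‖ech (-n) x • ech l x • cross (uhat U l) (S x)‖ ∂cellProb := by
    refine Summable.of_nonneg_of_le (fun l => integral_nonneg fun x => norm_nonneg _) (fun l => ?_)
      (((summable_uhat hp hU).mul_left ‖crossCLM ℂ‖).mul_right (∫ x, ‖S x‖ ∂cellProb))
    rw [← integral_const_mul]
    refine integral_mono (hmeas l).norm (hSi.norm.const_mul _) fun x => ?_
    simp only [norm_smul, norm_ech, one_mul]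
    exact norm_cross_le _ _
  convert! hasSum_integral_of_summable_integral_norm hmeas hsum using 1
  refine integral_congr_ae (Filter.Eventually.of_forall fun x => ?_)
  have h1 := (hasSum_ech_smul_uhat hp hU x).mapL ((crossCLM ℂ).flip (S x))
  have h2 := h1.const_smul (ech (-n) x)
  simp only [ContinuousLinearMap.flip_apply, map_smul, crossCLM_apply] at h2
  convert! h2.tsum_eq.symm using 1

/-- The sequence of Fourier coefficients of a constant field. -/
noncomputable def constSeq : C3 →L[ℂ] Seq :=
  lp.singleContinuousLinearMap ℂ (fun _ : Z3 => C3) 2 0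

theorem convOp_constSeq {u : Z3 → C3} (hu : Summable fun l => ‖u l‖) (v : C3) (m : Z3) :
    convOp u (constSeq v) m = cross (u m) v := convOp_single hu v m

/-- Parseval for the unconjugated pairing: replacing g by its conjugate turns the frequency n into
−n. -/
theorem hasSum_cdot_coef {f g : E3 → C3} (hf : MemLp f 2 cellProb) (hg : MemLp g 2 cellProb) :
    HasSum (fun n => cdot (coef f n) (coef g (-n))) (∫ x, cdot (f x) (g x) ∂cellProb) := by
  have h : ∀ i, HasSum (fun n => coef f n i * coef g (-n) i) (∫ x, f x i * g x i ∂cellProb) := by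
    intro i
    have hgi := memLp_apply hg i
    have hgc : MemLp (fun x => (starRingEnd ℂ) (g x i)) 2 cellProb := hgi.star
    have := hasSum_conj_coef_mul_coef hgc (memLp_apply hf i)
    convert! this using 1
    · funext n
      rw [coef_apply (hf.integrable (by norm_num)), coef_apply (hg.integrable (by norm_num)), mul_comm]
      congr 1
      rw [coef, coef, ← integral_conj]
      congr 1
      funext x
      simp only [smul_eq_mul, map_mul, conj_ech, Complex.conj_conj]
    · congr 1
      funext x
      rw [Complex.conj_conj, mul_comm]
  have hI : ∀ i, Integrable (fun x => f x i * g x i) cellProb := fun i =>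
    (memLp_apply hf i).integrable_mul (memLp_apply hg i)
  simp only [cdot]
  rw [integral_finsetSum _ fun i _ => hI i]
  exact hasSum_sum fun i _ => h i

theorem laplacian_eq_sum_pderiv {F : Type*} [NormedAddCommGroup F] [NormedSpace ℝ F] {φ : E3 → F}
    (hφ : ContDiff ℝ ∞ φ) : Laplacian.laplacian φ = fun x => ∑ i, pderiv i (pderiv i φ) x := by
  rw [InnerProductSpace.laplacian_eq_iteratedFDeriv_orthonormalBasis φ (EuclideanSpace.basisFun (Fin 3) ℝ)]
  funext x
  refine Finset.sum_congr rfl fun i _ => ?_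
  rw [iteratedFDeriv_two_apply]
  have h : DifferentiableAt ℝ (fderiv ℝ φ) x :=
    ((hφ.fderiv_right (m := ∞) le_rfl).differentiable (by simp)).differentiableAt
  have h2 := (h.hasFDerivAt.clm_apply (hasFDerivAt_const (basisVec i) x)).fderiv
  unfold pderiv
  rw [h2]
  simp [basisVec]

section smoothField

variable {φ : E3 → C3}

theorem contDiff_laplacian (hφ : ContDiff ℝ ∞ φ) : ContDiff ℝ ∞ (Laplacian.laplacian φ) := by
  rw [laplacian_eq_sum_pderiv hφ]
  exact ContDiff.sum fun i _ => contDiff_pderiv (contDiff_pderiv hφ i) i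

theorem TorusPeriodic.laplacian (hp : TorusPeriodic φ) (hφ : ContDiff ℝ ∞ φ) :
    TorusPeriodic (Laplacian.laplacian φ) := by
  rw [laplacian_eq_sum_pderiv hφ]
  intro x j
  exact Finset.sum_congr rfl fun i _ => (hp.partialDeriv i).partialDeriv i x j

theorem coef_laplacian (hp : TorusPeriodic φ) (hφ : ContDiff ℝ ∞ φ) (n : Z3) :
    coef (Laplacian.laplacian φ) n = (-((‖latVec n‖ ^ 2 : ℝ) : ℂ)) • coef φ n := by
  have h : ∀ i, coef (pderiv i (pderiv i φ)) n = (-(((n i : ℝ) ^ 2 : ℝ) : ℂ)) • coef φ n := by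
    intro i
    rw [coef_pderiv (hp.partialDeriv i) (contDiff_pderiv hφ i), coef_pderiv hp hφ, smul_smul]
    congr 1
    push_cast
    linear_combination (n i : ℂ) ^ 2 * Complex.I_sq
  have hI : ∀ i, Integrable (fun x => ech (-n) x • pderiv i (pderiv i φ) x) cellProb := fun i =>
    integrable_ech_smul (((hp.partialDeriv i).partialDeriv i).integrable
      (contDiff_pderiv (contDiff_pderiv hφ i) i).continuous) _
  rw [laplacian_eq_sum_pderiv hφ, coef]
  simp only [Finset.smul_sum]
  rw [integral_finsetSum _ fun i _ => hI i, norm_latVec_sq]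
  push_cast
  rw [neg_smul, Finset.sum_smul, ← Finset.sum_neg_distrib]
  refine Finset.sum_congr rfl fun i _ => ?_
  have := h i
  rw [coef] at this
  rw [this]
  push_cast
  rw [neg_smul]

theorem curl_apply {𝕜 : Type*} [RCLike 𝕜] {f : E3 → EuclideanSpace 𝕜 (Fin 3)} {x : E3}
    (hf : DifferentiableAt ℝ f x) :
    curl f x = !₂[pderiv 1 f x 2 - pderiv 2 f x 1, pderiv 2 f x 0 - pderiv 0 f x 2,
      pderiv 0 f x 1 - pderiv 1 f x 0] := by
  simp only [curl, pderiv_apply hf]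

theorem contDiff_curl {𝕜 : Type*} [RCLike 𝕜] {f : E3 → EuclideanSpace 𝕜 (Fin 3)}
    (hf : ContDiff ℝ ∞ f) : ContDiff ℝ ∞ (curl f) := by
  rw [contDiff_piLp]
  have h : ∀ i j, ContDiff ℝ ∞ fun x => pderiv i f x j := fun i j =>
    (contDiff_piLp 2).mp (contDiff_pderiv hf i) j
  have e : curl f = fun x => !₂[pderiv 1 f x 2 - pderiv 2 f x 1, pderiv 2 f x 0 - pderiv 0 f x 2,
      pderiv 0 f x 1 - pderiv 1 f x 0] :=
    funext fun x => curl_apply (hf.differentiable (by simp)).differentiableAt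
  rw [e]
  intro i
  fin_cases i
  · exact (h 1 2).sub (h 2 1)
  · exact (h 2 0).sub (h 0 2)
  · exact (h 0 1).sub (h 1 0)

theorem TorusPeriodic.curl (hp : TorusPeriodic φ) (hφ : ContDiff ℝ ∞ φ) :
    TorusPeriodic (curl φ) := by
  intro x j
  rw [curl_apply (hφ.differentiable (by simp)).differentiableAt,
    curl_apply (hφ.differentiable (by simp)).differentiableAt]
  simp only [hp.partialDeriv _ x j]

theorem coef_curl (hp : TorusPeriodic φ) (hφ : ContDiff ℝ ∞ φ) (n : Z3) :
    coef (Dynamo.curl φ) n = Complex.I • cross (latVec n) (coef φ n) := by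
  have hc := (hp.curl hφ).integrable (contDiff_curl hφ).continuous
  have h1 : ∀ i j, coef (fun x => pderiv i φ x j) n = Complex.I * n i * coef φ n j := by
    intro i j
    rw [← coef_apply ((hp.partialDeriv i).integrable (contDiff_pderiv hφ i).continuous),
      coef_pderiv hp hφ]
    rfl
  have hI : ∀ i j, Integrable (fun x => ech (-n) x • pderiv i φ x j) cellProb := fun i j =>
    integrable_ech_smul ((EuclideanSpace.proj (𝕜 := ℂ) j).integrable_comp
      ((hp.partialDeriv i).integrable (contDiff_pderiv hφ i).continuous)) _
  have h2 : ∀ i j k l, coef (fun x => pderiv i φ x j - pderiv k φ x l) n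
      = Complex.I * n i * coef φ n j - Complex.I * n k * coef φ n l := by
    intro i j k l
    rw [← h1, ← h1, coef, coef, coef, ← integral_sub (hI i j) (hI k l)]
    simp only [smul_sub]
  have e : Dynamo.curl φ = fun x => !₂[pderiv 1 φ x 2 - pderiv 2 φ x 1,
      pderiv 2 φ x 0 - pderiv 0 φ x 2, pderiv 0 φ x 1 - pderiv 1 φ x 0] :=
    funext fun x => curl_apply (hφ.differentiable (by simp)).differentiableAt
  apply vec_ext
  · rw [coef_apply hc, e, PiLp.smul_apply, cross_apply_zero, smul_eq_mul]
    refine (h2 1 2 2 1).trans ?_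
    simp only [latVec_apply]; ring
  · rw [coef_apply hc, e, PiLp.smul_apply, cross_apply_one, smul_eq_mul]
    refine (h2 2 0 0 2).trans ?_
    simp only [latVec_apply]; ring
  · rw [coef_apply hc, e, PiLp.smul_apply, cross_apply_two, smul_eq_mul]
    refine (h2 0 1 1 0).trans ?_
    simp only [latVec_apply]; ring

end smoothField

end cell

/-! ### Weak solutions of the cell problem as solutions of an equation for Fourier coefficients -/

section cellSolution

variable {U : E3 → E3}

/-- The Fourier coefficients of the defect in the equation of the cell problem. -/
noncomputable def cellDefect (u : Z3 → C3) (v : C3) (s : Seq) (n : Z3) : C3 :=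
  Complex.I • cross (latVec n) (convOp u s n) - ((‖latVec n‖ ^ 2 : ℝ) : ℂ) • s n
    - Complex.I • cross (latVec n) (cross v (u n))

theorem latVec_neg (n : Z3) : latVec (-n) = -latVec n := by ext i; simp

/-- Parseval moves the curl and the Laplacian from the test field onto the coefficients. The
frequency −n attached to φ compensates the sign in the transposition of the cross product. -/
theorem hasSum_cellDefect (hp : TorusPeriodic U) (hU : ContDiff ℝ ∞ U) (v : C3) {S : E3 → C3}
    (hS : MemLp S 2 cellProb) {φ : E3 → C3} (hφ : ContDiff ℝ ∞ φ) (hpφ : TorusPeriodic φ) :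
    HasSum (fun n => cdot (cellDefect (uhat U) v (coefSeq hS) n) (coef φ (-n)))
      ((∫ x, (cdot (cross (toC3 (U x)) (S x)) (curl φ x)
        + cdot (S x) (Laplacian.laplacian φ x)) ∂cellProb)
        - ∫ x, cdot (cross v (toC3 (U x))) (curl φ x) ∂cellProb) := by
  have hcurl : MemLp (curl φ) 2 cellProb := (hpφ.curl hφ).memLp (contDiff_curl hφ).continuous
  have hlap : MemLp (Laplacian.laplacian φ) 2 cellProb :=
    (hpφ.laplacian hφ).memLp (contDiff_laplacian hφ).continuous
  have hv : ContDiff ℝ ∞ fun x => cross v (toC3 (U x)) :=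
    ((crossCLM ℂ v).restrictScalars ℝ).contDiff.comp (contDiff_toC3 hU)
  have hvU : MemLp (fun x => cross v (toC3 (U x))) 2 cellProb :=
    TorusPeriodic.memLp (fun x i => by simp only [hp x i]) hv.continuous
  have h1 := hasSum_cdot_coef (memLp_cross_toC3 hp hU hS) hcurl
  have h2 := hasSum_cdot_coef hS hlap
  have h3 := hasSum_cdot_coef hvU hcurl
  have hI : ∀ {f g : E3 → C3}, MemLp f 2 cellProb → MemLp g 2 cellProb →
      Integrable (fun x => cdot (f x) (g x)) cellProb := fun hf hg => by
    simp only [cdot]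
    exact integrable_finsetSum _ fun i _ => (memLp_apply hf i).integrable_mul (memLp_apply hg i)
  rw [integral_add (hI (memLp_cross_toC3 hp hU hS) hcurl) (hI hS hlap)]
  convert! (h1.add h2).sub h3 using 1
  funext n
  have e1 : coef (fun x => cross v (toC3 (U x))) n = cross v (uhat U n) :=
    coef_comp_clm (crossCLM ℂ v) (integrable_toC3 hp hU) n
  have e2 : ‖latVec (-n)‖ = ‖latVec n‖ := by rw [latVec_neg, norm_neg]
  have e3 : ∀ a b : C3, cdot a (Complex.I • cross (latVec (-n)) b)
      = cdot (Complex.I • cross (latVec n) a) b := by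
    intro a b
    rw [cdot_smul_right, cdot_smul_left, cdot_cross_right, latVec_neg,
      show -latVec n = (-1 : ℂ) • latVec n by simp, cross_smul_left, cdot_smul_left]
    ring
  rw [coef_cross hp hU hS, coef_curl hpφ hφ, coef_laplacian hpφ hφ, e1, e2, e3, e3, cellDefect,
    cdot_sub_left, cdot_sub_left, cdot_smul_right, coefSeq_apply, cdot_smul_left _ (coef S n)]
  ring

theorem cell_equation_iff {f g : E3 → ℂ} :
    (∫ x in cell, f x = ∫ x in cell, g x) ↔ (∫ x, f x ∂cellProb) - (∫ x, g x ∂cellProb) = 0 := by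
  have h := volume_cell_pos_finite
  have hne : ((volume cell)⁻¹).toReal ≠ 0 :=
    ENNReal.toReal_ne_zero.mpr ⟨ENNReal.inv_ne_zero.mpr h.2, ENNReal.inv_ne_top.mpr h.1⟩
  rw [cellProb, Measure.restrict_apply_univ, integral_smul_measure, integral_smul_measure,
    ← smul_sub, smul_eq_zero, or_iff_right hne, sub_eq_zero]

theorem coef_ech_smul (m n : Z3) (e : C3) :
    coef (fun x => ech m x • e) n = if n = m then e else 0 := by
  have h : ∀ x, ech (-n) x • ech m x • e = ech (m - n) x • e := fun x => by
    rw [smul_smul, ← ech_add, neg_add_eq_sub]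
  simp only [coef, h]
  rw [integral_smul_const, integral_ech]
  split_ifs with h1 h2 h2
  · rw [one_smul]
  · exact absurd (sub_eq_zero.mp h1).symm h2
  · exact absurd (sub_eq_zero.mpr h2.symm) h1
  · rw [zero_smul]

/-- Exponential test fields isolate one Fourier coefficient of the defect each; conversely the
defect pairs to zero with every smooth periodic test field. -/
theorem isCellSolution_iff (hp : TorusPeriodic U) (hU : ContDiff ℝ ∞ U) (v : C3) {S : E3 → C3}
    (hS : MemLp S 2 cellProb) :
    IsCellSolution U v S ↔
      (∀ n, cellDefect (uhat U) v (coefSeq hS) n = 0) ∧ coefSeq hS 0 = 0 := by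
  have h0 : coefSeq hS 0 = 0 ↔ ∫ x in cell, S x = 0 := by
    have h := volume_cell_pos_finite
    have hne : ((volume cell)⁻¹).toReal ≠ 0 :=
      ENNReal.toReal_ne_zero.mpr ⟨ENNReal.inv_ne_zero.mpr h.2, ENNReal.inv_ne_top.mpr h.1⟩
    rw [coefSeq_apply, coef]
    simp only [neg_zero, ech_zero, one_smul]
    rw [cellProb, Measure.restrict_apply_univ, integral_smul_measure, smul_eq_zero,
      or_iff_right hne]
  constructor
  · intro h
    refine ⟨fun m => eq_zero_of_cdot_eq_zero fun e => ?_, h0.mpr h.mean_zero⟩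
    have hφ : ContDiff ℝ ∞ fun x => ech (-m) x • e := (contDiff_ech _).smul contDiff_const
    have hpφ : TorusPeriodic fun x => ech (-m) x • e := fun x i => by
      simp only [periodic_ech (-m) x i]
    have h1 := hasSum_cellDefect hp hU v hS hφ hpφ
    rw [cell_equation_iff.mp (h.equation _ hφ hpφ)] at h1
    refine HasSum.unique ?_ h1
    have := hasSum_single (f := fun n => cdot (cellDefect (uhat U) v (coefSeq hS) n)
      (coef (fun x => ech (-m) x • e) (-n))) m fun n hn => by
        simp only [coef_ech_smul]
        rw [if_neg (by simpa using hn), cdot_zero_right]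
    simpa only [coef_ech_smul, if_true] using this
  · rintro ⟨h1, h2⟩
    refine ⟨memLp_cellProb_iff.mp hS, fun φ hφ hpφ => ?_, h0.mp h2⟩
    rw [cell_equation_iff]
    refine (hasSum_cellDefect hp hU v hS hφ hpφ).unique ?_
    simp only [h1, cdot_zero_left]
    exact hasSum_zero

/-- Riesz–Fischer in each of the three components. -/
theorem exists_coefSeq_eq (s : Seq) : ∃ (S : E3 → C3) (hS : MemLp S 2 cellProb), coefSeq hS = s := by
  have h : ∀ i, ∃ f : E3 → ℂ, MemLp f 2 cellProb ∧ ∀ n, coef f n = s n i := fun i =>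
    exists_memLp_coef_eq <| Summable.of_nonneg_of_le (fun n => by positivity)
      (fun n => by gcongr; exact PiLp.norm_apply_le (s n) i) (summable_seq s)
  choose f hf hfs using h
  have hS : MemLp (fun x => (WithLp.toLp 2 fun i => f i x : C3)) 2 cellProb := by
    rw [memLp_piLp_iff]
    exact fun i => hf i
  refine ⟨_, hS, ?_⟩
  ext n i
  rw [coefSeq_apply, coef_apply (hS.integrable (by norm_num))]
  exact hfs i n

theorem sq_mul_inv_norm {n : Z3} (hn : n ≠ 0) :
    ((‖latVec n‖ ^ 2 : ℝ) : ℂ) * (((‖latVec n‖⁻¹ : ℝ) : ℂ) * ((‖latVec n‖⁻¹ : ℝ) : ℂ)) = 1 := by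
  have := one_le_norm_latVec hn
  rw [← Complex.ofReal_mul, ← Complex.ofReal_mul, ← Complex.ofReal_one]
  congr 1
  field_simp

theorem invNormOp_zero (w : Seq) : invNormOp w 0 = 0 := by
  rw [invNormOp_apply]; simp

/-- The equation of the cell problem in terms of the rescaled unknown. -/
theorem cellDefect_eq_zero_of_eq {u : Z3 → C3} (hu : Summable fun l => ‖u l‖) {v : C3} {w : Seq}
    (hw : w = cellOp u w + unitCurlOp (convOp u (constSeq v))) (n : Z3) :
    cellDefect u v (invNormOp w) n = 0 := by
  rcases eq_or_ne n 0 with rfl | hn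
  · simp [cellDefect]
  · have h1 : w n = (Complex.I * ((‖latVec n‖⁻¹ : ℝ) : ℂ)) •
        (cross (latVec n) (convOp u (invNormOp w) n) + cross (latVec n) (cross (u n) v)) := by
      conv_lhs => rw [hw]
      rw [lp.coeFn_add, Pi.add_apply, cellOp_apply, unitCurlOp_apply, convOp_constSeq hu, smul_add]
    rw [cellDefect, cross_anticomm' v, invNormOp_apply w n, h1, smul_smul, smul_smul,
      show ((‖latVec n‖ ^ 2 : ℝ) : ℂ) * ((‖latVec n‖⁻¹ : ℝ) : ℂ)
        * (Complex.I * ((‖latVec n‖⁻¹ : ℝ) : ℂ)) = Complex.I by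
          linear_combination Complex.I * sq_mul_inv_norm hn,
      show -cross (u n) v = (-1 : ℂ) • cross (u n) v by simp, cross_smul_right]
    module

/-- Solving the equation for |n|² s(n) exhibits s(n) as w(n)/|n| with w = (in/|n|) × (û * s + û × v)
square summable. The frequency 0 carries no equation, so s(0) = 0 is needed there. -/
theorem eq_of_cellDefect_eq_zero {u : Z3 → C3} (hu : Summable fun l => ‖u l‖) {v : C3} {s : Seq}
    (hs : ∀ n, cellDefect u v s n = 0) (h0 : s 0 = 0) :
    ∃ w, invNormOp w = s ∧ w = cellOp u w + unitCurlOp (convOp u (constSeq v)) := by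
  have h1 : invNormOp (unitCurlOp (convOp u s + convOp u (constSeq v))) = s := by
    ext n : 2
    rcases eq_or_ne n 0 with rfl | hn
    · rw [invNormOp_zero, h0]
    · have h2 := hs n
      rw [cellDefect, cross_anticomm' v, show -cross (u n) v = (-1 : ℂ) • cross (u n) v by simp,
        cross_smul_right] at h2
      rw [invNormOp_apply, unitCurlOp_apply, lp.coeFn_add, Pi.add_apply, convOp_constSeq hu,
        cross_add_right]
      have h3 : Complex.I • (cross (latVec n) (convOp u s n) + cross (latVec n) (cross (u n) v))
          = ((‖latVec n‖ ^ 2 : ℝ) : ℂ) • s n := by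
        rw [← sub_eq_zero, ← h2]
        module
      rw [mul_comm Complex.I, ← smul_smul, h3, smul_smul, smul_smul, mul_comm,
        sq_mul_inv_norm hn, one_smul]
  refine ⟨_, h1, ?_⟩
  conv_rhs => rw [cellOp, ContinuousLinearMap.comp_apply, ContinuousLinearMap.comp_apply, h1]
  rw [map_add]

/-- The alpha matrix in terms of the solution of the cell problem on the Fourier side. -/
theorem alphaMap_eq {c : ℝ} (hp : TorusPeriodic U) (hU : ContDiff ℝ ∞ U)
    (hdiv : ∀ x, divergence U x = 0) (hc1 : c < 1) (hc : ∀ x, ‖fderiv ℝ U x‖ ≤ c) (j : E3)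
    {v : C3} {w : Seq} (hw : w = cellOp (uhat U) w + unitCurlOp (convOp (uhat U) (constSeq v))) :
    alphaMap U j v = Complex.I • cross (toC3 (‖j‖⁻¹ • j)) (convOp (uhat U) (invNormOp w) 0) := by
  have hu := summable_uhat hp hU
  have hex : ∃ S : E3 → C3, IsCellSolution U v S := by
    obtain ⟨S, hS, hSs⟩ := exists_coefSeq_eq (invNormOp w)
    refine ⟨S, (isCellSolution_iff hp hU v hS).mpr ?_⟩
    rw [hSs]
    exact ⟨cellDefect_eq_zero_of_eq hu hw, invNormOp_zero w⟩
  have hsol : IsCellSolution U v (cellSolution U v) := by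
    rw [cellSolution, dif_pos hex]
    exact hex.choose_spec
  have hS : MemLp (cellSolution U v) 2 cellProb := memLp_cellProb_iff.mpr hsol.memLp
  obtain ⟨h1, h2⟩ := (isCellSolution_iff hp hU v hS).mp hsol
  obtain ⟨w', hw1, hw2⟩ := eq_of_cellDefect_eq_zero hu h1 h2
  -- The solution picked by `cellSolution` may differ from the one just built; injectivity of 1 −
  -- cellOp identifies the two coefficient sequences.
  have hww : w' = w := by
    apply (bijective_one_sub_cellOp hp hU hdiv hc1 hc).1
    change w' - cellOp (uhat U) w' = w - cellOp (uhat U) w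
    rw [sub_eq_iff_eq_add'.mpr hw2, sub_eq_iff_eq_add'.mpr hw]
  rw [alphaMap, ← hww, hw1, ← coef_cross hp hU hS, average_cell, coef]
  simp only [neg_zero, ech_zero, one_smul]

end cellSolution

/-! ### Simple eigenvalues -/

/-- If (A − μ)x is a multiple of v, then x lies in the kernel of (A − μ)², hence in the generalized
eigenspace, which is the line of v; orthogonality to v then forces x = 0. The last clause says that
A − μ bordered by v is injective, which is the nondegeneracy used in the implicit function theorem.
-/
theorem exists_eigenvector_of_rootMultiplicity_eq_one {V : Type*} [NormedAddCommGroup V]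
    [InnerProductSpace ℂ V] [FiniteDimensional ℂ V] {A : V →ₗ[ℂ] V} {μ : ℂ}
    (h : A.charpoly.rootMultiplicity μ = 1) :
    ∃ v : V, ‖v‖ = 1 ∧ A v = μ • v ∧
      ∀ (x : V) (t : ℂ), A x - μ • x = t • v → inner ℂ v x = 0 → x = 0 ∧ t = 0 := by
  have hroot : A.charpoly.IsRoot μ := by
    rw [← Polynomial.rootMultiplicity_pos A.charpoly_monic.ne_zero, h]
    exact one_pos
  obtain ⟨v', hv'⟩ := ((Module.End.hasEigenvalue_iff_isRoot_charpoly A μ).mpr hroot).exists_hasEigenvector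
  have hne : ‖v'‖ ≠ 0 := norm_ne_zero_iff.mpr hv'.2
  set v := ((‖v'‖⁻¹ : ℝ) : ℂ) • v'
  have hv1 : ‖v‖ = 1 := by
    simp only [v, norm_smul, Complex.norm_real, norm_inv, norm_norm]
    field_simp
  have hAv : A v = μ • v := by
    simp only [v, map_smul, hv'.apply_eq_smul]
    rw [smul_comm]
  have hv0 : v ≠ 0 := fun h0 => by simp [h0] at hv1
  refine ⟨v, hv1, hAv, fun x t hx hi => ?_⟩
  have hdim : Module.finrank ℂ (Module.End.maxGenEigenspace A μ) = 1 := by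
    rw [LinearMap.finrank_maxGenEigenspace_eq, h]
  have hvm : v ∈ Module.End.maxGenEigenspace A μ := by
    rw [Module.End.mem_maxGenEigenspace]
    exact ⟨1, by simp [hAv]⟩
  have hxm : x ∈ Module.End.maxGenEigenspace A μ := by
    rw [Module.End.mem_maxGenEigenspace]
    refine ⟨2, ?_⟩
    have : (A - μ • (1 : Module.End ℂ V)) x = t • v := by simpa using hx
    rw [sq, Module.End.mul_apply, this, map_smul]
    simp [hAv]
  obtain ⟨a, ha⟩ := (finrank_eq_one_iff_of_nonzero' (⟨v, hvm⟩ : Module.End.maxGenEigenspace A μ)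
    (by simpa using hv0)).mp hdim ⟨x, hxm⟩
  have hxa : x = a • v := (congrArg Subtype.val ha).symm
  have ha0 : a = 0 := by
    rw [hxa, inner_smul_right, ← ofReal_norm_sq, hv1] at hi
    simpa using hi
  have hx0 : x = 0 := by rw [hxa, ha0, zero_smul]
  refine ⟨hx0, ?_⟩
  rw [hx0, map_zero, smul_zero, sub_zero] at hx
  exact (smul_eq_zero.mp hx.symm).resolve_right hv0

/-! ### The perturbed eigenvalue problem -/

/-- Multiplication by `m_a / |m|²`. -/
noncomputable def freqOp (a : Fin 3) : Seq →L[ℂ] Seq :=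
  diagOp (fun m => (m a : ℂ) • ((‖latVec m‖⁻¹ ^ 2 : ℝ) : ℂ) • ContinuousLinearMap.id ℂ C3) 1 zero_le_one
    fun m => by
      rw [norm_smul]
      have h1 : ‖(m a : ℂ)‖ ≤ ‖latVec m‖ := PiLp.norm_apply_le (latVec m) a
      calc ‖(m a : ℂ)‖ * ‖((‖latVec m‖⁻¹ ^ 2 : ℝ) : ℂ) • ContinuousLinearMap.id ℂ C3‖
          ≤ ‖latVec m‖ * ‖latVec m‖⁻¹ ^ 2 := by
            gcongr
            exact norm_ofReal_smul_id_le (by positivity) le_rfl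
        _ ≤ 1 := by
            rcases eq_or_ne m 0 with rfl | hm
            · simp
            · have := one_le_norm_latVec hm
              rw [sq, ← mul_assoc, mul_inv_cancel₀ (by positivity), one_mul]
              exact inv_norm_latVec_le_one m

theorem freqOp_apply (a : Fin 3) (w : Seq) (m : Z3) :
    freqOp a w m = (m a : ℂ) • ((‖latVec m‖⁻¹ ^ 2 : ℝ) : ℂ) • w m := rfl

/-- The operator `w ↦ (i e_a / |m|) × w`. -/
noncomputable def dirCurlOp (a : Fin 3) : Seq →L[ℂ] Seq :=
  (crossOp (Complex.I • EuclideanSpace.single a 1)).comp invNormOp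

theorem dirCurlOp_apply (a : Fin 3) (w : Seq) (m : Z3) :
    dirCurlOp a w m = cross (Complex.I • EuclideanSpace.single a 1)
      (((‖latVec m‖⁻¹ : ℝ) : ℂ) • w m) := rfl

theorem constSeq_apply_zero (v : C3) : constSeq v 0 = v :=
  lp.single_apply_self (E := fun _ : Z3 => C3) 2 0 v

theorem constSeq_apply_ne (v : C3) {m : Z3} (hm : m ≠ 0) : constSeq v m = 0 :=
  lp.single_apply_ne (E := fun _ : Z3 => C3) 2 0 v hm

/-- The value at the zero frequency. -/
noncomputable def evalZero : Seq →L[ℂ] C3 := lp.evalCLM ℂ (fun _ : Z3 => C3) 2 0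

/-- The map whose zeros are the eigenmodes with quasi-momentum `δ k`. The unknowns are the mean,
the eigenvalue divided by `δ`, and the rescaled fluctuation. -/
noncomputable def modeMap (u : Z3 → C3) (v₀ : C3) (p : (ℂ × ℂ × C3) × (C3 × ℂ × Seq)) :
    C3 × ℂ × Seq :=
  (Complex.I • crossCLM ℂ p.1.2.2 (evalZero (convOp u (invNormOp p.2.2.2)))
      - (p.1.2.1 * p.1.1 * cdot p.1.2.2 p.1.2.2) • p.2.1 - p.2.2.1 • p.2.1,
    innerSL ℂ v₀ p.2.1 - 1,
    p.1.2.1 • (p.2.2.2 + (2 * p.1.1) • (∑ a, p.1.2.2 a • freqOp a p.2.2.2)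
        + (p.1.1 ^ 2 * cdot p.1.2.2 p.1.2.2) • invNormOp (invNormOp p.2.2.2))
      + (p.1.1 * p.2.2.1) • invNormOp (invNormOp p.2.2.2)
      - (unitCurlOp (convOp u (invNormOp p.2.2.2 + constSeq p.2.1))
        + p.1.1 • ∑ a, p.1.2.2 a • dirCurlOp a (convOp u (invNormOp p.2.2.2 + constSeq p.2.1))))

theorem contDiff_modeMap (u : Z3 → C3) (v₀ : C3) : ContDiff ℂ 1 (modeMap u v₀) := by
  unfold modeMap cdot
  fun_prop

/-- The relation satisfied by the Fourier coefficients of an eigenmode. -/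
def IsMode (u : Z3 → C3) (lam ε : ℂ) (κ : C3) (h : Seq) : Prop :=
  ∀ m, lam • h m = Complex.I • cross (latVec m + κ) (convOp u h m)
    - (ε * cdot (latVec m + κ) (latVec m + κ)) • h m

theorem cdot_self_latVec (m : Z3) : cdot (latVec m) (latVec m) = ((‖latVec m‖ ^ 2 : ℝ) : ℂ) := by
  rw [cdot_latVec, ofReal_norm_sq]

/-- The first component of `modeMap` is the mode equation at m = 0 divided by δ, and the third is
the equation at m ≠ 0 divided by |m|; multiply back. At m = 0 the mean v does not feed the
convolution because û(0) = 0. -/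
theorem isMode_of_modeMap_eq_zero {u : Z3 → C3} (hu : Summable fun l => ‖u l‖) (hu0 : u 0 = 0)
    {v₀ v k : C3} {δ ε σ : ℂ} {w : Seq} (h : modeMap u v₀ ((δ, ε, k), (v, σ, w)) = 0) :
    IsMode u (δ * σ) ε (δ • k) (invNormOp w + constSeq v) := by
  have h1 := congrArg Prod.fst h
  have h3 := congrArg (fun z => z.2.2) h
  simp only [modeMap, Prod.fst_zero, Prod.snd_zero] at h1 h3
  intro m
  rcases eq_or_ne m 0 with rfl | hm
  · have e1 : (invNormOp w + constSeq v) 0 = v := by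
      rw [lp.coeFn_add, Pi.add_apply, invNormOp_zero, zero_add]
      exact constSeq_apply_zero v
    have e2 : convOp u (invNormOp w + constSeq v) 0 = evalZero (convOp u (invNormOp w)) := by
      rw [map_add, lp.coeFn_add, Pi.add_apply, convOp_constSeq hu, hu0, cross_zero_left, add_zero]
      rfl
    rw [e1, e2, latVec_zero, zero_add, cdot_smul_left, cdot_smul_right, cross_smul_left]
    rw [crossCLM_apply] at h1
    have := congrArg (fun z => δ • z) h1
    simp only [smul_sub, smul_zero] at this
    rw [← sub_eq_zero, ← neg_eq_zero, ← this]
    module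
  · have h4 := congrArg (fun z : Seq => z m) h3
    have hn := one_le_norm_latVec hm
    have hnc : ((‖latVec m‖ : ℝ) : ℂ) ≠ 0 := by
      rw [Ne, Complex.ofReal_eq_zero]; positivity
    have e1 : (invNormOp w + constSeq v) m = ((‖latVec m‖⁻¹ : ℝ) : ℂ) • w m := by
      rw [lp.coeFn_add, Pi.add_apply, invNormOp_apply]
      have : constSeq v m = 0 := constSeq_apply_ne v hm
      rw [this, add_zero]
    set z := convOp u (invNormOp w + constSeq v)
    simp only [lp.coeFn_add, lp.coeFn_sub, lp.coeFn_smul, Pi.add_apply, Pi.sub_apply, Pi.smul_apply,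
      Fin.sum_univ_three, freqOp_apply, dirCurlOp_apply, invNormOp_apply, unitCurlOp_apply,
      lp.coeFn_zero, Pi.zero_apply, cross_smul_right, cross_smul_left] at h4
    have hk : cross k (z m) = k 0 • cross (EuclideanSpace.single 0 1) (z m)
        + k 1 • cross (EuclideanSpace.single 1 1) (z m)
        + k 2 • cross (EuclideanSpace.single 2 1) (z m) := by
      rw [← cross_smul_left, ← cross_smul_left, ← cross_smul_left, ← cross_add_left,
        ← cross_add_left]
      congr 1
      apply vec_ext <;> simp
    have hc : cdot (latVec m) k = (m 0 : ℂ) * k 0 + m 1 * k 1 + m 2 * k 2 := by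
      simp [cdot, Fin.sum_univ_three]
    have h5 := congrArg (fun y => ((‖latVec m‖ : ℝ) : ℂ) • y) h4
    simp only [smul_zero] at h5
    rw [e1, cross_add_left, cross_smul_left, hk, cdot_add_left, cdot_add_right, cdot_add_right,
      cdot_smul_left, cdot_smul_left, cdot_smul_right, cdot_smul_right, cdot_self_latVec,
      cdot_comm' k (latVec m), hc, ← sub_eq_zero, ← h5]
    push_cast
    match_scalars <;> field_simp <;> ring

/-! ### The implicit function theorem at quasi-momentum zero -/

section implicit

/-- The derivative of `modeMap` in the unknowns at the base point. -/
noncomputable def modeDeriv (u : Z3 → C3) (v₀ k : C3) (μ : ℂ) : C3 × ℂ × Seq →L[ℂ] C3 × ℂ × Seq :=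
  let fv := ContinuousLinearMap.fst ℂ C3 (ℂ × Seq)
  let fs := (ContinuousLinearMap.fst ℂ ℂ Seq) ∘L (ContinuousLinearMap.snd ℂ C3 (ℂ × Seq))
  let fw := (ContinuousLinearMap.snd ℂ ℂ Seq) ∘L (ContinuousLinearMap.snd ℂ C3 (ℂ × Seq))
  (((Complex.I • crossCLM ℂ k) ∘L evalZero ∘L convOp u ∘L invNormOp) ∘L fw - μ • fv
      - fs.smulRight v₀).prod
    ((innerSL ℂ v₀ ∘L fv).prod
      (fw - cellOp u ∘L fw - (unitCurlOp ∘L convOp u ∘L constSeq) ∘L fv))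

theorem modeDeriv_apply (u : Z3 → C3) (v₀ k : C3) (μ : ℂ) (v : C3) (σ : ℂ) (w : Seq) :
    modeDeriv u v₀ k μ (v, σ, w) =
      (Complex.I • cross k (convOp u (invNormOp w) 0) - μ • v - σ • v₀, inner ℂ v₀ v,
        w - cellOp u w - unitCurlOp (convOp u (constSeq v))) := rfl

theorem fderiv_modeMap_comp_inr (u : Z3 → C3) (v₀ k : C3) (μ : ℂ) (w₀ : Seq) :
    fderiv ℂ (modeMap u v₀) ((0, 1, k), (v₀, μ, w₀)) ∘L
      .inr ℂ (ℂ × ℂ × C3) (C3 × ℂ × Seq) = modeDeriv u v₀ k μ := by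
  have h1 : HasFDerivAt (fun e => modeMap u v₀ ((0, 1, k), e))
      (fderiv ℂ (modeMap u v₀) ((0, 1, k), (v₀, μ, w₀)) ∘L
        .inr ℂ (ℂ × ℂ × C3) (C3 × ℂ × Seq)) (v₀, μ, w₀) := by
    have := ((contDiff_modeMap u v₀).differentiable (by simp)).differentiableAt
      (x := ((0, 1, k), (v₀, μ, w₀)))
    exact this.hasFDerivAt.comp (v₀, μ, w₀) (hasFDerivAt_prodMk_right (0, 1, k) (v₀, μ, w₀))
  refine h1.unique ?_
  -- At δ = 0, ε = 1 the only nonlinear term is the product σ v. It is written as σ v₀ − σ (v₀ − v),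
  -- whose second factor vanishes at the base point; the constants v₀ cancel.
  have h2 : (fun e : C3 × ℂ × Seq => modeMap u v₀ ((0, 1, k), e)) = fun e =>
      modeDeriv u v₀ k 0 e + (v₀ - 0, -1, 0) + (e.2.1 • (v₀ - e.1) - v₀, 0, 0) := by
    funext ⟨v, σ, w⟩
    rw [modeDeriv_apply]
    simp only [modeMap, crossCLM_apply, Prod.mk_add_mk]
    refine Prod.ext ?_ (Prod.ext ?_ ?_)
    · simp only [evalZero, lp.evalCLM]
      simp
      module
    · simp [sub_eq_add_neg]
    · simp [cellOp, map_add]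
      abel
  rw [h2]
  have hs : HasFDerivAt (fun e : C3 × ℂ × Seq => e.2.1 • (v₀ - e.1) - v₀)
      (μ • (-ContinuousLinearMap.fst ℂ C3 (ℂ × Seq)) +
        ((ContinuousLinearMap.fst ℂ ℂ Seq) ∘L (ContinuousLinearMap.snd ℂ C3 (ℂ × Seq))).smulRight
          (v₀ - v₀)) (v₀, μ, w₀) := by
    have ha : HasFDerivAt (fun e : C3 × ℂ × Seq => e.2.1)
        ((ContinuousLinearMap.fst ℂ ℂ Seq) ∘L (ContinuousLinearMap.snd ℂ C3 (ℂ × Seq)))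
        (v₀, μ, w₀) :=
      ((ContinuousLinearMap.fst ℂ ℂ Seq) ∘L (ContinuousLinearMap.snd ℂ C3 (ℂ × Seq))).hasFDerivAt
    have hb : HasFDerivAt (fun e : C3 × ℂ × Seq => v₀ - e.1)
        (-ContinuousLinearMap.fst ℂ C3 (ℂ × Seq)) (v₀, μ, w₀) :=
      (ContinuousLinearMap.fst ℂ C3 (ℂ × Seq)).hasFDerivAt.const_sub v₀
    exact (ha.smul hb).sub_const v₀
  have h3 := (((modeDeriv u v₀ k 0).hasFDerivAt (x := (v₀, μ, w₀))).add_const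
    (v₀ - 0, -1, 0)).add (hs.prodMk (hasFDerivAt_const ((0 : ℂ), (0 : Seq)) (v₀, μ, w₀)))
  have h4 : modeDeriv u v₀ k μ = modeDeriv u v₀ k 0 +
      (μ • (-ContinuousLinearMap.fst ℂ C3 (ℂ × Seq)) +
        ((ContinuousLinearMap.fst ℂ ℂ Seq) ∘L (ContinuousLinearMap.snd ℂ C3 (ℂ × Seq))).smulRight
          (v₀ - v₀)).prod 0 := by
    refine ContinuousLinearMap.ext fun ⟨v, σ, w⟩ => ?_
    rw [add_apply, modeDeriv_apply, modeDeriv_apply]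
    refine Prod.ext ?_ (Prod.ext ?_ ?_)
    · simp
      module
    · simp
    · simp
  rw [h4]
  exact h3

/-- A continuous family of growing eigenmodes. -/
theorem exists_modeMap_branch {u : Z3 → C3} {v₀ k : C3} {μ : ℂ} {w₀ : Seq}
    (h0 : modeMap u v₀ ((0, 1, k), (v₀, μ, w₀)) = 0)
    (hb : Function.Bijective (modeDeriv u v₀ k μ)) {U : Set (C3 × ℂ × Seq)}
    (hU : U ∈ nhds (v₀, μ, w₀)) :
    ∃ (r : ℝ) (ψ : ℂ × ℂ × C3 → C3 × ℂ × Seq), 0 < r ∧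
      ContinuousOn ψ (Metric.ball (0, 1, k) r) ∧
      ∀ p ∈ Metric.ball ((0, 1, k) : ℂ × ℂ × C3) r, modeMap u v₀ (p, ψ p) = 0 ∧ ψ p ∈ U := by
  have hinv : (fderiv ℂ (modeMap u v₀) ((0, 1, k), (v₀, μ, w₀)) ∘L
      .inr ℂ (ℂ × ℂ × C3) (C3 × ℂ × Seq)).IsInvertible := by
    rw [fderiv_modeMap_comp_inr]
    exact ⟨ContinuousLinearEquiv.ofBijective _ (LinearMap.ker_eq_bot.mpr hb.1)
      (LinearMap.range_eq_top.mpr hb.2), ContinuousLinearEquiv.coe_ofBijective _ _ _⟩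
  have hcd : ContDiffAt ℂ 1 (modeMap u v₀) ((0, 1, k), (v₀, μ, w₀)) :=
    (contDiff_modeMap u v₀).contDiffAt
  set ψ := hcd.implicitFunction one_ne_zero hinv
  have e1 := hcd.eventually_apply_implicitFunction one_ne_zero hinv
  have hψ : ContDiffAt ℂ 1 ψ (0, 1, k) := hcd.contDiffAt_implicitFunction one_ne_zero hinv
  have hψ0 : ψ (0, 1, k) = (v₀, μ, w₀) := hcd.implicitFunction_apply_self one_ne_zero hinv
  have e2 : ∀ᶠ p in nhds ((0, 1, k) : ℂ × ℂ × C3), ψ p ∈ U :=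
    hψ.continuousAt.eventually_mem (by rw [hψ0]; exact hU)
  have e3 := hψ.eventually (by simp)
  obtain ⟨r, hr, h⟩ := Metric.eventually_nhds_iff_ball.mp (e1.and (e2.and e3))
  refine ⟨r, ψ, hr, fun p hp => (h p hp).2.2.continuousAt.continuousWithinAt, fun p hp => ⟨?_, (h p hp).2.1⟩⟩
  rw [← h0]
  exact (h p hp).1

end implicit

/-! ### Nondegeneracy and the family of growing modes -/

section branch

variable {U : E3 → E3}

/-- Schur complement: the inverse R of 1 − cellOp eliminates w and leaves the bordered operator (x,
t) ↦ ((A − μ)x − t v₀, ⟨v₀, x⟩) on a finite-dimensional space, where the hypothesis of injectivity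
gives surjectivity. -/
theorem bijective_modeDeriv {u : Z3 → C3} {k v₀ : C3} {μ : ℂ} (R : Seq →L[ℂ] Seq)
    (hR : ∀ w, R w - cellOp u (R w) = w) (hR' : ∀ w, R (w - cellOp u w) = w)
    (hs : ∀ (x : C3) (t : ℂ),
      Complex.I • cross k (convOp u (invNormOp (R (unitCurlOp (convOp u (constSeq x))))) 0) - μ • x
        = t • v₀ → inner ℂ v₀ x = 0 → x = 0 ∧ t = 0) :
    Function.Bijective (modeDeriv u v₀ k μ) := by
  constructor
  · rw [injective_iff_map_eq_zero]
    rintro ⟨x, t, w⟩ h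
    rw [modeDeriv_apply] at h
    simp only [Prod.mk_eq_zero] at h
    obtain ⟨h1, h2, h3⟩ := h
    have hw : w = R (unitCurlOp (convOp u (constSeq x))) := by
      rw [← sub_eq_zero.mp h3, hR']
    rw [hw] at h1
    obtain ⟨rfl, rfl⟩ := hs x t (sub_eq_zero.mp h1) h2
    simp [hw]
  · let P : Seq →L[ℂ] C3 := (Complex.I • crossCLM ℂ k) ∘L evalZero ∘L convOp u ∘L invNormOp
    let A : C3 →L[ℂ] C3 := P ∘L R ∘L unitCurlOp ∘L convOp u ∘L constSeq
    let Φ : C3 × ℂ →L[ℂ] C3 × ℂ :=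
      ((A - μ • ContinuousLinearMap.id ℂ C3) ∘L ContinuousLinearMap.fst ℂ C3 ℂ
        - (ContinuousLinearMap.snd ℂ C3 ℂ).smulRight v₀).prod
          (innerSL ℂ v₀ ∘L ContinuousLinearMap.fst ℂ C3 ℂ)
    have hΦ : ∀ x t, Φ (x, t) = (A x - μ • x - t • v₀, inner ℂ v₀ x) := fun x t => rfl
    have hinj : Function.Injective Φ := by
      rw [injective_iff_map_eq_zero]
      rintro ⟨x, t⟩ h
      rw [hΦ, Prod.mk_eq_zero] at h
      obtain ⟨rfl, rfl⟩ := hs x t (sub_eq_zero.mp h.1) h.2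
      rfl
    have hsurj : Function.Surjective Φ :=
      (LinearMap.injective_iff_surjective (f := (Φ : C3 × ℂ →ₗ[ℂ] C3 × ℂ))).mp hinj
    rintro ⟨a, b, c⟩
    obtain ⟨⟨x, t⟩, hxt⟩ := hsurj (a - P (R c), b)
    rw [hΦ, Prod.mk.injEq] at hxt
    refine ⟨(x, t, R (unitCurlOp (convOp u (constSeq x))) + R c), ?_⟩
    rw [modeDeriv_apply]
    refine Prod.ext ?_ (Prod.ext ?_ ?_)
    · have : Complex.I • cross k (convOp u (invNormOp
          (R (unitCurlOp (convOp u (constSeq x))) + R c)) 0) = A x + P (R c) :=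
        map_add P _ _
      dsimp only
      rw [this, ← sub_eq_zero]
      have := hxt.1
      rw [eq_sub_iff_add_eq, ← sub_eq_zero] at this
      rw [← this]
      abel
    · exact hxt.2
    · dsimp only
      rw [map_add, add_sub_add_comm, hR, hR]
      abel

theorem uhat_zero (hp : TorusPeriodic U) (hU : ContDiff ℝ ∞ U) (hmean : ∫ x in cell, U x = 0) :
    uhat U 0 = 0 := by
  have h : uhat U 0 = toC3CLM (∫ x, U x ∂cellProb) := by
    rw [← toC3CLM.integral_comp_comm (hp.integrable hU.continuous)]
    simp [uhat, coef, ech_zero]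
  rw [h, ← average_cell, setAverage_eq, hmean, smul_zero, map_zero]

/-- The branch from the implicit function theorem is used at a fixed small δ = s. The wave vector κ
= s k varies through k, so a neighbourhood of the unit vector j/|j| becomes a ball of quasi-momenta
away from the origin. -/
theorem exists_mode_family (hα : AlphaUnstable U) :
    ∃ (κ₀ : E3) (ρ ζ γ : ℝ) (lam : E3 × ℝ → ℂ) (W : E3 × ℝ → Seq) (V : E3 × ℝ → C3),
      0 < ρ ∧ ρ < ‖κ₀‖ ∧ ‖κ₀‖ + ρ < 1 / 2 ∧ 1 / 2 < ζ ∧ ζ < 1 ∧ 0 < γ ∧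
      ContinuousOn lam (Metric.closedBall κ₀ ρ ×ˢ Set.Icc ζ 1) ∧
      ContinuousOn W (Metric.closedBall κ₀ ρ ×ˢ Set.Icc ζ 1) ∧
      ContinuousOn V (Metric.closedBall κ₀ ρ ×ˢ Set.Icc ζ 1) ∧
      ∀ κ ∈ Metric.closedBall κ₀ ρ, ∀ ε ∈ Set.Icc ζ 1,
        2 * γ ≤ (lam (κ, ε)).re ∧ V (κ, ε) ≠ 0 ∧
        IsMode (uhat U) (lam (κ, ε)) ε (toC3 κ)
          (invNormOp (W (κ, ε)) + constSeq (V (κ, ε))) := by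
  obtain ⟨c, hc1, hc⟩ := hα.grad_lt_one
  obtain ⟨j, hj, μ, hμ, hroot⟩ := hα.unstable
  have hp := hα.periodic
  have hU := hα.smooth
  have hdiv := hα.div_free
  have hu := summable_uhat hp hU
  have hu0 := uhat_zero hp hU hα.mean_zero
  set u := uhat U with hudef
  have hbij := bijective_one_sub_cellOp hp hU hdiv hc1 hc
  let Re := ContinuousLinearEquiv.ofBijective _ (LinearMap.ker_eq_bot.mpr hbij.1)
      (LinearMap.range_eq_top.mpr hbij.2)
  let R : Seq →L[ℂ] Seq := Re.symm
  have hRe : ∀ w, Re w = w - cellOp u w := fun w => rfl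
  have hR : ∀ w, R w - cellOp u (R w) = w := fun w => by
    rw [← hRe]; exact Re.apply_symm_apply w
  have hR' : ∀ w, R (w - cellOp u w) = w := fun w => by
    rw [← hRe]; exact Re.symm_apply_apply w
  set k := toC3 (‖j‖⁻¹ • j) with hk
  have hk1 : ‖k‖ = 1 := by
    rw [hk, norm_toC3, norm_smul, norm_inv, norm_norm, inv_mul_cancel₀ (norm_ne_zero_iff.mpr hj)]
  let A : C3 →L[ℂ] C3 := (Complex.I • crossCLM ℂ k) ∘L evalZero ∘L convOp u ∘L invNormOp ∘L
    R ∘L unitCurlOp ∘L convOp u ∘L constSeq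
  have hA : ∀ v, A v = alphaMap U j v := fun v => by
    rw [alphaMap_eq hp hU hdiv hc1 hc j (w := R (unitCurlOp (convOp u (constSeq v))))
      (sub_eq_iff_eq_add'.mp (hR _))]
    rfl
  have hchar : (A : C3 →ₗ[ℂ] C3).charpoly.rootMultiplicity μ = 1 := by
    rw [← hroot, ← LinearMap.charpoly_toMatrix (A : C3 →ₗ[ℂ] C3) (EuclideanSpace.basisFun (Fin 3) ℂ).toBasis]
    congr 2
    ext i l
    rw [LinearMap.toMatrix_apply]
    simp only [OrthonormalBasis.coe_toBasis, EuclideanSpace.basisFun_apply, alphaMatrix,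
      Matrix.of_apply, ← hA]
    rfl
  obtain ⟨v₀, hv1, hAv, hs⟩ := exists_eigenvector_of_rootMultiplicity_eq_one hchar
  set w₀ := R (unitCurlOp (convOp u (constSeq v₀))) with hw₀
  have hder : Function.Bijective (modeDeriv u v₀ k μ) := bijective_modeDeriv R hR hR' hs
  have hzero : modeMap u v₀ ((0, 1, k), (v₀, μ, w₀)) = 0 := by
    have e1 : Complex.I • crossCLM ℂ k (evalZero (convOp u (invNormOp w₀))) = μ • v₀ := hAv
    have e2 : w₀ - cellOp u w₀ = unitCurlOp (convOp u (constSeq v₀)) := hR _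
    refine Prod.ext ?_ (Prod.ext ?_ ?_)
    · simp only [modeMap]
      rw [e1]
      simp
    · simp only [modeMap]
      have := ofReal_norm_sq v₀
      rw [hv1] at this
      simp only [innerSL_apply_apply]
      rw [← this]
      simp
    · simp only [modeMap]
      rw [map_add, map_add, ← e2]
      simp [cellOp]
  -- Staying in this neighbourhood keeps the real part of σ above half of its value at the base
  -- point.
  have hUn : {p : C3 × ℂ × Seq | μ.re / 2 < p.2.1.re} ∈ nhds (v₀, μ, w₀) := by
    apply IsOpen.mem_nhds
    · exact isOpen_lt continuous_const (Complex.continuous_re.comp (continuous_fst.comp continuous_snd))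
    · show μ.re / 2 < μ.re
      linarith
  obtain ⟨r, ψ, hr, hψ, hψ0⟩ := exists_modeMap_branch hzero hder hUn
  -- The bound r/2 keeps the parameters inside the domain of the branch; 1/8 ensures s² < s, s + s²
  -- < 1/2 and 1 − s > 1/2.
  set s := min (r / 2) (1 / 8) with hsdef
  have hs0 : 0 < s := by positivity
  have hsr : s < r := (min_le_left _ _).trans_lt (by linarith)
  have hs8 : s ≤ 1 / 8 := min_le_right _ _
  let p : E3 × ℝ → ℂ × ℂ × C3 := fun q => ((s : ℂ), (q.2 : ℂ), toC3 (s⁻¹ • q.1))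
  have hpc : Continuous p := by
    have : p = fun q => ((s : ℂ), (q.2 : ℂ), toC3CLM (s⁻¹ • q.1)) := rfl
    rw [this]
    fun_prop
  set κ₀ := s • (‖j‖⁻¹ • j)
  have hmem : Set.MapsTo p (Metric.closedBall κ₀ (s * s) ×ˢ Set.Icc (1 - s) 1)
      (Metric.ball (0, 1, k) r) := by
    rintro ⟨κ, ε⟩ ⟨hκ, hε⟩
    simp only [Metric.mem_closedBall, Set.mem_Icc, dist_eq_norm] at hκ hε
    simp only [Metric.mem_ball, p, dist_eq_norm, Prod.mk_sub_mk, Prod.norm_mk]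
    refine max_lt ?_ (max_lt ?_ ?_)
    · simpa [abs_of_pos hs0] using hsr
    · rw [← Complex.ofReal_one, ← Complex.ofReal_sub, Complex.norm_real, Real.norm_eq_abs, abs_lt]
      constructor <;> linarith
    · have e : toC3 (s⁻¹ • κ) - k = toC3 (s⁻¹ • (κ - κ₀)) := by
        rw [hk]
        show toC3CLM _ - toC3CLM _ = toC3CLM _
        rw [← map_sub, smul_sub, inv_smul_smul₀ hs0.ne']
      rw [e, norm_toC3, norm_smul, norm_inv, Real.norm_of_nonneg hs0.le, inv_mul_lt_iff₀ hs0]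
      nlinarith
  have hcomp := hψ.comp hpc.continuousOn hmem
  have hκ₀ : ‖κ₀‖ = s := by
    rw [norm_smul, ← norm_toC3 (‖j‖⁻¹ • j), ← hk, hk1, Real.norm_of_nonneg hs0.le, mul_one]
  -- A radius s² for κ is a radius s for κ/s. Since λ = sσ with Re σ > Re μ / 2, the choice γ = s Re
  -- μ / 4 gives Re λ ≥ 2γ.
  refine ⟨κ₀, s * s, 1 - s, s * μ.re / 4, fun q => (s : ℂ) * (ψ (p q)).2.1, fun q => (ψ (p q)).2.2,
    fun q => (ψ (p q)).1, by positivity, by rw [hκ₀]; nlinarith, by rw [hκ₀]; nlinarith,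
    by linarith, by linarith, by positivity, ?_, ?_, ?_, ?_⟩
  · exact continuousOn_const.mul (continuous_fst.comp_continuousOn (continuous_snd.comp_continuousOn hcomp))
  · exact continuous_snd.comp_continuousOn (continuous_snd.comp_continuousOn hcomp)
  · exact continuous_fst.comp_continuousOn hcomp
  · intro κ hκ ε hε
    obtain ⟨hz, hre⟩ := hψ0 _ (hmem (Set.mk_mem_prod hκ hε))
    have hre' : μ.re / 2 < (ψ (p (κ, ε))).2.1.re := hre
    refine ⟨?_, ?_, ?_⟩
    · rw [Complex.re_ofReal_mul]
      nlinarith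
    -- The normalization ⟨v₀, v⟩ = 1 built into `modeMap` excludes v = 0.
    · intro hV
      have h2 := congrArg (fun z => z.2.1) hz
      simp only [modeMap, hV] at h2
      simp at h2
    · have := isMode_of_modeMap_eq_zero hu hu0 (v := (ψ (p (κ, ε))).1) (σ := (ψ (p (κ, ε))).2.1)
        (w := (ψ (p (κ, ε))).2.2) hz
      have e : (s : ℂ) • toC3 (s⁻¹ • κ) = toC3 κ := by
        apply vec_ext <;> simp [toC3_apply, hs0.ne']
      rw [e] at this
      exact this

end branch

open scoped FourierTransform

/-! ### Square-integrable fields with complex values -/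

/-- `L²(ℝ³; ℂ³)`. -/
abbrev L2C : Type := Lp C3 2 (volume : Measure E3)

/-- The Fourier transform on `L²(ℝ³; ℂ³)`. -/
noncomputable abbrev fourierL2 : L2C ≃ₗᵢ[ℂ] L2C := Lp.fourierTransformₗᵢ E3 C3

namespace IsTest

section basic

variable {F : Type*} [NormedAddCommGroup F] [NormedSpace ℝ F] {φ ψ : E3 → F}

theorem memLp (h : IsTest φ) (p : ENNReal) : MemLp φ p (volume : Measure E3) :=
  h.1.continuous.memLp_of_hasCompactSupport h.2

theorem integrable (h : IsTest φ) : Integrable φ := memLp_one_iff_integrable.mp (h.memLp 1)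

theorem pderiv (h : IsTest φ) (i : Fin 3) : IsTest (Dynamo.pderiv i φ) :=
  ⟨contDiff_pderiv h.1 i, h.2.fderiv_apply (𝕜 := ℝ) _⟩

theorem add (h : IsTest φ) (h' : IsTest ψ) : IsTest fun x => φ x + ψ x :=
  ⟨h.1.add h'.1, h.2.add h'.2⟩

theorem clm_comp {G : Type*} [NormedAddCommGroup G] [NormedSpace ℝ G] (L : F →L[ℝ] G)
    (h : IsTest φ) : IsTest fun x => L (φ x) :=
  ⟨L.contDiff.comp h.1, h.2.comp_left (g := L) (map_zero L)⟩

theorem laplacian (h : IsTest φ) : IsTest (Laplacian.laplacian φ) := by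
  rw [laplacian_eq_sum_pderiv h.1]
  simp only [Fin.sum_univ_three]
  exact (((h.pderiv 0).pderiv 0).add ((h.pderiv 1).pderiv 1)).add ((h.pderiv 2).pderiv 2)

end basic

theorem toC3 {φ : E3 → E3} (h : IsTest φ) : IsTest fun x => toC3 (φ x) := h.clm_comp toC3CLM

theorem curl_eq {𝕜 : Type*} [RCLike 𝕜] {φ : E3 → EuclideanSpace 𝕜 (Fin 3)} (h : IsTest φ) :
    Dynamo.curl φ = fun x => cross (EuclideanSpace.single 0 1) (Dynamo.pderiv 0 φ x)
      + cross (EuclideanSpace.single 1 1) (Dynamo.pderiv 1 φ x)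
      + cross (EuclideanSpace.single 2 1) (Dynamo.pderiv 2 φ x) := by
  funext x
  rw [curl_apply (h.1.differentiable (by simp)).differentiableAt]
  apply vec_ext <;> simp [cross_apply_zero, cross_apply_one, cross_apply_two] <;> ring

theorem curl {𝕜 : Type*} [RCLike 𝕜] {φ : E3 → EuclideanSpace 𝕜 (Fin 3)} (h : IsTest φ) :
    IsTest (Dynamo.curl φ) := by
  rw [h.curl_eq]
  have hc : ∀ i, IsTest fun x =>
      cross (EuclideanSpace.single i 1 : EuclideanSpace 𝕜 (Fin 3)) (Dynamo.pderiv i φ x) := fun i =>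
    (h.pderiv i).clm_comp ((crossCLM 𝕜 (EuclideanSpace.single i 1)).restrictScalars ℝ)
  exact ((hc 0).add (hc 1)).add (hc 2)

variable {φ : E3 → C3}

/-- The class in `L²` of a test field. -/
noncomputable def toL2 (h : IsTest φ) : L2C := (h.memLp 2).toLp φ

theorem coeFn_toL2 (h : IsTest φ) : h.toL2 =ᵐ[volume] φ := (h.memLp 2).coeFn_toLp

theorem coeFn_fourierL2 (h : IsTest φ) : fourierL2 h.toL2 =ᵐ[volume] 𝓕 φ := by
  have h1 : h.toL2 = (h.2.toSchwartzMap h.1).toLp 2 := rfl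
  have h2 := SchwartzMap.toLp_fourier_eq (h.2.toSchwartzMap h.1)
  rw [h1]
  have h3 : fourierL2 ((h.2.toSchwartzMap h.1).toLp 2) = (𝓕 (h.2.toSchwartzMap h.1)).toLp 2 := h2
  rw [h3]
  exact SchwartzMap.coeFn_toLp _ _ _

theorem memLp_fourier (h : IsTest φ) : MemLp (𝓕 φ) 2 (volume : Measure E3) :=
  (𝓕 (h.2.toSchwartzMap h.1)).memLp 2 volume

theorem fourier_clm (h : IsTest φ) (L : C3 →L[ℂ] C3) (η : E3) :
    𝓕 (fun x => L (φ x)) η = L (𝓕 φ η) := by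
  rw [Real.fourier_eq, Real.fourier_eq, ← L.integral_comp_comm]
  · congr 1
    funext x
    simp [Circle.smul_def]
  · exact (Real.fourierIntegral_convergent_iff η).mpr h.integrable

theorem fourier_add {φ ψ : E3 → C3} (h : IsTest φ) (h' : IsTest ψ) (η : E3) :
    𝓕 (fun x => φ x + ψ x) η = 𝓕 φ η + 𝓕 ψ η := by
  rw [Real.fourier_eq, Real.fourier_eq, Real.fourier_eq, ← integral_add]
  · simp
  · exact (Real.fourierIntegral_convergent_iff η).mpr h.integrable
  · exact (Real.fourierIntegral_convergent_iff η).mpr h'.integrable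

/-- The wave vector `2πη` of a frequency. -/
noncomputable def _root_.Dynamo.waveVec (η : E3) : E3 := (2 * Real.pi) • η

theorem _root_.Dynamo.waveVec_apply (η : E3) (i : Fin 3) : waveVec η i = 2 * Real.pi * η i := rfl

theorem fourier_pderiv (h : IsTest φ) (i : Fin 3) (η : E3) :
    𝓕 (Dynamo.pderiv i φ) η = (Complex.I * waveVec η i) • 𝓕 φ η := by
  have hf : Integrable (fderiv ℝ φ) :=
    ((h.1.fderiv_right (m := ∞) le_rfl).continuous).integrable_of_hasCompactSupport (h.2.fderiv (𝕜 := ℝ))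
  have h1 := Real.fourier_fderiv h.integrable (h.1.differentiable (by simp)) hf
  have h2 := Real.fourier_continuousLinearMap_apply (a := basisVec i) (v := η) hf
  rw [h1] at h2
  have : (Dynamo.pderiv i φ) = fun x => fderiv ℝ φ x (basisVec i) := rfl
  rw [this, ← h2, VectorFourier.fourierSMulRight_apply, waveVec_apply]
  have hin : (innerSL ℝ) η (basisVec i) = η i := by
    rw [innerSL_apply_apply, basisVec, EuclideanSpace.inner_single_right]
    simp
  simp only [neg_apply, hin, neg_smul, smul_neg, neg_neg]
  rw [RCLike.real_smul_eq_coe_smul (K := ℂ), smul_smul]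
  congr 1
  push_cast
  simp
  ring

theorem fourier_curl (h : IsTest φ) (η : E3) :
    𝓕 (Dynamo.curl φ) η = Complex.I • cross (Dynamo.toC3 (waveVec η)) (𝓕 φ η) := by
  rw [h.curl_eq]
  have hc : ∀ i, IsTest fun x =>
      cross (EuclideanSpace.single i 1 : C3) (Dynamo.pderiv i φ x) := fun i =>
    (h.pderiv i).clm_comp ((crossCLM ℂ (EuclideanSpace.single i 1)).restrictScalars ℝ)
  have hf : ∀ i, 𝓕 (fun x => cross (EuclideanSpace.single i 1 : C3) (Dynamo.pderiv i φ x)) η =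
      cross (EuclideanSpace.single i 1 : C3) ((Complex.I * waveVec η i) • 𝓕 φ η) := fun i => by
    have := (h.pderiv i).fourier_clm (crossCLM ℂ (EuclideanSpace.single i 1)) η
    simp only [crossCLM_apply] at this
    rw [this, h.fourier_pderiv]
  rw [fourier_add ((hc 0).add (hc 1)) (hc 2), fourier_add (hc 0) (hc 1), hf, hf, hf]
  apply vec_ext <;> simp [cross_apply_zero, cross_apply_one, cross_apply_two] <;> ring

theorem fourier_laplacian (h : IsTest φ) (η : E3) :
    𝓕 (Laplacian.laplacian φ) η = (-((‖waveVec η‖ ^ 2 : ℝ) : ℂ)) • 𝓕 φ η := by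
  rw [laplacian_eq_sum_pderiv h.1]
  simp only [Fin.sum_univ_three]
  have hd : ∀ i, IsTest (Dynamo.pderiv i (Dynamo.pderiv i φ)) := fun i => (h.pderiv i).pderiv i
  have hf : ∀ i, 𝓕 (Dynamo.pderiv i (Dynamo.pderiv i φ)) η
      = (Complex.I * waveVec η i) • (Complex.I * waveVec η i) • 𝓕 φ η := fun i => by
    rw [(h.pderiv i).fourier_pderiv, h.fourier_pderiv]
  rw [fourier_add ((hd 0).add (hd 1)) (hd 2), fourier_add (hd 0) (hd 1), hf, hf, hf,
    EuclideanSpace.norm_sq_eq]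
  simp only [Fin.sum_univ_three, Real.norm_eq_abs, sq_abs, smul_smul, ← add_smul]
  congr 1
  push_cast
  linear_combination ((waveVec η 0 : ℂ) ^ 2 + (waveVec η 1 : ℂ) ^ 2 + (waveVec η 2 : ℂ) ^ 2) *
    Complex.I_sq

end IsTest

/-- Test fields are dense in L². Identities between continuous operators involving `fourierL2`
thereby reduce to computations with the Fourier integral. -/
theorem eq_of_eq_on_test {X : Type*} [TopologicalSpace X] [T2Space X] {S T : L2C → X}
    (hS : Continuous S) (hT : Continuous T)
    (h : ∀ (φ : E3 → C3) (hφ : IsTest φ), S hφ.toL2 = T hφ.toL2) : S = T := by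
  refine hS.ext_on (Lp.dense_hasCompactSupport_contDiff (p := 2) (μ := (volume : Measure E3))
    (E := E3) (F := C3) (by simp)) hT ?_
  rintro f ⟨φ, hf, hs, hc⟩
  have hφ : IsTest φ := ⟨hc, hs⟩
  have : f = hφ.toL2 := Lp.ext (hf.trans hφ.coeFn_toL2.symm)
  rw [this]
  exact h φ hφ

/-! ### Multiplication, translation, dilation and conjugation on `L²` -/

theorem norm_sq_eq_integral {F : Type*} [NormedAddCommGroup F] [InnerProductSpace ℝ F]
    (f : Lp F 2 (volume : Measure E3)) : ‖f‖ ^ 2 = ∫ x, ‖f x‖ ^ 2 := by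
  rw [← real_inner_self_eq_norm_sq, L2.inner_def]
  simp

section mult

theorem memLp_mult {a : E3 → C3 →L[ℂ] C3} {C : ℝ} (ha : AEStronglyMeasurable a volume)
    (hC : ∀ x, ‖a x‖ ≤ C) (f : L2C) : MemLp (fun x => a x (f x)) 2 (volume : Measure E3) := by
  refine (Lp.memLp f).of_le_mul (c := C) ?_ (Filter.Eventually.of_forall fun x => ?_)
  · exact isBoundedBilinearMap_apply.continuous.comp_aestronglyMeasurable
      (ha.prodMk (Lp.aestronglyMeasurable f))
  · exact (a x).le_of_opNorm_le (hC x) _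

/-- The operator of multiplication by a bounded matrix-valued function. -/
noncomputable def multOp (a : E3 → C3 →L[ℂ] C3) (C : ℝ) (ha : AEStronglyMeasurable a volume)
    (hC : ∀ x, ‖a x‖ ≤ C) : L2C →L[ℂ] L2C :=
  LinearMap.mkContinuous
    { toFun := fun f => (memLp_mult ha hC f).toLp _
      map_add' := fun f g => by
        refine Lp.ext ?_
        filter_upwards [(memLp_mult ha hC (f + g)).coeFn_toLp, (memLp_mult ha hC f).coeFn_toLp,
          (memLp_mult ha hC g).coeFn_toLp, Lp.coeFn_add f g,
          Lp.coeFn_add ((memLp_mult ha hC f).toLp _) ((memLp_mult ha hC g).toLp _)]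
          with x h1 h2 h3 h4 h5
        rw [h1, h5, Pi.add_apply, h2, h3, h4, Pi.add_apply, map_add]
      map_smul' := fun c f => by
        refine Lp.ext ?_
        filter_upwards [(memLp_mult ha hC (c • f)).coeFn_toLp, (memLp_mult ha hC f).coeFn_toLp,
          Lp.coeFn_smul c f, Lp.coeFn_smul c ((memLp_mult ha hC f).toLp _)] with x h1 h2 h3 h4
        rw [h1, RingHom.id_apply, h4, Pi.smul_apply, h2, h3, Pi.smul_apply, map_smul] }
    C fun f => by
      refine Lp.norm_le_mul_norm_of_ae_le_mul ?_
      filter_upwards [(memLp_mult ha hC f).coeFn_toLp] with x h1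
      simp only [LinearMap.coe_mk, AddHom.coe_mk]
      rw [h1]
      exact (a x).le_of_opNorm_le (hC x) _

theorem coeFn_multOp {a : E3 → C3 →L[ℂ] C3} {C : ℝ} (ha : AEStronglyMeasurable a volume)
    (hC : ∀ x, ‖a x‖ ≤ C) (f : L2C) : multOp a C ha hC f =ᵐ[volume] fun x => a x (f x) :=
  (memLp_mult ha hC f).coeFn_toLp

theorem norm_multOp_apply_le {a : E3 → C3 →L[ℂ] C3} {C : ℝ} (ha : AEStronglyMeasurable a volume)
    (hC : ∀ x, ‖a x‖ ≤ C) (f : L2C) : ‖multOp a C ha hC f‖ ≤ C * ‖f‖ :=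
  (multOp a C ha hC).le_of_opNorm_le
    (LinearMap.mkContinuous_norm_le _ ((norm_nonneg _).trans (hC 0)) _) f

end mult

section modulation

/-- The character with wave vector `c`. -/
noncomputable def character (c x : E3) : ℂ := Complex.exp ((inner ℝ c x : ℝ) * Complex.I)

theorem norm_character (c x : E3) : ‖character c x‖ = 1 := Complex.norm_exp_ofReal_mul_I _

theorem contDiff_character (c : E3) : ContDiff ℝ ∞ (character c) := by
  unfold character
  exact ((Complex.ofRealCLM.contDiff.comp (innerSL ℝ c).contDiff).mul contDiff_const).cexp

theorem IsTest.character_smul {φ : E3 → C3} (h : IsTest φ) (c : E3) :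
    IsTest fun x => character c x • φ x :=
  ⟨(ContinuousLinearMap.lsmul ℝ ℂ (E := C3)).isBoundedBilinearMap.contDiff.comp
    ((contDiff_character c).prodMk h.1), h.2.smul_left (f := character c)⟩

theorem norm_character_smul_id (c x : E3) :
    ‖character c x • ContinuousLinearMap.id ℂ C3‖ ≤ 1 := by
  rw [norm_smul, norm_character, one_mul]
  exact ContinuousLinearMap.norm_id_le

/-- Multiplication by a character. -/
noncomputable def modOp (c : E3) : L2C →L[ℂ] L2C :=
  multOp (fun x => character c x • ContinuousLinearMap.id ℂ C3) 1
    ((contDiff_character c).continuous.smul continuous_const).aestronglyMeasurable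
    (norm_character_smul_id c)

theorem coeFn_modOp (c : E3) (f : L2C) : modOp c f =ᵐ[volume] fun x => character c x • f x :=
  coeFn_multOp _ _ f

/-- Translation by `d`. -/
noncomputable def transOp (d : E3) : L2C →ₗᵢ[ℂ] L2C :=
  Lp.compMeasurePreservingₗᵢ ℂ (fun x => x - d) (measurePreserving_sub_right volume d)

theorem coeFn_transOp (d : E3) (f : L2C) : transOp d f =ᵐ[volume] fun x => f (x - d) :=
  Lp.coeFn_compMeasurePreserving f (measurePreserving_sub_right volume d)

theorem fourier_character_smul (φ : E3 → C3) (c η : E3) :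
    𝓕 (fun x => character c x • φ x) η = 𝓕 φ (η - (2 * Real.pi)⁻¹ • c) := by
  rw [Real.fourier_eq', Real.fourier_eq']
  congr 1
  funext x
  rw [smul_smul, character, ← Complex.exp_add]
  congr 2
  rw [inner_sub_right, inner_smul_right, real_inner_comm x c]
  push_cast
  have : (Real.pi : ℂ) ≠ 0 := by exact_mod_cast Real.pi_ne_zero
  field_simp
  ring

theorem fourierL2_modOp (c : E3) (f : L2C) :
    fourierL2 (modOp c f) = transOp ((2 * Real.pi)⁻¹ • c) (fourierL2 f) := by
  refine congrFun (eq_of_eq_on_test (S := fun f => fourierL2 (modOp c f))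
    (T := fun f => transOp ((2 * Real.pi)⁻¹ • c) (fourierL2 f))
    (fourierL2.continuous.comp (modOp c).continuous)
    ((transOp _).continuous.comp fourierL2.continuous) fun φ hφ => ?_) f
  have h1 : modOp c hφ.toL2 = (hφ.character_smul c).toL2 := by
    refine Lp.ext ?_
    filter_upwards [coeFn_modOp c hφ.toL2, (hφ.character_smul c).coeFn_toL2, hφ.coeFn_toL2]
      with x h1 h2 h3
    rw [h1, h2, h3]
  refine Lp.ext ?_
  rw [h1]
  filter_upwards [(hφ.character_smul c).coeFn_fourierL2, coeFn_transOp ((2 * Real.pi)⁻¹ • c)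
    (fourierL2 hφ.toL2), (measurePreserving_sub_right volume
      ((2 * Real.pi)⁻¹ • c)).quasiMeasurePreserving.ae_eq_comp hφ.coeFn_fourierL2] with η h2 h3 h4
  rw [h2, h3, fourier_character_smul]
  exact h4.symm

end modulation

section dilation

/-- A dilation changes the measure only by a factor, so it may be composed with almost-everywhere
identities. -/
theorem quasiMeasurePreserving_smul {c : ℝ} (hc : 0 < c) :
    Measure.QuasiMeasurePreserving (fun x : E3 => c • x) volume volume :=
  ⟨measurable_const_smul c, by
    rw [Measure.map_addHaar_smul volume hc.ne']
    exact Measure.smul_absolutelyContinuous⟩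

theorem memLp_dilation {c : ℝ} (hc : 0 < c) (f : L2C) :
    MemLp (fun x => ((c ^ (3 / 2 : ℝ) : ℝ) : ℂ) • f (c • x)) 2 (volume : Measure E3) := by
  refine MemLp.const_smul (f := fun x => f (c • x)) ?_ (((c ^ (3 / 2 : ℝ) : ℝ) : ℂ))
  refine MemLp.comp_of_map (f := fun x : E3 => c • x) ?_ (measurable_const_smul c).aemeasurable
  rw [Measure.map_addHaar_smul volume hc.ne']
  exact (Lp.memLp f).smul_measure ENNReal.ofReal_ne_top

/-- The unitary dilation `f ↦ c^{3/2} f(c ·)`. -/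
noncomputable def dilation (c : ℝ) (hc : 0 < c) : L2C →ₗᵢ[ℂ] L2C where
  toFun f := (memLp_dilation hc f).toLp _
  map_add' f g := by
    refine Lp.ext ?_
    filter_upwards [(memLp_dilation hc (f + g)).coeFn_toLp, (memLp_dilation hc f).coeFn_toLp,
      (memLp_dilation hc g).coeFn_toLp,
      (quasiMeasurePreserving_smul hc).ae_eq_comp (Lp.coeFn_add f g),
      Lp.coeFn_add ((memLp_dilation hc f).toLp _) ((memLp_dilation hc g).toLp _)]
      with x h1 h2 h3 h4 h5
    simp only [Function.comp_apply, Pi.add_apply] at h4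
    rw [h1, h5, Pi.add_apply, h2, h3, h4, smul_add]
  map_smul' z f := by
    refine Lp.ext ?_
    filter_upwards [(memLp_dilation hc (z • f)).coeFn_toLp, (memLp_dilation hc f).coeFn_toLp,
      (quasiMeasurePreserving_smul hc).ae_eq_comp (Lp.coeFn_smul z f),
      Lp.coeFn_smul z ((memLp_dilation hc f).toLp _)] with x h1 h2 h3 h4
    simp only [Function.comp_apply, Pi.smul_apply] at h3
    rw [h1, RingHom.id_apply, h4, Pi.smul_apply, h2, h3, smul_comm]
  norm_map' f := by
    rw [← sq_eq_sq₀ (norm_nonneg _) (norm_nonneg _), norm_sq_eq_integral (F := C3),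
      norm_sq_eq_integral (F := C3)]
    have h : ∀ᵐ x ∂volume, ‖(memLp_dilation hc f).toLp _ x‖ ^ 2 = c ^ 3 * ‖f (c • x)‖ ^ 2 := by
      filter_upwards [(memLp_dilation hc f).coeFn_toLp] with x h1
      rw [h1, norm_smul, Complex.norm_real, Real.norm_of_nonneg (by positivity), mul_pow,
        ← Real.rpow_natCast (c ^ (3 / 2 : ℝ)), ← Real.rpow_mul hc.le]
      norm_num
    show ∫ x, ‖(memLp_dilation hc f).toLp _ x‖ ^ 2 = _
    rw [integral_congr_ae h, integral_const_mul,
      Measure.integral_comp_smul volume (fun x => ‖f x‖ ^ 2) c]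
    simp only [finrank_euclideanSpace, Fintype.card_fin, smul_eq_mul]
    rw [abs_of_pos (by positivity), ← mul_assoc, mul_inv_cancel₀ (by positivity), one_mul]

theorem coeFn_dilation {c : ℝ} (hc : 0 < c) (f : L2C) :
    dilation c hc f =ᵐ[volume] fun x => ((c ^ (3 / 2 : ℝ) : ℝ) : ℂ) • f (c • x) :=
  (memLp_dilation hc f).coeFn_toLp

theorem IsTest.dilation {φ : E3 → C3} (h : IsTest φ) {c : ℝ} (hc : 0 < c) :
    IsTest fun x => ((c ^ (3 / 2 : ℝ) : ℝ) : ℂ) • φ (c • x) :=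
  ⟨(h.1.comp (contDiff_const_smul c)).const_smul _,
    (h.2.comp_smul hc.ne').smul_left (f := fun _ => ((c ^ (3 / 2 : ℝ) : ℝ) : ℂ))⟩

theorem fourier_dilation (φ : E3 → C3) {c : ℝ} (hc : 0 < c) (η : E3) :
    𝓕 (fun x => ((c ^ (3 / 2 : ℝ) : ℝ) : ℂ) • φ (c • x)) η
      = ((c⁻¹ ^ (3 / 2 : ℝ) : ℝ) : ℂ) • 𝓕 φ (c⁻¹ • η) := by
  rw [Real.fourier_eq', Real.fourier_eq']
  have h := Measure.integral_comp_smul (volume : Measure E3) (fun x =>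
    Complex.exp (((-2 * Real.pi * inner ℝ x (c⁻¹ • η) : ℝ) : ℂ) * Complex.I) • φ x) c
  have h2 : ∀ x : E3, inner ℝ (c • x) (c⁻¹ • η) = inner ℝ x η := fun x => by
    rw [inner_smul_left, inner_smul_right, ← mul_assoc]
    simp [hc.ne']
  simp only [h2] at h
  simp only [smul_comm _ (((c ^ (3 / 2 : ℝ) : ℝ) : ℂ))]
  rw [integral_smul, h, RCLike.real_smul_eq_coe_smul (K := ℂ), smul_smul]
  congr 1
  rw [finrank_euclideanSpace, Fintype.card_fin, abs_of_pos (by positivity)]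
  have e : c⁻¹ ^ (3 / 2 : ℝ) = c ^ (3 / 2 : ℝ) * (c ^ 3)⁻¹ := by
    rw [Real.inv_rpow hc.le, ← Real.rpow_natCast, ← Real.rpow_neg hc.le, ← Real.rpow_neg hc.le,
      ← Real.rpow_add hc]
    norm_num
  rw [e, Complex.ofReal_mul]
  rfl

theorem fourierL2_dilation {c : ℝ} (hc : 0 < c) (f : L2C) :
    fourierL2 (dilation c hc f) = dilation c⁻¹ (inv_pos.mpr hc) (fourierL2 f) := by
  refine congrFun (eq_of_eq_on_test (S := fun f => fourierL2 (dilation c hc f))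
    (T := fun f => dilation c⁻¹ (inv_pos.mpr hc) (fourierL2 f))
    (fourierL2.continuous.comp (Dynamo.dilation c hc).continuous)
    ((Dynamo.dilation _ _).continuous.comp fourierL2.continuous) fun φ hφ => ?_) f
  have h1 : Dynamo.dilation c hc hφ.toL2 = (hφ.dilation hc).toL2 := by
    refine Lp.ext ?_
    filter_upwards [coeFn_dilation hc hφ.toL2, (hφ.dilation hc).coeFn_toL2,
      (quasiMeasurePreserving_smul hc).ae_eq_comp hφ.coeFn_toL2]
      with x h1 h2 h3
    rw [h1, h2]
    exact congrArg _ h3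
  refine Lp.ext ?_
  rw [h1]
  filter_upwards [(hφ.dilation hc).coeFn_fourierL2, coeFn_dilation (inv_pos.mpr hc)
    (fourierL2 hφ.toL2), (quasiMeasurePreserving_smul (inv_pos.mpr hc)).ae_eq_comp
      hφ.coeFn_fourierL2] with η h2 h3 h4
  rw [h2, h3, fourier_dilation φ hc]
  exact congrArg _ h4.symm

end dilation

section conj

/-- Complex conjugation on `ℂ³`. -/
noncomputable def conjC3 : C3 →L[ℝ] C3 :=
  LinearMap.toContinuousLinearMap
    { toFun := fun z => WithLp.toLp 2 fun i => (starRingEnd ℂ) (z i)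
      map_add' := fun z w => by ext i; simp
      map_smul' := fun c z => by ext i; simp }

@[simp] theorem conjC3_apply (z : C3) (i : Fin 3) : conjC3 z i = (starRingEnd ℂ) (z i) := rfl

theorem norm_conjC3 (z : C3) : ‖conjC3 z‖ = ‖z‖ := by
  simp [EuclideanSpace.norm_eq]

/-- The real part of a vector of `ℂ³`. -/
noncomputable def reC3 : C3 →L[ℝ] E3 :=
  LinearMap.toContinuousLinearMap
    { toFun := fun z => WithLp.toLp 2 fun i => (z i).re
      map_add' := fun z w => by ext i; simp
      map_smul' := fun c z => by ext i; simp }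

@[simp] theorem reC3_apply (z : C3) (i : Fin 3) : reC3 z i = (z i).re := rfl

theorem toC3_reC3 (z : C3) : toC3 (reC3 z) = (2⁻¹ : ℝ) • (z + conjC3 z) := by
  ext i
  apply Complex.ext <;> (simp; try ring)

theorem inner_reC3 (a : E3) (z : C3) : inner ℝ (reC3 z) a = (inner ℂ (toC3 a) z).re := by
  simp [PiLp.inner_apply, Fin.sum_univ_three]
  ring

theorem norm_reC3_le (z : C3) : ‖reC3 z‖ ≤ ‖z‖ := by
  rw [EuclideanSpace.norm_eq, EuclideanSpace.norm_eq]
  gcongr with i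
  exact Complex.abs_re_le_norm _

/-- Complex conjugation on `L²`. -/
noncomputable def conjOp : L2C →L[ℝ] L2C := conjC3.compLpL 2 volume

theorem coeFn_conjOp (f : L2C) : conjOp f =ᵐ[volume] fun x => conjC3 (f x) :=
  conjC3.coeFn_compLpL f

/-- The real part on `L²`. -/
noncomputable def reOp : L2C →L[ℝ] L2 := reC3.compLpL 2 volume

theorem coeFn_reOp (f : L2C) : reOp f =ᵐ[volume] fun x => reC3 (f x) := reC3.coeFn_compLpL f

/-- The inclusion of real fields in complex fields. -/
noncomputable def complexify : L2 →L[ℝ] L2C := toC3CLM.compLpL 2 volume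

theorem coeFn_complexify (f : L2) : complexify f =ᵐ[volume] fun x => toC3 (f x) :=
  toC3CLM.coeFn_compLpL f

theorem norm_complexify (f : L2) : ‖complexify f‖ = ‖f‖ := by
  rw [Lp.norm_def, Lp.norm_def]
  refine congrArg _ (eLpNorm_congr_norm_ae ?_)
  filter_upwards [coeFn_complexify f] with x hx
  rw [hx, norm_toC3]

theorem complexify_reOp (f : L2C) : complexify (reOp f) = (2⁻¹ : ℝ) • (f + conjOp f) := by
  refine Lp.ext ?_
  filter_upwards [coeFn_complexify (reOp f), coeFn_reOp f, coeFn_conjOp f,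
    Lp.coeFn_smul (2⁻¹ : ℝ) (f + conjOp f), Lp.coeFn_add f (conjOp f)] with x h1 h2 h3 h4 h5
  rw [h1, h2, h4, Pi.smul_apply, h5, Pi.add_apply, h3, toC3_reC3]

/-- The reflection `f ↦ f(-·)`. -/
noncomputable def negOp : L2C →ₗᵢ[ℂ] L2C :=
  Lp.compMeasurePreservingₗᵢ ℂ (fun x : E3 => -x) (Measure.measurePreserving_neg volume)

theorem coeFn_negOp (f : L2C) : negOp f =ᵐ[volume] fun x => f (-x) :=
  Lp.coeFn_compMeasurePreserving f (Measure.measurePreserving_neg volume)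

theorem fourier_conj (φ : E3 → C3) (η : E3) :
    𝓕 (fun x => conjC3 (φ x)) η = conjC3 (𝓕 φ (-η)) := by
  rw [Real.fourier_eq', Real.fourier_eq']
  let L : C3 ≃L[ℝ] C3 := ContinuousLinearEquiv.equivOfInverse conjC3 conjC3
    (fun z => by ext i; simp) (fun z => by ext i; simp)
  have hL : ∀ z, L z = conjC3 z := fun z => rfl
  rw [← hL, ← L.integral_comp_comm]
  congr 1
  funext x
  rw [hL]
  ext i
  simp only [PiLp.smul_apply, conjC3_apply, smul_eq_mul, map_mul, ← Complex.exp_conj,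
    Complex.conj_ofReal, Complex.conj_I, inner_neg_right]
  congr 2
  push_cast
  ring

theorem fourierL2_conjOp (f : L2C) : fourierL2 (conjOp f) = negOp (conjOp (fourierL2 f)) := by
  refine congrFun (eq_of_eq_on_test (S := fun f => fourierL2 (conjOp f))
    (T := fun f => negOp (conjOp (fourierL2 f)))
    (fourierL2.continuous.comp conjOp.continuous)
    (negOp.continuous.comp (conjOp.continuous.comp fourierL2.continuous)) fun φ hφ => ?_) f
  have h1 : conjOp hφ.toL2 = (hφ.clm_comp conjC3).toL2 := by
    refine Lp.ext ?_
    filter_upwards [coeFn_conjOp hφ.toL2, (hφ.clm_comp conjC3).coeFn_toL2, hφ.coeFn_toL2]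
      with x h1 h2 h3
    rw [h1, h2, h3]
  refine Lp.ext ?_
  rw [h1]
  filter_upwards [(hφ.clm_comp conjC3).coeFn_fourierL2, coeFn_negOp (conjOp (fourierL2 hφ.toL2)),
    (Measure.measurePreserving_neg (volume : Measure E3)).quasiMeasurePreserving.ae_eq_comp
      ((coeFn_conjOp (fourierL2 hφ.toL2)).trans (hφ.coeFn_fourierL2.fun_comp conjC3))]
    with η h2 h3 h4
  rw [h2, h3, fourier_conj]
  exact h4.symm

theorem norm_conjOp (f : L2C) : ‖conjOp f‖ = ‖f‖ := by
  rw [Lp.norm_def, Lp.norm_def]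
  refine congrArg _ (eLpNorm_congr_norm_ae ?_)
  filter_upwards [coeFn_conjOp f] with x hx
  rw [hx, norm_conjC3]

end conj

/-! ### Weak solutions on the Fourier side -/

theorem integrable_inner_memLp {ψ : E3 → C3} (hψ : MemLp ψ 2 (volume : Measure E3)) (g : L2C) :
    Integrable fun x => inner ℂ (ψ x) (g x) := by
  refine (L2.integrable_inner (𝕜 := ℂ) (hψ.toLp ψ) g).congr ?_
  filter_upwards [hψ.coeFn_toLp] with x hx
  rw [hx]

namespace IsTest

theorem inner_toL2 {ψ : E3 → C3} (hψ : IsTest ψ) (b : L2C) :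
    inner ℂ hψ.toL2 b = ∫ x, inner ℂ (ψ x) (b x) := by
  rw [L2.inner_def]
  refine integral_congr_ae ?_
  filter_upwards [hψ.coeFn_toL2] with x hx
  rw [hx]

theorem inner_fourier {ψ : E3 → C3} (hψ : IsTest ψ) (f : L2C) :
    inner ℂ hψ.toL2 (fourierL2.symm f) = ∫ η, inner ℂ (𝓕 ψ η) (f η) := by
  rw [← fourierL2.inner_map_map, fourierL2.apply_symm_apply, L2.inner_def]
  refine integral_congr_ae ?_
  filter_upwards [hψ.coeFn_fourierL2] with x hx
  rw [hx]

theorem inner_fourierL2 {ψ : E3 → C3} (hψ : IsTest ψ) (f : L2C) :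
    inner ℂ (fourierL2 hψ.toL2) f = ∫ η, inner ℂ (𝓕 ψ η) (f η) := by
  rw [← hψ.inner_fourier, ← fourierL2.inner_map_map hψ.toL2, fourierL2.apply_symm_apply]

theorem integral_re_inner {φ : E3 → E3} (hφ : IsTest φ) (b : L2C) :
    ∫ x, (inner ℂ (Dynamo.toC3 (φ x)) (b x)).re = (inner ℂ hφ.toC3.toL2 b).re := by
  rw [inner_toL2]
  exact Complex.reCLM.integral_comp_comm (integrable_inner_memLp (hφ.toC3.memLp 2) b)

theorem integral_inner_reOp {φ : E3 → E3} (hφ : IsTest φ) (b : L2C) :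
    ∫ x, inner ℝ (reOp b x) (φ x) = (inner ℂ hφ.toC3.toL2 b).re := by
  rw [← hφ.integral_re_inner]
  refine integral_congr_ae ?_
  filter_upwards [coeFn_reOp b] with x hx
  rw [hx, inner_reC3]

theorem toC3_curl {φ : E3 → E3} (hφ : IsTest φ) (x : E3) :
    Dynamo.toC3 (Dynamo.curl φ x) = Dynamo.curl (fun x => Dynamo.toC3 (φ x)) x := by
  rw [hφ.curl_eq, hφ.toC3.curl_eq]
  have h : ∀ i, Dynamo.pderiv i (fun x => Dynamo.toC3 (φ x)) x = Dynamo.toC3 (Dynamo.pderiv i φ x) :=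
    fun i => pderiv_toC3 hφ.1 i x
  simp only [h]
  apply vec_ext <;> simp [cross_apply_zero, cross_apply_one, cross_apply_two]

theorem toC3_laplacian {φ : E3 → E3} (hφ : IsTest φ) (x : E3) :
    Dynamo.toC3 (Laplacian.laplacian φ x) = Laplacian.laplacian (fun x => Dynamo.toC3 (φ x)) x := by
  rw [laplacian_eq_sum_pderiv hφ.1, laplacian_eq_sum_pderiv hφ.toC3.1]
  have h : ∀ i, Dynamo.pderiv i (fun x => Dynamo.toC3 (φ x))
      = fun x => Dynamo.toC3 (Dynamo.pderiv i φ x) := fun i => funext fun x => pderiv_toC3 hφ.1 i x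
  have h' : ∀ i, Dynamo.pderiv i (Dynamo.pderiv i (fun x => Dynamo.toC3 (φ x))) x
      = Dynamo.toC3 (Dynamo.pderiv i (Dynamo.pderiv i φ) x) := fun i => by
    rw [h]; exact pderiv_toC3 (hφ.pderiv i).1 i x
  simp only [h']
  exact map_sum toC3CLM _ _

theorem toL2_congr {φ ψ : E3 → C3} (hφ : IsTest φ) (hψ : IsTest ψ) (h : ∀ x, φ x = ψ x) :
    hφ.toL2 = hψ.toL2 := by
  obtain rfl : φ = ψ := funext h
  rfl

end IsTest

theorem norm_crossCLM_toC3_le {u : E3 → E3} {C : ℝ} (hC : ∀ x, ‖u x‖ ≤ C) (x : E3) :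
    ‖crossCLM ℂ (toC3 (u x))‖ ≤ ‖crossCLM ℂ‖ * C := by
  refine ((crossCLM ℂ).le_opNorm _).trans ?_
  rw [norm_toC3]
  exact mul_le_mul_of_nonneg_left (hC x) (crossCLM ℂ).opNorm_nonneg

theorem continuous_crossCLM_toC3 {u : E3 → E3} (hu : Continuous u) :
    Continuous fun x => crossCLM ℂ (toC3 (u x)) :=
  (crossCLM ℂ).continuous.comp (toC3CLM.continuous.comp hu)

/-- The operator `b ↦ u × b`. -/
noncomputable def velOp (u : E3 → E3) (C : ℝ) (hu : Continuous u) (hC : ∀ x, ‖u x‖ ≤ C) :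
    L2C →L[ℂ] L2C :=
  multOp (fun x => crossCLM ℂ (toC3 (u x))) (‖crossCLM ℂ‖ * C)
    (continuous_crossCLM_toC3 hu).aestronglyMeasurable (norm_crossCLM_toC3_le hC)

theorem coeFn_velOp {u : E3 → E3} {C : ℝ} (hu : Continuous u) (hC : ∀ x, ‖u x‖ ≤ C) (b : L2C) :
    velOp u C hu hC b =ᵐ[volume] fun x => cross (toC3 (u x)) (b x) := coeFn_multOp _ _ b

theorem reC3_cross (a : E3) (z : C3) : reC3 (cross (toC3 a) z) = cross a (reC3 z) := by
  apply vec_ext <;> simp [cross_apply_zero, cross_apply_one, cross_apply_two]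

theorem inner_cross_left (a : E3) (x y : C3) :
    inner ℂ (Complex.I • cross (toC3 a) x) y = inner ℂ x (Complex.I • cross (toC3 a) y) := by
  simp only [inner_eq_sum, Fin.sum_univ_three, PiLp.smul_apply, cross_apply_zero, cross_apply_one,
    cross_apply_two, smul_eq_mul, map_mul, map_sub, toC3_apply, Complex.conj_ofReal,
    Complex.conj_I]
  ring

/-- The right-hand side of the weak equation in terms of Fourier transforms. -/
theorem integral_weak_eq {u : E3 → E3} {C : ℝ} (hu : Continuous u) (hC : ∀ x, ‖u x‖ ≤ C)
    {φ : E3 → E3} (hφ : IsTest φ) (ε : ℝ) (b : L2C) :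
    ∫ x, (inner ℝ (cross (u x) (reOp b x)) (curl φ x)
        + ε * inner ℝ (reOp b x) (Laplacian.laplacian φ x))
      = (inner ℂ hφ.toC3.curl.toL2 (velOp u C hu hC b)
          + ε * inner ℂ hφ.toC3.laplacian.toL2 b).re := by
  have h1 : ∀ᵐ x ∂volume, inner ℝ (cross (u x) (reOp b x)) (curl φ x)
        + ε * inner ℝ (reOp b x) (Laplacian.laplacian φ x)
      = (inner ℂ (toC3 (curl φ x)) (velOp u C hu hC b x)
        + ε * inner ℂ (toC3 (Laplacian.laplacian φ x)) (b x)).re := by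
    filter_upwards [coeFn_reOp b, coeFn_velOp hu hC b] with x h1 h2
    rw [h1, h2, Complex.add_re, Complex.re_ofReal_mul, ← inner_reC3, ← inner_reC3, reC3_cross]
  have i1 := integrable_inner_memLp (hφ.curl.toC3.memLp 2) (velOp u C hu hC b)
  have i2 := (integrable_inner_memLp (hφ.laplacian.toC3.memLp 2) b).const_mul (ε : ℂ)
  have h2 := Complex.reCLM.integral_comp_comm (i1.add i2)
  simp only [Complex.reCLM_apply, Pi.add_apply] at h2
  rw [integral_congr_ae h1, h2, integral_add i1 i2, integral_const_mul,
    ← hφ.curl.toC3.inner_toL2, ← hφ.laplacian.toC3.inner_toL2,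
    hφ.curl.toC3.toL2_congr hφ.toC3.curl hφ.toC3_curl,
    hφ.laplacian.toC3.toL2_congr hφ.toC3.laplacian hφ.toC3_laplacian]

theorem memLp_of_continuous {F : Type*} [NormedAddCommGroup F] {g : ℝ → F} (hg : Continuous g)
    (T : ℝ) : MemLp g 2 (volume.restrict (Set.Ioc 0 T)) := by
  obtain ⟨C, hC⟩ := (isCompact_Icc (a := (0 : ℝ)) (b := T)).exists_bound_of_continuousOn
    hg.continuousOn
  refine MemLp.of_bound (hg.continuousOn.aestronglyMeasurable_of_isCompact isCompact_Icc
    measurableSet_Icc |>.mono_measure (Measure.restrict_mono Set.Ioc_subset_Icc_self le_rfl)) C ?_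
  filter_upwards [ae_restrict_mem measurableSet_Ioc] with t ht
  exact hC t (Set.Ioc_subset_Icc_self ht)

/-- The gradient of φ is the sum of ∂ᵢ(φ eᵢ), so its transform is a scalar times the wave vector,
and Plancherel reduces the pairing to the pointwise condition. -/
theorem weaklyDivFree_reOp {f : L2C} (hdiv : ∀ᵐ η, cdot (toC3 (waveVec η)) (f η) = 0) :
    WeaklyDivFree (reOp (fourierL2.symm f)) := by
  intro φ hφ
  let e : Fin 3 → C3 := fun i => EuclideanSpace.single i 1
  have hψ : ∀ i, IsTest fun x => φ x • e i := fun i =>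
    hφ.clm_comp (ContinuousLinearMap.toSpanSingleton ℝ (e i))
  have hΨ := (((hψ 0).pderiv 0).add ((hψ 1).pderiv 1)).add ((hψ 2).pderiv 2)
  have hp : ∀ i x, pderiv i (fun x => φ x • e i) x = pderiv i φ x • e i := fun i x => by
    have := ((hφ.1.differentiable (by simp)).differentiableAt (x := x)).hasFDerivAt.smul_const (e i)
    unfold pderiv
    rw [this.fderiv]
    simp
  have hgrad : ∀ i x, gradient φ x i = pderiv i φ x := fun i x => by
    have h : inner ℝ (gradient φ x) (basisVec i) = fderiv ℝ φ x (basisVec i) :=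
      InnerProductSpace.toDual_symm_apply
    rw [pderiv, ← h, basisVec, EuclideanSpace.inner_single_right]
    simp
  have h1 : ∀ x, toC3 (gradient φ x) = pderiv 0 (fun x => φ x • e 0) x
      + pderiv 1 (fun x => φ x • e 1) x + pderiv 2 (fun x => φ x • e 2) x := fun x => by
    rw [hp, hp, hp]
    apply vec_ext <;> simp [e, hgrad]
  have h2 : ∀ i η, 𝓕 (fun x => φ x • e i) η = (𝓕 (fun x => φ x • e 0) η 0) • e i := fun i η => by
    have := (hψ 0).fourier_clm (ContinuousLinearMap.toSpanSingleton ℂ (e i) ∘L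
      EuclideanSpace.proj (𝕜 := ℂ) 0) η
    refine Eq.trans (congrArg (fun g : E3 → C3 => 𝓕 g η) (funext fun x => ?_)) this
    simp [e]
  have h3 : ∫ x, inner ℝ (reOp (fourierL2.symm f) x) (gradient φ x)
      = (inner ℂ hΨ.toL2 (fourierL2.symm f)).re := by
    rw [hΨ.inner_toL2]
    refine Eq.trans ?_ (Complex.reCLM.integral_comp_comm
      (integrable_inner_memLp (hΨ.memLp 2) (fourierL2.symm f)))
    refine integral_congr_ae ?_
    filter_upwards [coeFn_reOp (fourierL2.symm f)] with x hx
    rw [hx, inner_reC3, h1, Complex.reCLM_apply]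
  rw [h3, hΨ.inner_fourier, integral_eq_zero_of_ae, Complex.zero_re]
  filter_upwards [hdiv] with η hη
  rw [IsTest.fourier_add (((hψ 0).pderiv 0).add ((hψ 1).pderiv 1)) ((hψ 2).pderiv 2),
    IsTest.fourier_add ((hψ 0).pderiv 0) ((hψ 1).pderiv 1), (hψ 0).fourier_pderiv,
    (hψ 1).fourier_pderiv, (hψ 2).fourier_pderiv]
  obtain ⟨c, hc⟩ : ∃ c : ℂ, ∀ i, 𝓕 (fun x => φ x • e i) η = c • e i := ⟨_, fun i => h2 i η⟩
  simp only [cdot, Fin.sum_univ_three, toC3_apply] at hη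
  have he : ∀ (c : ℂ) i, inner ℂ (c • e i) (f η) = (starRingEnd ℂ) c * f η i := fun c i => by
    rw [inner_smul_left, EuclideanSpace.inner_single_left]
    simp
  rw [hc, hc, hc, inner_add_left, inner_add_left, smul_smul, smul_smul, smul_smul, he, he, he]
  simp only [map_mul, Complex.conj_I, Complex.conj_ofReal, Pi.zero_apply]
  linear_combination (-Complex.I * (starRingEnd ℂ) c) * hη

/-- The real part of the inner product with a fixed field. -/
noncomputable def rePair (v : L2C) : L2C →L[ℝ] ℝ :=
  LinearMap.mkContinuous
    { toFun := fun g => (inner ℂ v g).re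
      map_add' := fun g h => by rw [inner_add_right, Complex.add_re]
      map_smul' := fun c g => by
        rw [inner_smul_right_eq_smul, Complex.real_smul, Complex.re_ofReal_mul]
        rfl }
    ‖v‖ fun g => (Complex.abs_re_le_norm _).trans (norm_inner_le_norm v g)

theorem rePair_apply (v g : L2C) : rePair v g = (inner ℂ v g).re := rfl

/-- By Plancherel, testing against φ turns the pointwise evolution equation into a scalar one with
continuous derivative, and the weak form is the fundamental theorem of calculus. The curves q are
the transforms of the gradient up to the factor i; their continuity gives the H¹ bound on bounded
time intervals. -/
theorem isKDESolution_reOp {u : E3 → E3} {C ε : ℝ} (hu : Continuous u) (hC : ∀ x, ‖u x‖ ≤ C)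
    {f f' : ℝ → L2C} {q : Fin 3 → ℝ → L2C} (hf' : Continuous f')
    (hff' : ∀ t, HasDerivAt f (f' t) t) (hq : ∀ i, Continuous (q i))
    (hqf : ∀ i t, q i t =ᵐ[volume] fun η => (waveVec η i : ℂ) • f t η)
    (hdiv : ∀ t, ∀ᵐ η, cdot (toC3 (waveVec η)) (f t η) = 0)
    (heq : ∀ t, f' t =ᵐ[volume] fun η =>
      Complex.I • cross (toC3 (waveVec η)) (fourierL2 (velOp u C hu hC (fourierL2.symm (f t))) η)
        - ((ε * ‖waveVec η‖ ^ 2 : ℝ) : ℂ) • f t η) :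
    IsKDESolution u ε (reOp (fourierL2.symm (f 0))) (fun t => reOp (fourierL2.symm (f t))) := by
  have hf : Continuous f := continuous_iff_continuousAt.mpr fun t => (hff' t).continuousAt
  refine ⟨rfl, ?_, ⟨fun i t => reOp (fourierL2.symm (Complex.I • q i t)), ?_, ?_⟩,
    fun t _ => weaklyDivFree_reOp (hdiv t), ?_⟩
  · exact (reOp.continuous.comp (fourierL2.symm.continuous.comp hf)).continuousOn
  · refine fun i => Filter.Eventually.of_forall fun t φ hφ => ?_
    rw [hφ.integral_inner_reOp, (hφ.pderiv i).integral_inner_reOp, IsTest.inner_fourier,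
      IsTest.inner_fourier, ← Complex.neg_re, ← integral_neg]
    congr 1
    refine integral_congr_ae ?_
    filter_upwards [hqf i t, Lp.coeFn_smul Complex.I (q i t)] with η h1 h2
    have h3 : (fun x => toC3 (pderiv i φ x)) = pderiv i (fun x => toC3 (φ x)) :=
      funext fun x => (pderiv_toC3 hφ.1 i x).symm
    rw [h3, hφ.toC3.fourier_pderiv, h2, Pi.smul_apply, h1, inner_smul_left, inner_smul_right,
      inner_smul_right, map_mul, Complex.conj_I, Complex.conj_ofReal]
    ring
  · intro i T _
    have h1 : Continuous fun t => Complex.I • q i t := (hq i).const_smul Complex.I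
    have h2 : Continuous fun t => fourierL2.symm (Complex.I • q i t) :=
      fourierL2.symm.continuous.comp h1
    exact memLp_of_continuous (reOp.continuous.comp h2) T
  · intro φ hφ t ht
    -- A bounded real functional on the Fourier side, so it commutes with the time derivative of f.
    set L := rePair (fourierL2 hφ.toC3.toL2) with hLdef
    have hL : ∀ g, (inner ℂ hφ.toC3.toL2 (fourierL2.symm g)).re = L g := fun g => by
      rw [hLdef, rePair_apply, IsTest.inner_fourierL2, IsTest.inner_fourier]
    have hd : ∀ s, HasDerivAt (fun s => L (f s)) (L (f' s)) s := fun s =>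
      (L.hasFDerivAt.comp_hasDerivAt s (hff' s))
    have hint : ∀ s, ∫ x, (inner ℝ (cross (u x) (reOp (fourierL2.symm (f s)) x)) (curl φ x)
        + ε * inner ℝ (reOp (fourierL2.symm (f s)) x) (Laplacian.laplacian φ x)) = L (f' s) := by
      intro s
      rw [integral_weak_eq hu hC hφ, ← hL, IsTest.inner_fourier, IsTest.inner_fourier,
        ← fourierL2.symm_apply_apply (velOp u C hu hC (fourierL2.symm (f s))),
        IsTest.inner_fourier, ← integral_const_mul, ← integral_add]
      · congr 1
        refine integral_congr_ae ?_
        filter_upwards [heq s] with η h1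
        rw [hφ.toC3.fourier_curl, hφ.toC3.fourier_laplacian, h1, inner_sub_right,
          inner_cross_left, inner_smul_left, inner_smul_right, inner_smul_right]
        simp only [map_neg, Complex.conj_ofReal]
        push_cast
        ring
      · exact integrable_inner_memLp hφ.toC3.curl.memLp_fourier _
      · exact (integrable_inner_memLp hφ.toC3.laplacian.memLp_fourier _).const_mul _
    simp only [hint, hφ.integral_inner_reOp, hL]
    rw [intervalIntegral.integral_eq_sub_of_hasDerivAt (fun s _ => hd s)
      ((L.continuous.comp hf').intervalIntegrable _ _)]
    ring

/-! ### Wave packets of Bloch type -/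

/-- A lattice vector as a real vector. -/
noncomputable def latReal (m : Z3) : E3 := WithLp.toLp 2 fun i => (m i : ℝ)

@[simp] theorem latReal_apply (m : Z3) (i : Fin 3) : latReal m i = m i := rfl

/-- The lattice point closest to `p`. -/
noncomputable def modeIdx (p : E3) : Z3 := fun i => ⌊p i + 1 / 2⌋

/-- The quasi-momentum of `p`. -/
noncomputable def quasiMom (p : E3) : E3 := p - latReal (modeIdx p)

theorem measurable_modeIdx : Measurable modeIdx :=
  measurable_pi_lambda _ fun i => Int.measurable_floor.comp (by fun_prop)

theorem measurable_quasiMom : Measurable quasiMom := by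
  have : Measurable latReal := measurable_of_countable _
  exact measurable_id.sub (this.comp measurable_modeIdx)

theorem modeIdx_sub (p : E3) (l : Z3) : modeIdx (p - latReal l) = modeIdx p - l := by
  funext i
  simp only [modeIdx, PiLp.sub_apply, latReal_apply, Pi.sub_apply]
  rw [← Int.floor_sub_intCast]
  congr 1
  ring

theorem quasiMom_sub (p : E3) (l : Z3) : quasiMom (p - latReal l) = quasiMom p := by
  rw [quasiMom, quasiMom, modeIdx_sub]
  ext i
  simp

theorem quasiMom_add_latVec (p : E3) : latVec (modeIdx p) + toC3 (quasiMom p) = toC3 p := by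
  ext i
  simp [quasiMom]

section packet

variable {K : Set E3} [CompactSpace K]

open Classical in
/-- The extension by zero of the `m`-th component of `H`. -/
noncomputable def modeExt (H : C(K, Seq)) (m : Z3) (κ : E3) : C3 :=
  if h : κ ∈ K then H ⟨κ, h⟩ m else 0

omit [CompactSpace K] in
theorem modeExt_of_mem (H : C(K, Seq)) (m : Z3) {κ : E3} (h : κ ∈ K) :
    modeExt H m κ = H ⟨κ, h⟩ m := dif_pos h

omit [CompactSpace K] in
theorem modeExt_of_notMem (H : C(K, Seq)) (m : Z3) {κ : E3} (h : κ ∉ K) :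
    modeExt H m κ = 0 := dif_neg h

theorem measurable_modeExt (H : C(K, Seq)) (m : Z3) : Measurable (modeExt H m) := by
  classical
  have hK : MeasurableSet K := (isCompact_iff_compactSpace.mpr inferInstance).measurableSet
  have h1 : Continuous fun κ : K => H κ m :=
    (lp.evalCLM ℂ (fun _ : Z3 => C3) 2 m).continuous.comp H.continuous
  exact Measurable.dite h1.measurable measurable_const hK

/-- The Fourier transform of the wave packet with profile `H`. -/
noncomputable def packetFun (H : C(K, Seq)) (p : E3) : C3 := modeExt H (modeIdx p) (quasiMom p)

theorem measurable_packetFun (H : C(K, Seq)) : Measurable (packetFun H) := by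
  have h : Measurable fun q : E3 × Z3 => modeExt H q.2 q.1 :=
    measurable_from_prod_countable_left fun m => measurable_modeExt H m
  exact h.comp (measurable_quasiMom.prodMk measurable_modeIdx)

theorem continuous_waveVec : Continuous waveVec := continuous_const_smul _

theorem waveVec_sub_lat (η : E3) (l : Z3) :
    waveVec (η - (2 * Real.pi)⁻¹ • latReal l) = waveVec η - latReal l := by
  rw [waveVec, waveVec, smul_sub, smul_inv_smul₀ (by positivity)]

/-- At each η only one lattice index contributes, so the integrand is bounded by the sum over all
indices. Translating each term back to index 0 makes the frequencies add up to ‖H κ‖² over κ in K.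
-/
theorem lintegral_packetFun_le (H : C(K, Seq)) :
    ∫⁻ η, ‖packetFun H (waveVec η)‖ₑ ^ 2 ≤ ENNReal.ofReal (‖H‖ ^ 2) * volume (waveVec ⁻¹' K) := by
  have hK : MeasurableSet K := (isCompact_iff_compactSpace.mpr inferInstance).measurableSet
  have hm : ∀ m : Z3, Measurable fun η => ‖modeExt H m (waveVec η)‖ₑ ^ 2 := fun m =>
    ((measurable_modeExt H m).comp continuous_waveVec.measurable).enorm.pow_const 2
  calc ∫⁻ η, ‖packetFun H (waveVec η)‖ₑ ^ 2
      ≤ ∫⁻ η, ∑' m : Z3, ‖modeExt H m (waveVec (η - (2 * Real.pi)⁻¹ • latReal m))‖ₑ ^ 2 := by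
        refine lintegral_mono fun η => ?_
        refine le_trans (le_of_eq ?_) (ENNReal.le_tsum (modeIdx (waveVec η)))
        rw [waveVec_sub_lat]
        rfl
    _ = ∑' m : Z3, ∫⁻ η, ‖modeExt H m (waveVec η)‖ₑ ^ 2 := by
        rw [lintegral_tsum]
        · congr 1
          funext m
          exact lintegral_sub_right_eq_self (fun η => ‖modeExt H m (waveVec η)‖ₑ ^ 2) _
        · exact fun m => ((hm m).comp (measurable_sub_const _)).aemeasurable
    _ = ∫⁻ η, ∑' m : Z3, ‖modeExt H m (waveVec η)‖ₑ ^ 2 :=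
        (lintegral_tsum fun m => (hm m).aemeasurable).symm
    _ ≤ ∫⁻ η, (waveVec ⁻¹' K).indicator (fun _ => ENNReal.ofReal (‖H‖ ^ 2)) η := by
        refine lintegral_mono fun η => ?_
        by_cases h : waveVec η ∈ K
        · rw [Set.indicator_of_mem (by exact h)]
          simp only [modeExt_of_mem H _ h]
          calc ∑' m : Z3, ‖H ⟨waveVec η, h⟩ m‖ₑ ^ 2
              = ∑' m : Z3, ENNReal.ofReal (‖H ⟨waveVec η, h⟩ m‖ ^ 2) := by
                congr 1; funext m
                rw [← ofReal_norm, ENNReal.ofReal_pow (norm_nonneg _)]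
            _ = ENNReal.ofReal (‖H ⟨waveVec η, h⟩‖ ^ 2) := by
                rw [seq_norm_sq, ENNReal.ofReal_tsum_of_nonneg (fun m => by positivity)
                  (summable_seq _)]
            _ ≤ _ := by
                apply ENNReal.ofReal_le_ofReal
                gcongr
                exact H.norm_coe_le_norm _
        · simp [modeExt_of_notMem H _ h]
    _ = _ := lintegral_indicator_const (continuous_waveVec.measurable hK) _

theorem volume_preimage_waveVec_lt_top : volume (waveVec ⁻¹' K) < ⊤ := by
  have hK : IsCompact K := isCompact_iff_compactSpace.mpr inferInstance
  have : waveVec ⁻¹' K = (fun x => (2 * Real.pi)⁻¹ • x) '' K := by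
    ext η
    constructor
    · intro h
      exact ⟨waveVec η, h, inv_smul_smul₀ (by positivity) η⟩
    · rintro ⟨κ, hκ, rfl⟩
      show waveVec _ ∈ K
      rw [waveVec, smul_inv_smul₀ (by positivity)]
      exact hκ
  rw [this]
  exact (hK.image (continuous_const_smul _)).measure_lt_top

theorem memLp_packetFun (H : C(K, Seq)) :
    MemLp (fun η => packetFun H (waveVec η)) 2 (volume : Measure E3) := by
  refine ⟨((measurable_packetFun H).comp continuous_waveVec.measurable).aestronglyMeasurable, ?_⟩
  rw [eLpNorm_lt_top_iff_lintegral_rpow_enorm_lt_top (by norm_num) (by norm_num)]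
  simp only [ENNReal.toReal_ofNat, ENNReal.rpow_ofNat]
  exact (lintegral_packetFun_le H).trans_lt
    (ENNReal.mul_lt_top ENNReal.ofReal_lt_top volume_preimage_waveVec_lt_top)

omit [CompactSpace K] in
theorem packetFun_add (H G : C(K, Seq)) (p : E3) :
    packetFun (H + G) p = packetFun H p + packetFun G p := by
  by_cases h : quasiMom p ∈ K
  · simp [packetFun, modeExt_of_mem _ _ h]
  · simp [packetFun, modeExt_of_notMem _ _ h]

omit [CompactSpace K] in
theorem packetFun_smul (c : ℂ) (H : C(K, Seq)) (p : E3) :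
    packetFun (c • H) p = c • packetFun H p := by
  by_cases h : quasiMom p ∈ K
  · simp [packetFun, modeExt_of_mem _ _ h]
  · simp [packetFun, modeExt_of_notMem _ _ h]

variable (K) in
/-- The operator that sends a profile to the Fourier transform of the wave packet. -/
noncomputable def packet : C(K, Seq) →L[ℂ] L2C :=
  LinearMap.mkContinuous
    { toFun := fun H => (memLp_packetFun H).toLp _
      map_add' := fun H G => by
        rw [← MemLp.toLp_add]
        exact MemLp.toLp_congr _ _ (Filter.Eventually.of_forall fun η => packetFun_add H G _)
      map_smul' := fun c H => by
        rw [RingHom.id_apply, ← MemLp.toLp_const_smul]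
        exact MemLp.toLp_congr _ _ (Filter.Eventually.of_forall fun η => packetFun_smul c H _) }
    (Real.sqrt (volume (waveVec ⁻¹' K)).toReal) fun H => by
      simp only [LinearMap.coe_mk, AddHom.coe_mk]
      rw [← sq_le_sq₀ (norm_nonneg _) (by positivity), norm_sq_eq_integral (F := C3), mul_pow,
        Real.sq_sqrt ENNReal.toReal_nonneg]
      have h1 : ∫ η, ‖(memLp_packetFun H).toLp _ η‖ ^ 2
          = (∫⁻ η, ‖packetFun H (waveVec η)‖ₑ ^ 2).toReal := by
        rw [integral_eq_lintegral_of_nonneg_ae]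
        · congr 1
          refine lintegral_congr_ae ?_
          filter_upwards [(memLp_packetFun H).coeFn_toLp] with η hη
          rw [hη, ENNReal.ofReal_pow (norm_nonneg _), ofReal_norm]
        · exact Filter.Eventually.of_forall fun η => by positivity
        · exact (Lp.aestronglyMeasurable _).norm.pow 2
      rw [h1, mul_comm]
      refine (ENNReal.toReal_mono (ENNReal.mul_lt_top ENNReal.ofReal_lt_top
        volume_preimage_waveVec_lt_top).ne (lintegral_packetFun_le H)).trans (le_of_eq ?_)
      rw [ENNReal.toReal_mul, ENNReal.toReal_ofReal (by positivity)]

theorem coeFn_packet (H : C(K, Seq)) :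
    packet K H =ᵐ[volume] fun η => packetFun H (waveVec η) := (memLp_packetFun H).coeFn_toLp

/-- Composition of a profile with an operator. -/
noncomputable def profileMap (T : Seq →L[ℂ] Seq) (H : C(K, Seq)) : C(K, Seq) :=
  ⟨fun κ => T (H κ), T.continuous.comp H.continuous⟩

omit [CompactSpace K] in
theorem profileMap_apply (T : Seq →L[ℂ] Seq) (H : C(K, Seq)) (κ : K) :
    profileMap T H κ = T (H κ) := rfl

omit [CompactSpace K] in
-- The quasi-momentum is invariant under lattice translations, so shifting a profile amounts to
-- translating its packet.
theorem packetFun_crossShift (c : C3) (l : Z3) (H : C(K, Seq)) (p : E3) :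
    packetFun (profileMap ((crossOp c).comp (shiftOp l)) H) p
      = cross c (packetFun H (p - latReal l)) := by
  rw [packetFun, packetFun, quasiMom_sub, modeIdx_sub]
  by_cases h : quasiMom p ∈ K
  · rw [modeExt_of_mem _ _ h, modeExt_of_mem _ _ h]
    rfl
  · rw [modeExt_of_notMem _ _ h, modeExt_of_notMem _ _ h, cross_zero_right]

/-- Applying an operator to the fixed profile H is bounded and linear in the operator, hence
preserves the norm-convergent series that defines `convOp`. -/
theorem hasSum_profileMap_convOp {u : Z3 → C3} (hu : Summable fun l => ‖u l‖) (H : C(K, Seq)) :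
    HasSum (fun l => profileMap ((crossOp (u l)).comp (shiftOp l)) H)
      (profileMap (convOp u) H) := by
  let L : (Seq →L[ℂ] Seq) →L[ℂ] C(K, Seq) := LinearMap.mkContinuous
    { toFun := fun T => profileMap T H
      map_add' := fun T T' => rfl
      map_smul' := fun c T => rfl } ‖H‖ fun T => by
        rw [ContinuousMap.norm_le _ (by positivity)]
        intro κ
        rw [mul_comm]
        exact (T.le_opNorm _).trans (by gcongr; exact H.norm_coe_le_norm _)
  exact (summable_convOp hu).hasSum.mapL L

end packet

/-! ### Multiplication by the periodic field acts fibrewise on packets -/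

section velocity

/-- A constant matrix acting on `L²`. -/
noncomputable def constOp (L : C3 →L[ℂ] C3) : L2C →L[ℂ] L2C := L.compLpL 2 volume

theorem coeFn_constOp (L : C3 →L[ℂ] C3) (f : L2C) : constOp L f =ᵐ[volume] fun x => L (f x) :=
  L.coeFn_compLpL f

theorem norm_constOp_apply_le (L : C3 →L[ℂ] C3) (f : L2C) : ‖constOp L f‖ ≤ ‖L‖ * ‖f‖ :=
  L.norm_compLp_le f

theorem fourierL2_constOp (L : C3 →L[ℂ] C3) (f : L2C) :
    fourierL2 (constOp L f) = constOp L (fourierL2 f) := by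
  refine congrFun (eq_of_eq_on_test (S := fun f => fourierL2 (constOp L f))
    (T := fun f => constOp L (fourierL2 f))
    (fourierL2.continuous.comp (constOp L).continuous)
    ((constOp L).continuous.comp fourierL2.continuous) fun φ hφ => ?_) f
  have hL := hφ.clm_comp (L.restrictScalars ℝ)
  have h1 : constOp L hφ.toL2 = hL.toL2 := by
    refine Lp.ext ?_
    filter_upwards [coeFn_constOp L hφ.toL2, hL.coeFn_toL2, hφ.coeFn_toL2]
      with x h1 h2 h3
    rw [h1, h2, h3]
    rfl
  refine Lp.ext ?_
  rw [h1]
  filter_upwards [hL.coeFn_fourierL2, coeFn_constOp L (fourierL2 hφ.toL2), hφ.coeFn_fourierL2]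
    with η h2 h3 h4
  rw [h2, h3, h4]
  exact hφ.fourier_clm L η

theorem integral_norm_inner_le (f g : L2C) : ∫ x, ‖inner ℂ (f x) (g x)‖ ≤ ‖f‖ * ‖g‖ := by
  have h : ∀ f : L2C, (∫ x, ‖f x‖ ^ (2 : ℝ)) ^ (1 / 2 : ℝ) = ‖f‖ := fun f => by
    simp only [Real.rpow_ofNat]
    rw [← norm_sq_eq_integral (F := C3), ← Real.sqrt_eq_rpow, Real.sqrt_sq (norm_nonneg _)]
  have h2 := integral_mul_norm_le_Lp_mul_Lq (μ := (volume : Measure E3)) (p := 2) (q := 2)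
    (f := f) (g := g) Real.HolderConjugate.two_two (by simpa using Lp.memLp f)
    (by simpa using Lp.memLp g)
  rw [h, h] at h2
  refine le_trans (integral_mono_of_nonneg (Filter.Eventually.of_forall fun x => norm_nonneg _) ?_
    (Filter.Eventually.of_forall fun x => norm_inner_le_norm _ _)) h2
  exact (Lp.memLp f).norm.integrable_mul (Lp.memLp g).norm

/-- An absolutely convergent series in `L²` has its pointwise sum as a limit. -/
theorem hasSum_of_ae_hasSum {ι : Type*} [Countable ι] {F : ι → L2C} {g : L2C}
    (hF : Summable fun i => ‖F i‖) (h : ∀ᵐ x, HasSum (fun i => F i x) (g x)) : HasSum F g := by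
  have hs : Summable F := hF.of_norm
  suffices hg : ∑' i, F i = g by rw [← hg]; exact hs.hasSum
  refine ext_inner_left ℂ fun v => ?_
  have h1 : HasSum (fun i => inner ℂ v (F i)) (inner ℂ v (∑' i, F i)) :=
    hs.hasSum.mapL (innerSL ℂ v)
  have hint : ∀ i, Integrable (fun x => inner ℂ (v x) (F i x)) (volume : Measure E3) :=
    fun i => L2.integrable_inner v (F i)
  have hb : ∀ i, ∫ x, ‖inner ℂ (v x) (F i x)‖ ≤ ‖v‖ * ‖F i‖ := fun i =>
    integral_norm_inner_le v (F i)
  have h2 := hasSum_integral_of_summable_integral_norm hint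
    (Summable.of_nonneg_of_le (fun i => integral_nonneg fun x => norm_nonneg _) hb
      (hF.mul_left ‖v‖))
  have h3 : ∫ x, ∑' i, inner ℂ (v x) (F i x) = inner ℂ v g := by
    rw [L2.inner_def]
    refine integral_congr_ae ?_
    filter_upwards [h] with x hx
    exact (hx.mapL (innerSL ℂ (v x))).tsum_eq
  rw [h3] at h2
  refine h1.unique ?_
  convert! h2 using 2

theorem ech_eq_character (l : Z3) (x : E3) : ech l x = character (latReal l) x := by
  rw [ech, character]
  congr 3
  simp [PiLp.inner_apply, mul_comm]

variable {U : E3 → E3} {C : ℝ}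

theorem hasSum_velOp (hp : TorusPeriodic U) (hU : ContDiff ℝ ∞ U) (hC : ∀ x, ‖U x‖ ≤ C) (b : L2C) :
    HasSum (fun l => modOp (latReal l) (constOp (crossCLM ℂ (uhat U l)) b))
      (velOp U C hU.continuous hC b) := by
  have hu := summable_uhat hp hU
  have hn : ∀ l, ‖modOp (latReal l) (constOp (crossCLM ℂ (uhat U l)) b)‖
      ≤ ‖uhat U l‖ * (‖crossCLM ℂ‖ * ‖b‖) := fun l => by
    calc _ ≤ 1 * ‖constOp (crossCLM ℂ (uhat U l)) b‖ := norm_multOp_apply_le _ _ _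
      _ ≤ ‖crossCLM ℂ (uhat U l)‖ * ‖b‖ := by rw [one_mul]; exact norm_constOp_apply_le _ _
      _ ≤ (‖crossCLM ℂ‖ * ‖uhat U l‖) * ‖b‖ :=
          mul_le_mul_of_nonneg_right ((crossCLM ℂ).le_opNorm _) (norm_nonneg _)
      _ = _ := by ring
  refine hasSum_of_ae_hasSum (Summable.of_nonneg_of_le (fun _ => norm_nonneg _) hn
    (hu.mul_right _)) ?_
  have h1 : ∀ᵐ x ∂volume, ∀ l, modOp (latReal l) (constOp (crossCLM ℂ (uhat U l)) b) x
      = character (latReal l) x • cross (uhat U l) (b x) := by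
    rw [ae_all_iff]
    intro l
    filter_upwards [coeFn_modOp (latReal l) (constOp (crossCLM ℂ (uhat U l)) b),
      coeFn_constOp (crossCLM ℂ (uhat U l)) b] with x h1 h2
    rw [h1, h2, crossCLM_apply]
  filter_upwards [h1, coeFn_velOp hU.continuous hC b] with x h1 h2
  rw [h2]
  have h3 := (hasSum_ech_smul_uhat hp hU x).mapL ((crossCLM ℂ).flip (b x))
  refine Eq.mp (congrArg (fun F => HasSum F _) (funext fun l => ?_)) h3
  rw [h1, ← ech_eq_character, map_smul]
  rfl

/-- Each term of the Fourier series of U is a character with lattice wave vector, which becomes a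
lattice translation on the Fourier side. It leaves the quasi-momentum fixed and acts on the fibre as
a shift, so the series adds up to convolution with û. -/
theorem fourierL2_velOp_packet {K : Set E3} [CompactSpace K] (hp : TorusPeriodic U)
    (hU : ContDiff ℝ ∞ U) (hC : ∀ x, ‖U x‖ ≤ C) (H : C(K, Seq)) :
    fourierL2 (velOp U C hU.continuous hC (fourierL2.symm (packet K H)))
      = packet K (profileMap (convOp (uhat U)) H) := by
  have h1 := (hasSum_velOp hp hU hC (fourierL2.symm (packet K H))).mapL
    (fourierL2.toContinuousLinearEquiv : L2C →L[ℂ] L2C)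
  have h2 := (hasSum_profileMap_convOp (summable_uhat hp hU) H).mapL (packet K)
  refine h1.unique ?_
  refine Eq.mp (congrArg (fun F => HasSum F _) (funext fun l => ?_)) h2
  show _ = fourierL2 _
  rw [fourierL2_modOp, fourierL2_constOp, fourierL2.apply_symm_apply]
  refine Lp.ext ?_
  filter_upwards [coeFn_packet (profileMap ((crossOp (uhat U l)).comp (shiftOp l)) H),
    coeFn_transOp ((2 * Real.pi)⁻¹ • latReal l) (constOp (crossCLM ℂ (uhat U l)) (packet K H)),
    (measurePreserving_sub_right volume ((2 * Real.pi)⁻¹ • latReal l)).quasiMeasurePreserving.ae_eq_comp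
      ((coeFn_constOp (crossCLM ℂ (uhat U l)) (packet K H)).trans
        ((coeFn_packet H).fun_comp (crossCLM ℂ (uhat U l))))] with η h3 h4 h5
  rw [h3, h4, packetFun_crossShift]
  refine Eq.trans ?_ h5.symm
  simp only [Function.comp_apply]
  rw [waveVec_sub_lat, crossCLM_apply]

end velocity

/-! ### The growing solution -/

section realPart

/-- The field b and its conjugate have transforms f(η) and conj f(−η) with disjoint supports, so
they are orthogonal and ‖(b + b̄)/2‖² = ‖b‖²/2. -/
theorem norm_sq_reOp {f : L2C} (hf : ∀ᵐ η, f η = 0 ∨ f (-η) = 0) :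
    ‖reOp (fourierL2.symm f)‖ ^ 2 = 2⁻¹ * ‖f‖ ^ 2 := by
  set b := fourierL2.symm f
  have hb : fourierL2 b = f := fourierL2.apply_symm_apply f
  have hnb : ‖b‖ = ‖f‖ := fourierL2.symm.norm_map f
  have h0 : inner ℂ b (conjOp b) = 0 := by
    rw [← fourierL2.inner_map_map, fourierL2_conjOp, hb, L2.inner_def]
    refine integral_eq_zero_of_ae ?_
    filter_upwards [hf, coeFn_negOp (conjOp f),
      (Measure.measurePreserving_neg (volume : Measure E3)).quasiMeasurePreserving.ae_eq_comp
        (coeFn_conjOp f)] with η h1 h2 h3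
    simp only [Function.comp_apply] at h3
    rw [h2, h3]
    rcases h1 with h1 | h1 <;> simp [h1]
  rw [← norm_complexify, complexify_reOp, norm_smul, mul_pow, @norm_add_sq ℂ, h0, norm_conjOp, hnb]
  norm_num
  ring

end realPart

theorem cdot_toC3_self (a : E3) : cdot (toC3 a) (toC3 a) = ((‖a‖ ^ 2 : ℝ) : ℂ) := by
  rw [EuclideanSpace.norm_sq_eq]
  simp [cdot, Fin.sum_univ_three, sq]

theorem cdot_sub_right (a b c : C3) : cdot a (b - c) = cdot a b - cdot a c := by
  simp [cdot, Fin.sum_univ_three]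
  ring

/-- Pairing the mode equation with m + κ removes the curl term and leaves (λ + ε|m+κ|²) times the
divergence; this factor has positive real part. -/
theorem IsMode.cdot_eq_zero {u : Z3 → C3} {lam : ℂ} {ε : ℝ} {κ : E3} {h : Seq}
    (hm : IsMode u lam ε (toC3 κ) h) (hlam : 0 < lam.re) (hε : 0 ≤ ε) (m : Z3) :
    cdot (latVec m + toC3 κ) (h m) = 0 := by
  have h1 := congrArg (cdot (latVec m + toC3 κ)) (hm m)
  have hk : latVec m + toC3 κ = toC3 (latReal m + κ) := by ext i; simp
  rw [cdot_sub_right, cdot_smul_right, cdot_smul_right, cdot_smul_right, cdot_cross_self, hk,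
    cdot_toC3_self] at h1
  have h2 : (lam + ((ε * ‖latReal m + κ‖ ^ 2 : ℝ) : ℂ)) * cdot (toC3 (latReal m + κ)) (h m) = 0 := by
    push_cast at h1 ⊢
    linear_combination h1
  rw [hk]
  refine (mul_eq_zero.mp h2).resolve_left fun h3 => ?_
  have h4 := congrArg Complex.re h3
  rw [Complex.add_re, Complex.ofReal_re, Complex.zero_re] at h4
  have : 0 ≤ ε * ‖latReal m + κ‖ ^ 2 := by positivity
  linarith

/-! ### Time-dependent profiles and dilated packets -/

section profile

variable {K : Set E3} [CompactSpace K]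

/-- Multiplication of a fixed profile by a scalar function of the quasi-momentum. -/
noncomputable def profileScale (h : C(K, Seq)) : C(K, ℂ) →L[ℂ] C(K, Seq) :=
  LinearMap.mkContinuous
    { toFun := fun a => ⟨fun κ => a κ • h κ, a.continuous.smul h.continuous⟩
      map_add' := fun a b => by ext1 κ; exact add_smul _ _ _
      map_smul' := fun c a => by ext1 κ; exact mul_smul c (a κ) (h κ) }
    ‖h‖ fun a => by
      rw [ContinuousMap.norm_le _ (by positivity)]
      intro κ
      show ‖a κ • h κ‖ ≤ _
      rw [norm_smul, mul_comm]
      gcongr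
      · exact h.norm_coe_le_norm κ
      · exact a.norm_coe_le_norm κ

theorem profileScale_apply (h : C(K, Seq)) (a : C(K, ℂ)) (κ : K) :
    profileScale h a κ = a κ • h κ := rfl

/-- The function `κ ↦ exp(t λ(κ))`. -/
noncomputable def expProfile (lam : C(K, ℂ)) (t : ℝ) : C(K, ℂ) := NormedSpace.exp (t • lam)

theorem expProfile_apply (lam : C(K, ℂ)) (t : ℝ) (κ : K) :
    expProfile lam t κ = Complex.exp (t * lam κ) := by
  have h := NormedSpace.map_exp (ContinuousMap.evalAlgHom ℂ ℂ κ : C(K, ℂ) →ₐ[ℂ] ℂ)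
    (continuous_eval_const κ) (t • lam)
  rw [Complex.exp_eq_exp_ℂ]
  refine Eq.trans h ?_
  congr 1

/-- The exponential is taken in the Banach algebra of continuous functions on K, so the derivative
exists in the sup norm and passes to L² through bounded operators. -/
theorem hasDerivAt_expProfile (lam : C(K, ℂ)) (t : ℝ) :
    HasDerivAt (expProfile lam) (expProfile lam t * lam) t :=
  hasDerivAt_exp_smul_const lam t

theorem continuous_expProfile (lam : C(K, ℂ)) : Continuous (expProfile lam) :=
  continuous_iff_continuousAt.mpr fun t => (hasDerivAt_expProfile lam t).continuousAt

variable (K) in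
/-- The Fourier transform of the wave packet dilated to the length scale `a`. -/
noncomputable def scaledPacket (a : ℝ) (ha : 0 < a) : C(K, Seq) →L[ℂ] L2C :=
  (dilation a ha).toContinuousLinearMap ∘L packet K

theorem waveVec_smul (c : ℝ) (η : E3) : waveVec (c • η) = c • waveVec η := smul_comm _ _ _

theorem coeFn_scaledPacket {a : ℝ} (ha : 0 < a) (H : C(K, Seq)) :
    scaledPacket K a ha H =ᵐ[volume]
      fun η => ((a ^ (3 / 2 : ℝ) : ℝ) : ℂ) • packetFun H (a • waveVec η) := by
  filter_upwards [coeFn_dilation ha (packet K H),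
    (quasiMeasurePreserving_smul ha).ae_eq_comp (coeFn_packet H)] with η h1 h2
  refine h1.trans (congrArg _ (h2.trans ?_))
  simp only [Function.comp_apply, waveVec_smul]

theorem fourierL2_dilation_inv {a : ℝ} (ha : 0 < a) (f : L2C) :
    fourierL2 (dilation a⁻¹ (inv_pos.mpr ha) f) = dilation a ha (fourierL2 f) := by
  have h : ∀ (c : ℝ) (hc : 0 < c), c = a → dilation c hc = dilation a ha := by
    rintro c hc rfl; rfl
  rw [fourierL2_dilation, h _ _ (inv_inv a)]

theorem fourierL2_symm_dilation {a : ℝ} (ha : 0 < a) (f : L2C) :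
    fourierL2.symm (dilation a ha f) = dilation a⁻¹ (inv_pos.mpr ha) (fourierL2.symm f) := by
  rw [fourierL2.symm_apply_eq, fourierL2_dilation_inv, fourierL2.apply_symm_apply]

end profile

/-! ### The dilated packets solve the equation and grow -/

section velocity

variable {U : E3 → E3} {C : ℝ}

theorem continuous_rescale (hU : Continuous U) (a : ℝ) : Continuous fun x => a • U (a⁻¹ • x) :=
  (hU.comp (continuous_const_smul _)).const_smul a

theorem norm_rescale_le (hC : ∀ x, ‖U x‖ ≤ C) {a : ℝ} (ha : 0 < a) (x : E3) :
    ‖a • U (a⁻¹ • x)‖ ≤ a * C := by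
  rw [norm_smul, Real.norm_of_nonneg ha.le]
  exact mul_le_mul_of_nonneg_left (hC _) ha.le

theorem velOp_dilation (hU : Continuous U) (hC : ∀ x, ‖U x‖ ≤ C) {a : ℝ} (ha : 0 < a) (b : L2C) :
    velOp (fun x => a • U (a⁻¹ • x)) (a * C) (continuous_rescale hU a) (norm_rescale_le hC ha)
        (dilation a⁻¹ (inv_pos.mpr ha) b)
      = (a : ℂ) • dilation a⁻¹ (inv_pos.mpr ha) (velOp U C hU hC b) := by
  refine Lp.ext ?_
  filter_upwards [coeFn_velOp (continuous_rescale hU a) (norm_rescale_le hC ha)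
      (dilation a⁻¹ (inv_pos.mpr ha) b), coeFn_dilation (inv_pos.mpr ha) b,
    Lp.coeFn_smul (a : ℂ) (dilation a⁻¹ (inv_pos.mpr ha) (velOp U C hU hC b)),
    coeFn_dilation (inv_pos.mpr ha) (velOp U C hU hC b),
    (quasiMeasurePreserving_smul (inv_pos.mpr ha)).ae_eq_comp (coeFn_velOp hU hC b)]
    with x h1 h2 h3 h4 h5
  simp only [Function.comp_apply] at h5
  have e : toC3 (a • U (a⁻¹ • x)) = (a : ℂ) • toC3 (U (a⁻¹ • x)) := by ext i; simp
  rw [h1, h2, h3, Pi.smul_apply, h4, h5, e, cross_smul_left, cross_smul_right,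
    smul_comm]

variable {K : Set E3} [CompactSpace K]

theorem fourierL2_velOp_scaledPacket (hp : TorusPeriodic U) (hU : ContDiff ℝ ∞ U)
    (hC : ∀ x, ‖U x‖ ≤ C) {a : ℝ} (ha : 0 < a) (H : C(K, Seq)) :
    fourierL2 (velOp (fun x => a • U (a⁻¹ • x)) (a * C) (continuous_rescale hU.continuous a)
        (norm_rescale_le hC ha) (fourierL2.symm (scaledPacket K a ha H)))
      = (a : ℂ) • scaledPacket K a ha (profileMap (convOp (uhat U)) H) := by
  have e1 : scaledPacket K a ha H = dilation a ha (packet K H) := rfl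
  have e2 : scaledPacket K a ha (profileMap (convOp (uhat U)) H)
      = dilation a ha (packet K (profileMap (convOp (uhat U)) H)) := rfl
  rw [e1, e2, fourierL2_symm_dilation, velOp_dilation hU.continuous hC ha, map_smul,
    fourierL2_dilation_inv ha, fourierL2_velOp_packet hp hU hC]

omit [CompactSpace K] in
-- Both packets vanish where the quasi-momentum leaves K, and T 0 = 0 covers that case; it remains
-- to compare them fibrewise.
theorem packetFun_congr {H G : C(K, Seq)} {p : E3} {T : C3 → C3} (hT : T 0 = 0)
    (h : ∀ hp : quasiMom p ∈ K, H ⟨_, hp⟩ (modeIdx p) = T (G ⟨_, hp⟩ (modeIdx p))) :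
    packetFun H p = T (packetFun G p) := by
  by_cases hp : quasiMom p ∈ K
  · rw [packetFun, packetFun, modeExt_of_mem _ _ hp, modeExt_of_mem _ _ hp, h hp]
  · rw [packetFun, packetFun, modeExt_of_notMem _ _ hp, modeExt_of_notMem _ _ hp, hT]

variable {h : C(K, Seq)} {lam : C(K, ℂ)} {ε : ℝ}

/-- On the fibre over κ the dilated wave vector is a·2πη = m + κ, and the mode equation makes
exp(tλ) h solve the evolution equation. The factor a of the velocity and a² of the diffusivity
absorb the dilation, so λ is unchanged. The profiles g, with values (m + κ)ᵢ h(m), supply the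
gradient. -/
theorem isKDESolution_packet (hp : TorusPeriodic U) (hU : ContDiff ℝ ∞ U) (hε : 0 < ε)
    (hmode : ∀ κ : K, IsMode (uhat U) (lam κ) ε (toC3 κ) (h κ)) (hlam : ∀ κ, 0 < (lam κ).re)
    {g : Fin 3 → C(K, Seq)} (hg : ∀ i κ m, g i κ m = (((m i : ℝ) + (κ : E3) i : ℝ) : ℂ) • h κ m)
    {a : ℝ} (ha : 0 < a) :
    IsKDESolution (fun x => a • U (a⁻¹ • x)) (a ^ 2 * ε)
      (reOp (fourierL2.symm (scaledPacket K a ha (profileScale h (expProfile lam 0)))))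
      (fun t => reOp (fourierL2.symm (scaledPacket K a ha (profileScale h (expProfile lam t))))) := by
  obtain ⟨C, -, hC⟩ := hp.bounded hU.continuous
  refine isKDESolution_reOp (continuous_rescale hU.continuous a) (norm_rescale_le hC ha)
    (f := fun t => scaledPacket K a ha (profileScale h (expProfile lam t)))
    (f' := fun t => scaledPacket K a ha (profileScale h (expProfile lam t * lam)))
    (q := fun i t => (a⁻¹ : ℂ) • scaledPacket K a ha (profileScale (g i) (expProfile lam t)))
    ?_ ?_ ?_ ?_ ?_ ?_
  · exact (scaledPacket K a ha).continuous.comp ((profileScale h).continuous.comp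
      ((continuous_expProfile lam).mul continuous_const))
  · intro t
    exact (((scaledPacket K a ha ∘L profileScale h).restrictScalars ℝ).hasFDerivAt).comp_hasDerivAt t
      (hasDerivAt_expProfile lam t)
  · intro i
    have hc : Continuous fun t => scaledPacket K a ha (profileScale (g i) (expProfile lam t)) :=
      (scaledPacket K a ha).continuous.comp ((profileScale (g i)).continuous.comp
        (continuous_expProfile lam))
    exact hc.const_smul (a⁻¹ : ℂ)
  · intro i t
    filter_upwards [Lp.coeFn_smul (a⁻¹ : ℂ)
        (scaledPacket K a ha (profileScale (g i) (expProfile lam t))),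
      coeFn_scaledPacket ha (profileScale (g i) (expProfile lam t)),
      coeFn_scaledPacket ha (profileScale h (expProfile lam t))] with η h1 h2 h3
    have h4 : packetFun (profileScale (g i) (expProfile lam t)) (a • waveVec η)
        = ((a * waveVec η i : ℝ) : ℂ) • packetFun (profileScale h (expProfile lam t)) (a • waveVec η) := by
      refine packetFun_congr (T := fun z => ((a * waveVec η i : ℝ) : ℂ) • z) (smul_zero _) fun hK => ?_
      simp only [profileScale_apply, lp.coeFn_smul, Pi.smul_apply, hg]
      rw [smul_comm]
      congr 2
      have := congrArg (fun z : C3 => z i) (quasiMom_add_latVec (a • waveVec η))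
      simp at this
      exact_mod_cast this
    rw [h1, Pi.smul_apply, h2, h3, h4, smul_smul, smul_smul, smul_smul]
    congr 1
    have : (a : ℂ) ≠ 0 := by exact_mod_cast ha.ne'
    push_cast
    field_simp
  · intro t
    filter_upwards [coeFn_scaledPacket ha (profileScale h (expProfile lam t))] with η h1
    rw [h1, cdot_smul_right]
    have h2 : cdot (toC3 (a • waveVec η))
        (packetFun (profileScale h (expProfile lam t)) (a • waveVec η)) = 0 := by
      by_cases hK : quasiMom (a • waveVec η) ∈ K
      · rw [packetFun, modeExt_of_mem _ _ hK, profileScale_apply, lp.coeFn_smul, Pi.smul_apply,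
          cdot_smul_right, ← quasiMom_add_latVec, (hmode ⟨_, hK⟩).cdot_eq_zero (hlam _) hε.le,
          mul_zero]
      · rw [packetFun, modeExt_of_notMem _ _ hK]
        simp [cdot]
    have h3 : toC3 (a • waveVec η) = (a : ℂ) • toC3 (waveVec η) := by ext i; simp
    rw [h3, cdot_smul_left] at h2
    rw [(mul_eq_zero.mp h2).resolve_left (by exact_mod_cast ha.ne'), mul_zero]
  · intro t
    rw [fourierL2_velOp_scaledPacket hp hU hC ha]
    filter_upwards [coeFn_scaledPacket ha (profileScale h (expProfile lam t * lam)),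
      coeFn_scaledPacket ha (profileScale h (expProfile lam t)),
      Lp.coeFn_smul (a : ℂ) (scaledPacket K a ha (profileMap (convOp (uhat U))
        (profileScale h (expProfile lam t)))),
      coeFn_scaledPacket ha (profileMap (convOp (uhat U)) (profileScale h (expProfile lam t)))]
      with η h1 h2 h3 h4
    rw [h1, h2, h3, Pi.smul_apply, h4]
    have h6 : toC3 (a • waveVec η) = (a : ℂ) • toC3 (waveVec η) := by ext i; simp
    have h5 : packetFun (profileScale h (expProfile lam t * lam)) (a • waveVec η)
        = Complex.I • cross (toC3 (a • waveVec η)) (packetFun (profileMap (convOp (uhat U))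
            (profileScale h (expProfile lam t))) (a • waveVec η))
          - ((ε * ‖a • waveVec η‖ ^ 2 : ℝ) : ℂ) •
            packetFun (profileScale h (expProfile lam t)) (a • waveVec η) := by
      by_cases hK : quasiMom (a • waveVec η) ∈ K
      · have h7 := hmode ⟨_, hK⟩ (modeIdx (a • waveVec η))
        simp only [packetFun, modeExt_of_mem _ _ hK, profileScale_apply, profileMap_apply,
          ContinuousMap.mul_apply, lp.coeFn_smul, Pi.smul_apply, map_smul, mul_smul]
        rw [h7, quasiMom_add_latVec, cdot_toC3_self, cross_smul_right, Complex.ofReal_mul]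
        module
      · simp [packetFun, modeExt_of_notMem _ _ hK]
    rw [h5, h6, norm_smul, Real.norm_of_nonneg ha.le]
    simp only [cross_smul_left, cross_smul_right]
    push_cast
    module

/-- The comparison is pointwise on the Fourier side, where |exp(tλ(κ))| ≥ exp(γt). -/
theorem norm_packet_growth {γ : ℝ} (hlam : ∀ κ, γ ≤ (lam κ).re) {a : ℝ} (ha : 0 < a) {t : ℝ}
    (ht : 0 ≤ t) :
    Real.exp (γ * t) * ‖scaledPacket K a ha (profileScale h (expProfile lam 0))‖
      ≤ ‖scaledPacket K a ha (profileScale h (expProfile lam t))‖ := by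
  have h1 : ‖Real.exp (γ * t) • scaledPacket K a ha (profileScale h (expProfile lam 0))‖
      ≤ ‖scaledPacket K a ha (profileScale h (expProfile lam t))‖ := by
    refine Lp.norm_le_norm_of_ae_le ?_
    filter_upwards [Lp.coeFn_smul (Real.exp (γ * t))
        (scaledPacket K a ha (profileScale h (expProfile lam 0))),
      coeFn_scaledPacket ha (profileScale h (expProfile lam t)),
      coeFn_scaledPacket ha (profileScale h (expProfile lam 0))] with η h1 h2 h3
    rw [h1, Pi.smul_apply, h2, h3, norm_smul, norm_smul, norm_smul, mul_left_comm]
    refine mul_le_mul_of_nonneg_left ?_ (norm_nonneg _)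
    by_cases hK : quasiMom (a • waveVec η) ∈ K
    · simp only [packetFun, modeExt_of_mem _ _ hK, profileScale_apply, lp.coeFn_smul, Pi.smul_apply,
        expProfile_apply, norm_smul, Complex.norm_exp, Real.norm_eq_abs, Real.abs_exp]
      simp only [Complex.ofReal_zero, zero_mul, Complex.zero_re, Real.exp_zero, one_mul,
        Complex.re_ofReal_mul]
      refine mul_le_mul_of_nonneg_right (Real.exp_le_exp.mpr ?_) (norm_nonneg _)
      rw [mul_comm]
      exact mul_le_mul_of_nonneg_left (hlam _) ht
    · simp [packetFun, modeExt_of_notMem _ _ hK]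
  rwa [norm_smul, Real.norm_of_nonneg (Real.exp_pos _).le] at h1

/-- If both quasi-momenta lay in the ball, their sum would have norm less than 1 and be minus a
lattice vector, hence zero. Then κ and −κ are both within ρ of κ₀, which gives 2‖κ₀‖ ≤ 2ρ. -/
theorem quasiMom_neg_notMem {κ₀ : E3} {ρ : ℝ} (h1 : ρ < ‖κ₀‖) (h2 : ‖κ₀‖ + ρ < 1 / 2) {p : E3}
    (hp : quasiMom p ∈ Metric.closedBall κ₀ ρ) : quasiMom (-p) ∉ Metric.closedBall κ₀ ρ := by
  intro hn
  rw [mem_closedBall_iff_norm] at hp hn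
  have hb : ∀ κ : E3, ‖κ - κ₀‖ ≤ ρ → ‖κ‖ < 1 / 2 := fun κ hκ => by
    have := norm_add_le (κ - κ₀) κ₀
    rw [sub_add_cancel] at this
    linarith
  have hm : modeIdx p + modeIdx (-p) = 0 := by
    by_contra hne
    have h3 := one_le_norm_latVec hne
    have h4 : latVec (modeIdx p + modeIdx (-p)) = -toC3 (quasiMom p + quasiMom (-p)) := by
      ext i
      simp [quasiMom]
      ring
    rw [h4, norm_neg, norm_toC3] at h3
    have := norm_add_le (quasiMom p) (quasiMom (-p))
    have := hb _ hp
    have := hb _ hn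
    linarith
  have hq : quasiMom (-p) = -quasiMom p := by
    have : modeIdx (-p) = -modeIdx p := (neg_eq_of_add_eq_zero_right hm).symm
    rw [quasiMom, this, quasiMom]
    ext i
    simp
    ring
  rw [hq] at hn
  have h5 := norm_add_le (quasiMom p - κ₀) (-quasiMom p - κ₀)
  have h6 : (quasiMom p - κ₀) + (-quasiMom p - κ₀) = (-2 : ℝ) • κ₀ := by module
  rw [h6, norm_smul] at h5
  norm_num at h5
  linarith

theorem scaledPacket_zero_or_zero {κ₀ : E3} {ρ : ℝ} (h1 : ρ < ‖κ₀‖) (h2 : ‖κ₀‖ + ρ < 1 / 2)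
    {a : ℝ} (ha : 0 < a) (H : C(Metric.closedBall κ₀ ρ, Seq)) :
    ∀ᵐ η, scaledPacket (Metric.closedBall κ₀ ρ) a ha H η = 0 ∨
      scaledPacket (Metric.closedBall κ₀ ρ) a ha H (-η) = 0 := by
  have h3 := coeFn_scaledPacket ha H
  filter_upwards [h3,
    (Measure.measurePreserving_neg (volume : Measure E3)).quasiMeasurePreserving.ae_eq_comp h3]
    with η h4 h5
  simp only [Function.comp_apply] at h5
  rw [h4, h5]
  by_cases hK : quasiMom (a • waveVec η) ∈ Metric.closedBall κ₀ ρ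
  · right
    have h6 := quasiMom_neg_notMem h1 h2 hK
    have h7 : a • waveVec (-η) = -(a • waveVec η) := by
      rw [waveVec, waveVec, smul_neg, smul_neg]
    rw [h7, packetFun, modeExt_of_notMem _ _ h6, smul_zero]
  · left
    rw [packetFun, modeExt_of_notMem _ _ hK, smul_zero]

end velocity

/-! ### Uniqueness of weak solutions -/

theorem reOp_complexify (D : L2) : reOp (complexify D) = D := by
  refine Lp.ext ?_
  filter_upwards [coeFn_reOp (complexify D), coeFn_complexify D] with x h1 h2
  rw [h1, h2]
  ext i
  simp

theorem IsTest.inner_complexify {φ : E3 → E3} (hφ : IsTest φ) (D : L2) :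
    inner ℂ hφ.toC3.toL2 (complexify D) = ((∫ x, inner ℝ (D x) (φ x) : ℝ) : ℂ) := by
  rw [hφ.toC3.inner_toL2, ← integral_complex_ofReal]
  refine integral_congr_ae ?_
  filter_upwards [coeFn_complexify D] with x h1
  rw [h1, inner_toC3, real_inner_comm]

/-- All pairings involved are real when the field and the test field are real. The complex identity,
not only its real part, is needed because the mollifying multiplier is complex. -/
theorem integral_weak_eq_complexify {u : E3 → E3} {C : ℝ} (hu : Continuous u)
    (hC : ∀ x, ‖u x‖ ≤ C) {φ : E3 → E3} (hφ : IsTest φ) (ε : ℝ) (D : L2) :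
    ((∫ x, (inner ℝ (cross (u x) (D x)) (curl φ x)
        + ε * inner ℝ (D x) (Laplacian.laplacian φ x)) : ℝ) : ℂ)
      = inner ℂ hφ.toC3.curl.toL2 (velOp u C hu hC (complexify D))
          + ε * inner ℂ hφ.toC3.laplacian.toL2 (complexify D) := by
  have h1 := integral_weak_eq hu hC hφ ε (complexify D)
  rw [reOp_complexify] at h1
  rw [h1]
  refine Complex.ext (Complex.ofReal_re _) ?_
  rw [Complex.ofReal_im, eq_comm]
  have h2 : inner ℂ hφ.toC3.curl.toL2 (velOp u C hu hC (complexify D))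
      = ((∫ x, inner ℝ (curl φ x) (cross (u x) (D x)) : ℝ) : ℂ) := by
    rw [← hφ.curl.toC3.toL2_congr hφ.toC3.curl hφ.toC3_curl, hφ.curl.toC3.inner_toL2,
      ← integral_complex_ofReal]
    refine integral_congr_ae ?_
    filter_upwards [coeFn_complexify D, coeFn_velOp hu hC (complexify D)] with x h1 h2
    rw [h2, h1, cross_toC3, inner_toC3]
  rw [h2, ← hφ.laplacian.toC3.toL2_congr hφ.toC3.laplacian hφ.toC3_laplacian,
    hφ.laplacian.inner_complexify, ← Complex.ofReal_mul, ← Complex.ofReal_add, Complex.ofReal_im]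

/-- A field in `L²` that is orthogonal to the Fourier transforms of all real test fields vanishes. -/
theorem eq_zero_of_forall_inner_fourierL2 {Y : L2C}
    (h : ∀ (φ : E3 → E3) (hφ : IsTest φ), inner ℂ (fourierL2 hφ.toC3.toL2) Y = 0) : Y = 0 := by
  have h1 : (fun f : L2C => inner ℂ (fourierL2 f) Y) = fun _ => 0 := by
    refine eq_of_eq_on_test (by fun_prop) continuous_const fun ψ hψ => ?_
    have hre : IsTest fun x => reC3 (ψ x) := hψ.clm_comp reC3
    have him : IsTest fun x => reC3 (-Complex.I • ψ x) :=
      hψ.clm_comp (reC3 ∘L ((-Complex.I • ContinuousLinearMap.id ℂ C3).restrictScalars ℝ))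
    have h2 : hψ.toL2 = hre.toC3.toL2 + Complex.I • him.toC3.toL2 := by
      refine Lp.ext ?_
      filter_upwards [hψ.coeFn_toL2, hre.toC3.coeFn_toL2, him.toC3.coeFn_toL2,
        Lp.coeFn_add hre.toC3.toL2 (Complex.I • him.toC3.toL2),
        Lp.coeFn_smul Complex.I him.toC3.toL2] with x h1 h2 h3 h4 h5
      rw [h1, h4, Pi.add_apply, h2, h5, Pi.smul_apply, h3]
      ext i
      apply Complex.ext <;> simp
    rw [h2, map_add, map_smul, inner_add_left, inner_smul_left, h _ hre, h _ him]
    simp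
  have h2 := congrFun h1 (fourierL2.symm Y)
  simp only [fourierL2.apply_symm_apply] at h2
  exact inner_self_eq_zero.mp h2

/-! ### Mollification of test fields -/

section mollifier

variable {ρ : E3 → ℝ}

theorem IsTest.convolution (hρ : IsTest ρ) {φ : E3 → E3} (hφ : IsTest φ) :
    IsTest (MeasureTheory.convolution ρ φ (ContinuousLinearMap.lsmul ℝ ℝ) volume) :=
  ⟨hφ.2.contDiff_convolution_right _ hρ.1.continuous.locallyIntegrable hφ.1,
    hρ.2.convolution _ hφ.2⟩

/-- The Fourier transform of a scalar test function. -/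
noncomputable def symbol (ρ : E3 → ℝ) (η : E3) : ℂ := 𝓕 (fun x => (ρ x : ℂ)) η

theorem fourier_convolution (hρ : IsTest ρ) {φ : E3 → E3} (hφ : IsTest φ) (η : E3) :
    𝓕 (fun x => toC3 (MeasureTheory.convolution ρ φ (ContinuousLinearMap.lsmul ℝ ℝ) volume x)) η
      = symbol ρ η • 𝓕 (fun x => toC3 (φ x)) η := by
  have hρc : IsTest fun x => (ρ x : ℂ) := hρ.clm_comp Complex.ofRealCLM
  rw [symbol, ← Real.fourier_smul_convolution_eq hρc.integrable hφ.toC3.integrable]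
  refine congrArg (fun g : E3 → C3 => 𝓕 g η) (funext fun x => ?_)
  unfold MeasureTheory.convolution
  rw [← toC3CLM_apply, ← toC3CLM.integral_comp_comm]
  · refine integral_congr_ae (Filter.Eventually.of_forall fun y => ?_)
    ext i
    simp
  · refine Continuous.integrable_of_hasCompactSupport ?_ ?_
    · exact hρ.1.continuous.smul (hφ.1.continuous.comp (continuous_const.sub continuous_id))
    · exact hρ.2.smul_right (f' := fun y => φ (x - y))

/-- The symbol is a Schwartz function. The cases k = 1, 2 make the curl and the Laplacian of a
mollification bounded on L². -/
theorem exists_symbol_bound (hρ : IsTest ρ) (k : ℕ) :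
    ∃ C, ∀ η, ‖symbol ρ η‖ * ‖waveVec η‖ ^ k ≤ C := by
  have hρc : IsTest fun x => (ρ x : ℂ) := hρ.clm_comp Complex.ofRealCLM
  obtain ⟨C, hC⟩ := (𝓕 (hρc.2.toSchwartzMap hρc.1)).decay k 0
  refine ⟨(2 * Real.pi) ^ k * C, fun η => ?_⟩
  have h := hC.2 η
  rw [norm_iteratedFDeriv_zero] at h
  rw [waveVec, norm_smul, Real.norm_of_nonneg (by positivity), mul_pow, mul_left_comm]
  refine mul_le_mul_of_nonneg_left ?_ (by positivity)
  rw [mul_comm]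
  exact h

theorem continuous_symbol (hρ : IsTest ρ) : Continuous (symbol ρ) := by
  have hρc : IsTest fun x => (ρ x : ℂ) := hρ.clm_comp Complex.ofRealCLM
  exact (𝓕 (hρc.2.toSchwartzMap hρc.1)).continuous

end mollifier

theorem IsTest.inner_toL2_fourier {ψ : E3 → C3} (hψ : IsTest ψ) (b : L2C) :
    inner ℂ hψ.toL2 b = ∫ η, inner ℂ (𝓕 ψ η) (fourierL2 b η) := by
  rw [← hψ.inner_fourier, fourierL2.symm_apply_apply]

theorem real_inner_C3 (a b : C3) : inner ℝ a b = (inner ℂ a b).re := by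
  rw [PiLp.inner_apply, PiLp.inner_apply, Complex.re_sum]
  exact Finset.sum_congr rfl fun i _ => real_inner_eq_re_inner ℂ _ _

/-! ### Mollified energy estimate and Gronwall's inequality -/

section energy

variable {ρ : E3 → ℝ}

/-- The multiplier of the mollification. -/
noncomputable def mollOp (hρ : IsTest ρ) (h1 : ∀ η, ‖symbol ρ η‖ ≤ 1) : L2C →L[ℂ] L2C :=
  multOp (fun η => (starRingEnd ℂ) (symbol ρ η) • ContinuousLinearMap.id ℂ C3) 1
    (((Complex.continuous_conj.comp (continuous_symbol hρ)).smul
      continuous_const).aestronglyMeasurable) fun η => by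
    rw [norm_smul, RCLike.norm_conj]
    exact mul_le_one₀ (h1 η) (norm_nonneg _) ContinuousLinearMap.norm_id_le

theorem coeFn_mollOp (hρ : IsTest ρ) (h1 : ∀ η, ‖symbol ρ η‖ ≤ 1) (f : L2C) :
    mollOp hρ h1 f =ᵐ[volume] fun η => (starRingEnd ℂ) (symbol ρ η) • f η :=
  coeFn_multOp _ _ f

/-- The multiplier of the curl of the mollification. -/
noncomputable def mollCurlOp (hρ : IsTest ρ) : L2C →L[ℂ] L2C :=
  multOp (fun η => (starRingEnd ℂ) (symbol ρ η) • Complex.I • crossCLM ℂ (toC3 (waveVec η)))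
    (‖crossCLM ℂ‖ * (exists_symbol_bound hρ 1).choose)
    ((Complex.continuous_conj.comp (continuous_symbol hρ)).smul
      ((continuous_crossCLM_toC3 continuous_waveVec).const_smul Complex.I)).aestronglyMeasurable
    fun η => by
    have h := (exists_symbol_bound hρ 1).choose_spec η
    rw [pow_one] at h
    rw [norm_smul, RCLike.norm_conj, norm_smul, Complex.norm_I, one_mul]
    calc _ ≤ ‖symbol ρ η‖ * (‖crossCLM ℂ‖ * ‖waveVec η‖) :=
          mul_le_mul_of_nonneg_left
            (norm_crossCLM_toC3_le (u := fun _ => waveVec η) (fun _ => le_rfl) 0)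
            (norm_nonneg _)
      _ = ‖crossCLM ℂ‖ * (‖symbol ρ η‖ * ‖waveVec η‖) := by ring
      _ ≤ _ := mul_le_mul_of_nonneg_left h (crossCLM ℂ).opNorm_nonneg

theorem coeFn_mollCurlOp (hρ : IsTest ρ) (f : L2C) :
    mollCurlOp hρ f =ᵐ[volume] fun η => (starRingEnd ℂ) (symbol ρ η) •
      Complex.I • cross (toC3 (waveVec η)) (f η) :=
  coeFn_multOp _ _ f

theorem continuous_lap_symbol (hρ : IsTest ρ) :
    Continuous fun η => (starRingEnd ℂ) (symbol ρ η) * ((‖waveVec η‖ ^ 2 : ℝ) : ℂ) := by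
  have h1 : Continuous fun η => (starRingEnd ℂ) (symbol ρ η) :=
    Complex.continuous_conj.comp (continuous_symbol hρ)
  have h2 : Continuous fun η => ((‖waveVec η‖ ^ 2 : ℝ) : ℂ) :=
    Complex.continuous_ofReal.comp (continuous_waveVec.norm.pow 2)
  exact h1.mul h2

/-- The multiplier of minus the Laplacian of the mollification. -/
noncomputable def mollLapOp (hρ : IsTest ρ) : L2C →L[ℂ] L2C :=
  multOp (fun η => ((starRingEnd ℂ) (symbol ρ η) * ((‖waveVec η‖ ^ 2 : ℝ) : ℂ)) •
      ContinuousLinearMap.id ℂ C3) (exists_symbol_bound hρ 2).choose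
    ((continuous_lap_symbol hρ).smul continuous_const).aestronglyMeasurable
    fun η => by
    rw [norm_smul, norm_mul, RCLike.norm_conj, Complex.norm_real,
      Real.norm_of_nonneg (by positivity)]
    refine le_trans ?_ ((exists_symbol_bound hρ 2).choose_spec η)
    exact mul_le_of_le_one_right (by positivity) ContinuousLinearMap.norm_id_le

theorem coeFn_mollLapOp (hρ : IsTest ρ) (f : L2C) :
    mollLapOp hρ f =ᵐ[volume] fun η => (starRingEnd ℂ) (symbol ρ η) •
      ((‖waveVec η‖ ^ 2 : ℝ) : ℂ) • f η := by
  have h0 : mollLapOp hρ f =ᵐ[volume] fun η =>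
      (((starRingEnd ℂ) (symbol ρ η) * ((‖waveVec η‖ ^ 2 : ℝ) : ℂ)) •
        ContinuousLinearMap.id ℂ C3) (f η) := coeFn_multOp _ _ f
  filter_upwards [h0] with η h
  rw [smul_smul]
  exact h

/-- The mollifier is put on the test field; on the Fourier side it moves to the solution as
multiplication by the conjugate symbol. -/
theorem inner_convolution (hρ : IsTest ρ) (h1 : ∀ η, ‖symbol ρ η‖ ≤ 1) {φ : E3 → E3}
    (hφ : IsTest φ) (b : L2C) :
    inner ℂ (hρ.convolution hφ).toC3.toL2 b
      = inner ℂ (fourierL2 hφ.toC3.toL2) (mollOp hρ h1 (fourierL2 b)) := by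
  rw [IsTest.inner_toL2_fourier, hφ.toC3.inner_fourierL2]
  refine integral_congr_ae ?_
  filter_upwards [coeFn_mollOp hρ h1 (fourierL2 b)] with η h2
  rw [h2, fourier_convolution hρ hφ, inner_smul_left, inner_smul_right]

theorem inner_curl_convolution (hρ : IsTest ρ) {φ : E3 → E3} (hφ : IsTest φ) (b : L2C) :
    inner ℂ (hρ.convolution hφ).toC3.curl.toL2 b
      = inner ℂ (fourierL2 hφ.toC3.toL2) (mollCurlOp hρ (fourierL2 b)) := by
  rw [IsTest.inner_toL2_fourier, hφ.toC3.inner_fourierL2]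
  refine integral_congr_ae ?_
  filter_upwards [coeFn_mollCurlOp hρ (fourierL2 b)] with η h2
  rw [h2, (hρ.convolution hφ).toC3.fourier_curl, fourier_convolution hρ hφ, inner_cross_left,
    inner_smul_left, inner_smul_right _ _ ((starRingEnd ℂ) _), inner_smul_right]

theorem inner_laplacian_convolution (hρ : IsTest ρ) {φ : E3 → E3} (hφ : IsTest φ) (b : L2C) :
    inner ℂ (hρ.convolution hφ).toC3.laplacian.toL2 b
      = -inner ℂ (fourierL2 hφ.toC3.toL2) (mollLapOp hρ (fourierL2 b)) := by
  rw [IsTest.inner_toL2_fourier, hφ.toC3.inner_fourierL2, ← integral_neg]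
  refine integral_congr_ae ?_
  filter_upwards [coeFn_mollLapOp hρ (fourierL2 b)] with η h2
  rw [h2, (hρ.convolution hφ).toC3.fourier_laplacian, fourier_convolution hρ hφ,
    inner_smul_left, inner_smul_left, inner_smul_right, inner_smul_right, map_neg,
    Complex.conj_ofReal]
  ring

/-- Young's inequality: the transport contribution k|w||g||r d| is absorbed by the dissipation
ε|w|²|r d|², at the cost k²|g|²/(4ε). -/
theorem energy_pointwise {ε k : ℝ} (hε : 0 < ε) {r : ℂ} (hr : ‖r‖ ≤ 1) {w : E3} {d g x : C3}
    (hx : ‖x‖ ≤ k * ‖w‖ * ‖g‖) :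
    (inner ℂ (r • d) (r • x - (ε : ℂ) • r • ((‖w‖ ^ 2 : ℝ) : ℂ) • d)).re
      ≤ k ^ 2 / (4 * ε) * ‖g‖ ^ 2 := by
  have e1 : (ε : ℂ) • r • ((‖w‖ ^ 2 : ℝ) : ℂ) • d = ((ε * ‖w‖ ^ 2 : ℝ) : ℂ) • (r • d) := by
    push_cast; module
  rw [e1, inner_sub_right, inner_smul_right _ _ ((ε * ‖w‖ ^ 2 : ℝ) : ℂ), ← ofReal_norm_sq,
    Complex.sub_re, ← Complex.ofReal_mul, Complex.ofReal_re]
  have h1 : (inner ℂ (r • d) (r • x)).re ≤ ‖r • d‖ * (k * ‖w‖ * ‖g‖) := by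
    refine (Complex.re_le_norm _).trans ((norm_inner_le_norm _ _).trans ?_)
    refine mul_le_mul_of_nonneg_left ?_ (norm_nonneg _)
    rw [norm_smul]
    exact (mul_le_of_le_one_left (norm_nonneg _) hr).trans hx
  have h2 : ‖r • d‖ * (k * ‖w‖ * ‖g‖) - ε * ‖w‖ ^ 2 * ‖r • d‖ ^ 2 ≤ k ^ 2 / (4 * ε) * ‖g‖ ^ 2 := by
    rw [div_mul_eq_mul_div, le_div_iff₀ (by positivity)]
    nlinarith [sq_nonneg (k * ‖g‖ - 2 * ε * (‖w‖ * ‖r • d‖))]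
  linarith

variable {u : E3 → E3} {C ε : ℝ}

/-- Once mollified, the solution is a C¹ curve in L² and the energy identity is legitimate. Only
|symbol| ≤ 1 enters the estimate, so the bound is independent of ρ; the unmollified norm on the
right makes any commutator estimate unnecessary. -/
theorem norm_sq_mollOp_le (hu : Continuous u) (hC : ∀ x, ‖u x‖ ≤ C) (hε : 0 < ε) {c : ℝ → L2C}
    (hc : Continuous c)
    (hw : ∀ (φ : E3 → E3) (hφ : IsTest φ), ∀ t, 0 ≤ t → inner ℂ hφ.toC3.toL2 (c t)
      = ∫ s in (0 : ℝ)..t, (inner ℂ hφ.toC3.curl.toL2 (velOp u C hu hC (c s))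
          + ε * inner ℂ hφ.toC3.laplacian.toL2 (c s)))
    (hρ : IsTest ρ) (h1 : ∀ η, ‖symbol ρ η‖ ≤ 1) {t : ℝ} (ht : 0 ≤ t) :
    ‖mollOp hρ h1 (fourierL2 (c t))‖ ^ 2
      ≤ ‖crossCLM ℂ‖ ^ 2 / (2 * ε) * (‖crossCLM ℂ‖ * C) ^ 2 * ∫ s in (0 : ℝ)..t, ‖c s‖ ^ 2 := by
  set d : ℝ → L2C := fun s => fourierL2 (c s) with hd
  set g : ℝ → L2C := fun s => fourierL2 (velOp u C hu hC (c s)) with hg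
  set N : ℝ → L2C := fun s => mollCurlOp hρ (g s) - (ε : ℂ) • mollLapOp hρ (d s) with hN
  have hdc : Continuous d := fourierL2.continuous.comp hc
  have hgc : Continuous g := fourierL2.continuous.comp ((velOp u C hu hC).continuous.comp hc)
  have hNc : Continuous N := ((mollCurlOp hρ).continuous.comp hgc).sub
    (((mollLapOp hρ).continuous.comp hdc).const_smul (ε : ℂ))
  set y : ℝ → L2C := fun t => ∫ s in (0 : ℝ)..t, N s with hy
  have hy' : ∀ t, HasDerivAt y (N t) t := fun t =>
    intervalIntegral.integral_hasDerivAt_right (hNc.intervalIntegrable _ _)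
      (hNc.stronglyMeasurableAtFilter _ _) hNc.continuousAt
  -- Testing the weak equation against ρ * φ for every real φ determines the mollified solution,
  -- which is therefore the primitive y.
  have hyM : ∀ t, 0 ≤ t → mollOp hρ h1 (d t) = y t := by
    intro t ht
    rw [← sub_eq_zero]
    refine eq_zero_of_forall_inner_fourierL2 fun φ hφ => ?_
    have h2 := hw _ (hρ.convolution hφ) t ht
    have h5 : inner ℂ (fourierL2 hφ.toC3.toL2) (mollOp hρ h1 (d t)) = _ :=
      (inner_convolution hρ h1 hφ (c t)).symm.trans h2
    rw [inner_sub_right, h5, sub_eq_zero]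
    have h3 := (innerSL ℂ (fourierL2 hφ.toC3.toL2)).intervalIntegral_comp_comm
      (hNc.intervalIntegrable (μ := volume) 0 t)
    simp only [innerSL_apply_apply] at h3
    refine Eq.trans ?_ h3
    refine intervalIntegral.integral_congr fun s _ => ?_
    have h6 := inner_curl_convolution hρ hφ (velOp u C hu hC (c s))
    have h7 := inner_laplacian_convolution hρ hφ (c s)
    simp only [hN, hd, hg, inner_sub_right, inner_smul_right]
    refine (congrArg₂ (fun p q : ℂ => p + ε * q) h6 h7).trans ?_
    ring
  have hbound : ∀ s, 0 ≤ s → inner ℝ (y s) (N s)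
      ≤ ‖crossCLM ℂ‖ ^ 2 / (4 * ε) * ((‖crossCLM ℂ‖ * C) ^ 2 * ‖c s‖ ^ 2) := by
    intro s hs
    rw [← hyM s hs, L2.inner_def]
    have hk : 0 ≤ ‖crossCLM ℂ‖ ^ 2 / (4 * ε) := by positivity
    have h2 : ‖g s‖ ≤ (‖crossCLM ℂ‖ * C) * ‖c s‖ := by
      rw [hg, fourierL2.norm_map]
      exact norm_multOp_apply_le _ _ _
    have h3 : ‖g s‖ ^ 2 ≤ (‖crossCLM ℂ‖ * C) ^ 2 * ‖c s‖ ^ 2 := by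
      rw [← mul_pow]
      exact pow_le_pow_left₀ (norm_nonneg _) h2 2
    refine le_trans ?_ (mul_le_mul_of_nonneg_left h3 hk)
    rw [norm_sq_eq_integral (F := C3), ← integral_const_mul]
    refine integral_mono_ae (L2.integrable_inner _ _) ?_ ?_
    · refine Integrable.const_mul ?_ _
      exact (Lp.memLp (g s)).integrable_norm_pow (by norm_num)
    · filter_upwards [coeFn_mollOp hρ h1 (d s), Lp.coeFn_sub (mollCurlOp hρ (g s))
        ((ε : ℂ) • mollLapOp hρ (d s)), coeFn_mollCurlOp hρ (g s), coeFn_mollLapOp hρ (d s),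
        Lp.coeFn_smul (ε : ℂ) (mollLapOp hρ (d s))] with η h4 h5 h6 h7 h8
      rw [h4, h5, Pi.sub_apply, h6, h8, Pi.smul_apply, h7, real_inner_C3]
      refine energy_pointwise hε (by rw [RCLike.norm_conj]; exact h1 η) ?_
      rw [norm_smul, Complex.norm_I, one_mul, ← norm_toC3 (waveVec η)]
      exact norm_cross_le _ _
  have hsq : ∀ s, HasDerivAt (fun s => ‖y s‖ ^ 2) (2 * inner ℝ (y s) (N s)) s := fun s =>
    (hy' s).norm_sq
  have hyc : Continuous y := continuous_iff_continuousAt.mpr fun s => (hy' s).continuousAt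
  have hic : Continuous fun s => 2 * inner ℝ (y s) (N s) := continuous_const.mul (hyc.inner hNc)
  have hint := intervalIntegral.integral_eq_sub_of_hasDerivAt (a := 0) (b := t) (fun s _ => hsq s)
    (hic.intervalIntegrable _ _)
  have hy0 : y 0 = 0 := by simp [hy]
  rw [hy0, norm_zero] at hint
  show ‖mollOp hρ h1 (d t)‖ ^ 2 ≤ _
  rw [hyM t ht, ← intervalIntegral.integral_const_mul]
  have h9 : ‖y t‖ ^ 2 = ∫ s in (0 : ℝ)..t, 2 * inner ℝ (y s) (N s) := by rw [hint]; ring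
  rw [h9]
  refine intervalIntegral.integral_mono_on ht (hic.intervalIntegrable _ _)
    ((continuous_const.mul (hc.norm.pow 2)).intervalIntegrable _ _) fun s hs => ?_
  have h10 := hbound s hs.1
  calc 2 * inner ℝ (y s) (N s)
      ≤ 2 * (‖crossCLM ℂ‖ ^ 2 / (4 * ε) * ((‖crossCLM ℂ‖ * C) ^ 2 * ‖c s‖ ^ 2)) := by linarith
    _ = _ := by
      field_simp
      ring

/-- An approximate identity. -/
noncomputable def bump (n : ℕ) : ContDiffBump (0 : E3) where
  rIn := 1 / (2 * ((n : ℝ) + 1))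
  rOut := 1 / ((n : ℝ) + 1)
  rIn_pos := by positivity
  rIn_lt_rOut := by
    apply one_div_lt_one_div_of_lt (by positivity)
    linarith [(n.cast_nonneg : (0 : ℝ) ≤ n)]

theorem isTest_bump (n : ℕ) : IsTest ((bump n).normed volume) :=
  ⟨(bump n).contDiff_normed, (bump n).hasCompactSupport_normed⟩

theorem norm_symbol_bump_le (n : ℕ) (η : E3) : ‖symbol ((bump n).normed volume) η‖ ≤ 1 := by
  rw [symbol, Real.fourier_eq]
  refine (norm_integral_le_integral_norm _).trans (le_of_eq ?_)
  rw [← (bump n).integral_normed (μ := volume)]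
  congr 1
  funext x
  rw [Circle.norm_smul, Complex.norm_real, Real.norm_of_nonneg ((bump n).nonneg_normed x)]

/-- The symbol at η is the convolution of the bump with the character y ↦ exp(2πi y·η), evaluated at
0, where the character equals 1. -/
theorem tendsto_symbol_bump (η : E3) :
    Filter.Tendsto (fun n => symbol ((bump n).normed volume) η) Filter.atTop (nhds 1) := by
  have hr : Filter.Tendsto (fun n => (bump n).rOut) Filter.atTop (nhds 0) :=
    tendsto_one_div_add_atTop_nhds_zero_nat
  have h := ContDiffBump.convolution_tendsto_right_of_continuous (μ := (volume : Measure E3)) hr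
    (g := fun y : E3 => (Real.fourierChar (inner ℝ y η) : ℂ))
    (by fun_prop) 0
  simp only [inner_zero_left] at h
  have h0 : ((Real.fourierChar 0 : Circle) : ℂ) = 1 := by simp
  rw [h0] at h
  refine h.congr fun n => ?_
  rw [symbol, Real.fourier_eq, MeasureTheory.convolution]
  congr 1
  funext x
  simp [Circle.smul_def, mul_comm]

/-- Removing the mollifier by dominated convergence turns the uniform bound into ‖c(t)‖² ≤ L ∫₀ᵗ
‖c‖², and Gronwall concludes. -/
theorem eq_zero_of_weak (hu : Continuous u) (hC : ∀ x, ‖u x‖ ≤ C) (hε : 0 < ε) {c : ℝ → L2C}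
    (hc : Continuous c)
    (hw : ∀ (φ : E3 → E3) (hφ : IsTest φ), ∀ t, 0 ≤ t → inner ℂ hφ.toC3.toL2 (c t)
      = ∫ s in (0 : ℝ)..t, (inner ℂ hφ.toC3.curl.toL2 (velOp u C hu hC (c s))
          + ε * inner ℂ hφ.toC3.laplacian.toL2 (c s))) {t : ℝ} (ht : 0 ≤ t) : c t = 0 := by
  set L := ‖crossCLM ℂ‖ ^ 2 / (2 * ε) * (‖crossCLM ℂ‖ * C) ^ 2 with hL
  have hL0 : 0 ≤ L := by positivity
  have hle : ∀ t, 0 ≤ t → ‖c t‖ ^ 2 ≤ L * ∫ s in (0 : ℝ)..t, ‖c s‖ ^ 2 := by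
    intro t ht
    have h1 : ∀ n, ∫ η, ‖symbol ((bump n).normed volume) η‖ ^ 2 * ‖fourierL2 (c t) η‖ ^ 2
        ≤ L * ∫ s in (0 : ℝ)..t, ‖c s‖ ^ 2 := fun n => by
      refine le_trans (le_of_eq ?_) (norm_sq_mollOp_le hu hC hε hc hw (isTest_bump n)
        (norm_symbol_bump_le n) ht)
      rw [norm_sq_eq_integral (F := C3)]
      refine integral_congr_ae ?_
      filter_upwards [coeFn_mollOp (isTest_bump n) (norm_symbol_bump_le n) (fourierL2 (c t))]
        with η h2
      rw [h2, norm_smul, RCLike.norm_conj, mul_pow]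
    have hint : Integrable fun η => ‖fourierL2 (c t) η‖ ^ 2 :=
      (Lp.memLp (fourierL2 (c t))).integrable_norm_pow (by norm_num)
    have h2 : Filter.Tendsto
        (fun n => ∫ η, ‖symbol ((bump n).normed volume) η‖ ^ 2 * ‖fourierL2 (c t) η‖ ^ 2)
        Filter.atTop (nhds (∫ η, ‖fourierL2 (c t) η‖ ^ 2)) := by
      refine tendsto_integral_of_dominated_convergence (fun η => ‖fourierL2 (c t) η‖ ^ 2)
        (fun n => ?_) hint (fun n => ?_) ?_
      · exact ((continuous_symbol (isTest_bump n)).norm.pow 2).aestronglyMeasurable.mul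
          hint.aestronglyMeasurable
      · refine Filter.Eventually.of_forall fun η => ?_
        rw [Real.norm_of_nonneg (by positivity)]
        exact mul_le_of_le_one_left (by positivity)
          (pow_le_one₀ (norm_nonneg _) (norm_symbol_bump_le n η))
      · refine Filter.Eventually.of_forall fun η => ?_
        have h3 := ((tendsto_symbol_bump η).norm.pow 2).mul_const (‖fourierL2 (c t) η‖ ^ 2)
        simpa using h3
    rw [← fourierL2.norm_map, norm_sq_eq_integral (F := C3)]
    exact le_of_tendsto h2 (Filter.Eventually.of_forall h1)
  -- Gronwall is applied to the primitive, since ‖c‖² itself is only known to be continuous.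
  set I : ℝ → ℝ := fun t => ∫ s in (0 : ℝ)..t, ‖c s‖ ^ 2
  have hcc : Continuous fun s => ‖c s‖ ^ 2 := hc.norm.pow 2
  have hI : ∀ t, HasDerivAt I (‖c t‖ ^ 2) t := fun t =>
    intervalIntegral.integral_hasDerivAt_right (hcc.intervalIntegrable _ _)
      (hcc.stronglyMeasurableAtFilter _ _) hcc.continuousAt
  have h0 := norm_le_gronwallBound_of_norm_deriv_right_le (f := I) (f' := fun t => ‖c t‖ ^ 2)
    (δ := 0) (K := L) (ε := 0) (a := 0) (b := t)
    (fun s _ => (hI s).continuousAt.continuousWithinAt) (fun s _ => (hI s).hasDerivWithinAt)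
    (by simp [I]) (fun s hs => by
      rw [Real.norm_of_nonneg (by positivity), add_zero]
      exact (hle s hs.1).trans (mul_le_mul_of_nonneg_left (Real.le_norm_self _) hL0))
    t ⟨ht, le_rfl⟩
  rw [gronwallBound_ε0_δ0] at h0
  have hI0 : I t = 0 := norm_le_zero_iff.mp h0
  have h5 := hle t ht
  rw [show ∫ s in (0 : ℝ)..t, ‖c s‖ ^ 2 = I t from rfl, hI0, mul_zero] at h5
  exact norm_eq_zero.mp (pow_eq_zero_iff two_ne_zero |>.mp (le_antisymm h5 (by positivity)))

/-- Weak solutions are unique. -/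
theorem IsKDESolution.unique (hu : Continuous u) (hC : ∀ x, ‖u x‖ ≤ C) (hε : 0 < ε) {F : L2}
    {B B' : ℝ → L2} (h : IsKDESolution u ε F B) (h' : IsKDESolution u ε F B') {t : ℝ}
    (ht : 0 ≤ t) : B t = B' t := by
  -- The solutions are continuous only for nonnegative times; freezing them at time 0 for negative
  -- times yields curves continuous on the whole line.
  have hpos : Continuous fun s : ℝ => max s 0 := continuous_id.max continuous_const
  have hcont : ∀ {B : ℝ → L2}, ContinuousOn B (Set.Ici 0) → Continuous fun s => B (max s 0) :=
    fun hB => hB.comp_continuous hpos fun s => le_max_right s 0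
  have hcx : ∀ {B : ℝ → L2}, ContinuousOn B (Set.Ici 0) →
      Continuous fun s => complexify (B (max s 0)) :=
    fun hB => complexify.continuous.comp (hcont hB)
  have hc : Continuous fun s => complexify (B (max s 0)) - complexify (B' (max s 0)) :=
    (hcx h.continuousOn).sub (hcx h'.continuousOn)
  have hweak : ∀ {B : ℝ → L2}, IsKDESolution u ε F B → ∀ (φ : E3 → E3) (hφ : IsTest φ), ∀ t, 0 ≤ t →
      inner ℂ hφ.toC3.toL2 (complexify (B (max t 0)))
        = ((∫ x, inner ℝ (F x) (φ x) : ℝ) : ℂ) + ∫ s in (0 : ℝ)..t,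
          (inner ℂ hφ.toC3.curl.toL2 (velOp u C hu hC (complexify (B (max s 0))))
            + ε * inner ℂ hφ.toC3.laplacian.toL2 (complexify (B (max s 0)))) := by
    intro B hB φ hφ t ht
    rw [hφ.inner_complexify, max_eq_left ht, hB.equation φ hφ t ht, Complex.ofReal_add,
      ← intervalIntegral.integral_ofReal]
    congr 1
    refine intervalIntegral.integral_congr fun s hs => ?_
    rw [Set.uIcc_of_le ht] at hs
    simp only [max_eq_left hs.1]
    exact integral_weak_eq_complexify hu hC hφ ε (B s)
  have hi : ∀ {B : ℝ → L2}, ContinuousOn B (Set.Ici 0) → ∀ {φ : E3 → E3} (hφ : IsTest φ) (t : ℝ),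
      IntervalIntegrable (fun s =>
        (inner ℂ hφ.toC3.curl.toL2 (velOp u C hu hC (complexify (B (max s 0))))
            + ε * inner ℂ hφ.toC3.laplacian.toL2 (complexify (B (max s 0))))) volume 0 t := by
    intro B hB φ hφ t
    refine Continuous.intervalIntegrable ?_ _ _
    exact (continuous_const.inner ((velOp u C hu hC).continuous.comp (hcx hB))).add
      (continuous_const.mul (continuous_const.inner (hcx hB)))
  have h0 := eq_zero_of_weak hu hC hε hc (fun φ hφ t ht => by
    rw [inner_sub_right, hweak h φ hφ t ht, hweak h' φ hφ t ht, add_sub_add_left_eq_sub,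
      ← intervalIntegral.integral_sub (hi h.continuousOn hφ t) (hi h'.continuousOn hφ t)]
    refine intervalIntegral.integral_congr fun s _ => ?_
    simp only [map_sub, inner_sub_right]
    ring) ht
  simp only [max_eq_left ht] at h0
  rw [← map_sub, ← norm_eq_zero, norm_complexify, norm_eq_zero] at h0
  exact sub_eq_zero.mp h0

/-- The flow is defined by a choice of weak solution, and uniqueness identifies that choice with a
given one. -/
theorem kdeFlow_eq (hu : Continuous u) (hC : ∀ x, ‖u x‖ ≤ C) (hε : 0 < ε) {F : L2}
    {B : ℝ → L2} (h : IsKDESolution u ε F B) {t : ℝ} (ht : 0 ≤ t) : kdeFlow u ε t F = B t := by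
  have hex : ∃ B : ℝ → L2, IsKDESolution u ε F B := ⟨B, h⟩
  rw [kdeFlow, dif_pos hex]
  exact IsKDESolution.unique hu hC hε hex.choose_spec h ht

end energy

/-! ### Rescaled velocity fields and the range of ε attached to n -/

section rescaling

theorem pderiv_smul_comp_smul {f : E3 → ℝ} (hf : Differentiable ℝ f) (c b : ℝ) (i : Fin 3)
    (x : E3) : pderiv i (fun y => c * f (b • y)) x = c * b * pderiv i f (b • x) := by
  have h1 : HasFDerivAt (fun y : E3 => b • y) (b • ContinuousLinearMap.id ℝ E3) x :=
    (hasFDerivAt_id x).const_smul b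
  have h2 := ((hf (b • x)).hasFDerivAt.comp x h1).const_mul c
  rw [pderiv, pderiv]
  refine (congrArg (fun L : E3 →L[ℝ] ℝ => L (basisVec i)) h2.fderiv).trans ?_
  simp
  ring

theorem curl_smul_comp_smul {Ψ : E3 → E3} (hΨ : ContDiff ℝ ∞ Ψ) (c b : ℝ) (x : E3) :
    curl (fun y => c • Ψ (b • y)) x = (c * b) • curl Ψ (b • x) := by
  have hd : ∀ i : Fin 3, Differentiable ℝ fun y => Ψ y i := fun i =>
    ((EuclideanSpace.proj i : E3 →L[ℝ] ℝ).contDiff.comp hΨ).differentiable (by norm_num)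
  have h : ∀ i j : Fin 3, pderiv i (fun y => (c • Ψ (b • y)) j) x
      = c * b * pderiv i (fun y => Ψ y j) (b • x) := fun i j =>
    pderiv_smul_comp_smul (hd j) c b i x
  simp only [curl, h]
  ext i
  fin_cases i <;> simp [mul_sub]

theorem rescaledField_eq_curl {Ψ U : E3 → E3} (hΨ : ContDiff ℝ ∞ Ψ) (hU : ∀ x, U x = curl Ψ x)
    {ζ : ℝ} (hζ : 0 < ζ) (n : ℕ) (x : E3) :
    rescaledField ζ n U x = curl (rescaledPotential ζ n Ψ) x := by
  have h : curl (rescaledPotential ζ n Ψ) x = _ := curl_smul_comp_smul hΨ (ζ ^ n) _ x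
  rw [h, rescaledField, hU, ← Real.rpow_natCast, ← Real.rpow_add hζ]
  congr 2
  ring

theorem rescaledField_eq {ζ : ℝ} (hζ : 0 < ζ) (n : ℕ) (U : E3 → E3) :
    rescaledField ζ n U = fun x => (ζ ^ ((n : ℝ) / 2)) • U ((ζ ^ ((n : ℝ) / 2))⁻¹ • x) := by
  funext x
  rw [rescaledField, Real.rpow_neg hζ.le]

theorem eq_of_pow_lt_of_le_pow {ζ ε : ℝ} (h0 : 0 < ζ) (h1 : ζ < 1) {m n : ℕ}
    (hm : ζ ^ (m + 1) < ε) (hm' : ε ≤ ζ ^ m) (hn : ζ ^ (n + 1) < ε) (hn' : ε ≤ ζ ^ n) : m = n := by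
  have h2 := (pow_lt_pow_iff_right_of_lt_one₀ h0 h1).mp (hm.trans_le hn')
  have h3 := (pow_lt_pow_iff_right_of_lt_one₀ h0 h1).mp (hn.trans_le hm')
  omega

end rescaling

/-! ### Normalized families of Bloch modes -/

section profiles

/-- The multiplier `mᵢ / |m|`. -/
noncomputable def unitLatOp (i : Fin 3) : Seq →L[ℂ] Seq :=
  diagOp (fun m => (((m i : ℝ) * ‖latVec m‖⁻¹ : ℝ) : ℂ) • ContinuousLinearMap.id ℂ C3) 1 zero_le_one
    fun m => by
      rw [norm_smul, Complex.norm_real, norm_mul, Real.norm_of_nonneg (inv_nonneg.mpr (norm_nonneg _))]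
      refine mul_le_one₀ ?_ (norm_nonneg _) ContinuousLinearMap.norm_id_le
      have h : ‖(m i : ℝ)‖ ≤ ‖latVec m‖ := by
        have := PiLp.norm_apply_le (latVec m) i
        simpa using this
      calc _ ≤ ‖latVec m‖ * ‖latVec m‖⁻¹ :=
            mul_le_mul_of_nonneg_right h (inv_nonneg.mpr (norm_nonneg _))
        _ ≤ 1 := mul_inv_le_one

theorem unitLatOp_apply (i : Fin 3) (w : Seq) (m : Z3) :
    unitLatOp i w m = (((m i : ℝ) * ‖latVec m‖⁻¹ : ℝ) : ℂ) • w m := rfl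

/-- At m = 0 the factor mᵢ removes the mean v, so multiplication of a mode by mᵢ is a bounded
function of the rescaled fluctuation w alone. This provides gradient profiles that depend
continuously on κ. -/
theorem unitLatOp_eq (i : Fin 3) (w : Seq) (v : C3) (m : Z3) :
    unitLatOp i w m = ((m i : ℝ) : ℂ) • (invNormOp w + constSeq v) m := by
  rw [lp.coeFn_add, Pi.add_apply, unitLatOp_apply, invNormOp_apply]
  rcases eq_or_ne m 0 with rfl | hm
  · simp
  · rw [constSeq_apply_ne v hm, add_zero, smul_smul, Complex.ofReal_mul]

theorem IsMode.smul {u : Z3 → C3} {lam ε : ℂ} {κ : C3} {h : Seq} (hm : IsMode u lam ε κ h) (c : ℂ) :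
    IsMode u lam ε κ (c • h) := by
  intro m
  rw [map_smul, lp.coeFn_smul, lp.coeFn_smul, Pi.smul_apply, Pi.smul_apply, cross_smul_right,
    smul_comm lam c, hm m, smul_sub]
  congr 1
  · rw [smul_comm]
  · rw [smul_comm]

/-- On the open set where 2πη lies in the open ball, the nearest lattice point is 0, so the
transform there is the zero-frequency component of H, which does not vanish. -/
theorem packet_ne_zero {κ₀ : E3} {ρ : ℝ} (hρ : 0 < ρ) (h : ‖κ₀‖ + ρ < 1 / 2)
    {H : C(Metric.closedBall κ₀ ρ, Seq)} (hH : ∀ κ, H κ 0 ≠ 0) :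
    packet (Metric.closedBall κ₀ ρ) H ≠ 0 := by
  intro h0
  have h1 : ∀ᵐ η, packetFun H (waveVec η) = 0 := by
    have h2 := coeFn_packet H
    rw [h0] at h2
    filter_upwards [h2, Lp.coeFn_zero C3 2 (volume : Measure E3)] with η h3 h4
    rw [← h3, h4, Pi.zero_apply]
  have hopen : IsOpen (waveVec ⁻¹' Metric.ball κ₀ ρ) :=
    Metric.isOpen_ball.preimage continuous_waveVec
  have hne : (waveVec ⁻¹' Metric.ball κ₀ ρ).Nonempty := by
    refine ⟨(2 * Real.pi)⁻¹ • κ₀, ?_⟩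
    show waveVec _ ∈ Metric.ball κ₀ ρ
    rw [waveVec, smul_inv_smul₀ (by positivity)]
    exact Metric.mem_ball_self hρ
  refine (hopen.measure_pos volume hne).ne' (measure_mono_null ?_ (ae_iff.mp h1))
  intro η hη h3
  have hη' : waveVec η ∈ Metric.ball κ₀ ρ := hη
  have hlt : ‖waveVec η‖ < 1 / 2 := by
    have h4 := norm_add_le (waveVec η - κ₀) κ₀
    rw [sub_add_cancel] at h4
    rw [mem_ball_iff_norm] at hη'
    linarith
  have hidx : modeIdx (waveVec η) = 0 := by
    funext i
    rw [modeIdx, Pi.zero_apply, Int.floor_eq_zero_iff]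
    have h5 := (PiLp.norm_apply_le (waveVec η) i).trans_lt hlt
    rw [Real.norm_eq_abs, abs_lt] at h5
    constructor <;> linarith
  have hq : quasiMom (waveVec η) = waveVec η := by
    rw [quasiMom, hidx]
    ext i
    simp
  have hmem : quasiMom (waveVec η) ∈ Metric.closedBall κ₀ ρ := by
    rw [hq]; exact Metric.ball_subset_closedBall hη'
  rw [packetFun, modeExt_of_mem _ _ hmem, hidx] at h3
  exact hH _ h3

/-- A continuous family of unstable Bloch modes, normalized in `L²`. -/
theorem exists_profile_family {U : E3 → E3} (hα : AlphaUnstable U) :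
    ∃ (κ₀ : E3) (ρ ζ γ : ℝ), ρ < ‖κ₀‖ ∧ ‖κ₀‖ + ρ < 1 / 2 ∧ 1 / 2 < ζ ∧ ζ < 1 ∧ 0 < γ ∧
      ∃ (lam : Set.Icc ζ 1 → C(Metric.closedBall κ₀ ρ, ℂ))
        (h : C(Set.Icc ζ 1, C(Metric.closedBall κ₀ ρ, Seq))),
        ∀ s, ‖packet (Metric.closedBall κ₀ ρ) (h s)‖ ^ 2 = 2 ∧
          (∀ κ, 2 * γ ≤ (lam s κ).re) ∧
          (∀ κ, IsMode (uhat U) (lam s κ) ((s : ℝ) : ℂ) (toC3 κ) (h s κ)) ∧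
          ∃ g : Fin 3 → C(Metric.closedBall κ₀ ρ, Seq), ∀ i κ m,
            g i κ m = (((m i : ℝ) + (κ : E3) i : ℝ) : ℂ) • h s κ m := by
  obtain ⟨κ₀, ρ, ζ, γ, lam, W, V, hρ, h1, h2, h3, h4, h5, hlam, hW, hV, hmode⟩ :=
    exists_mode_family hα
  set K := Metric.closedBall κ₀ ρ with hK
  have hin : Continuous fun q : Set.Icc ζ 1 × K => ((q.2 : E3), (q.1 : ℝ)) := by fun_prop
  have hmem : ∀ q : Set.Icc ζ 1 × K, ((q.2 : E3), (q.1 : ℝ)) ∈ K ×ˢ Set.Icc ζ 1 := fun q =>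
    ⟨q.2.2, q.1.2⟩
  have hWc : Continuous fun q : Set.Icc ζ 1 × K => W ((q.2 : E3), (q.1 : ℝ)) :=
    hW.comp_continuous hin hmem
  have hVc : Continuous fun q : Set.Icc ζ 1 × K => V ((q.2 : E3), (q.1 : ℝ)) :=
    hV.comp_continuous hin hmem
  have hlc : Continuous fun q : Set.Icc ζ 1 × K => lam ((q.2 : E3), (q.1 : ℝ)) :=
    hlam.comp_continuous hin hmem
  have hls : ∀ s : Set.Icc ζ 1, Continuous fun κ : K => lam ((κ : E3), (s : ℝ)) := fun s =>
    hlc.comp (by fun_prop : Continuous fun κ : K => (s, κ))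
  let H : C(Set.Icc ζ 1, C(K, Seq)) := ContinuousMap.curry
    ⟨fun q => invNormOp (W ((q.2 : E3), (q.1 : ℝ))) + constSeq (V ((q.2 : E3), (q.1 : ℝ))),
      (invNormOp.continuous.comp hWc).add (constSeq.continuous.comp hVc)⟩
  have hHapp : ∀ s κ, H s κ = invNormOp (W ((κ : E3), (s : ℝ))) + constSeq (V ((κ : E3), (s : ℝ))) :=
    fun _ _ => rfl
  have hne : ∀ s, packet K (H s) ≠ 0 := fun s => packet_ne_zero hρ h2 fun κ => by
    rw [hHapp, lp.coeFn_add, Pi.add_apply, invNormOp_zero, constSeq_apply_zero, zero_add]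
    exact (hmode κ κ.2 s s.2).2.1
  have hc : Continuous fun s => ((Real.sqrt 2 / ‖packet K (H s)‖ : ℝ) : ℂ) :=
    Complex.continuous_ofReal.comp (continuous_const.div
      ((packet K).continuous.comp H.continuous).norm fun s => norm_ne_zero_iff.mpr (hne s))
  refine ⟨κ₀, ρ, ζ, γ, h1, h2, h3, h4, h5,
    -- The complex packet gets norm √2 so that its real part has norm 1.
    fun s => ⟨fun κ => lam ((κ : E3), (s : ℝ)), hls s⟩,
    ⟨fun s => ((Real.sqrt 2 / ‖packet K (H s)‖ : ℝ) : ℂ) • H s, hc.smul H.continuous⟩,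
    fun s => ⟨?_, fun κ => (hmode κ κ.2 s s.2).1, fun κ => ?_, ?_⟩⟩
  · show ‖packet K (((Real.sqrt 2 / ‖packet K (H s)‖ : ℝ) : ℂ) • H s)‖ ^ 2 = 2
    rw [map_smul, norm_smul, Complex.norm_real, Real.norm_of_nonneg (by positivity),
      div_mul_cancel₀ _ (norm_ne_zero_iff.mpr (hne s)), Real.sq_sqrt zero_le_two]
  · exact (hmode κ κ.2 s s.2).2.2.smul _
  · have hWs : Continuous fun κ : K => W ((κ : E3), (s : ℝ)) := hWc.comp (by fun_prop :
      Continuous fun κ : K => (s, κ))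
    have hκ : ∀ i : Fin 3, Continuous fun κ : K => (((κ : E3) i : ℝ) : ℂ) := fun i =>
      Complex.continuous_ofReal.comp
        ((EuclideanSpace.proj i : E3 →L[ℝ] ℝ).continuous.comp continuous_subtype_val)
    refine ⟨fun i => ⟨fun κ => ((Real.sqrt 2 / ‖packet K (H s)‖ : ℝ) : ℂ) •
        (unitLatOp i (W ((κ : E3), (s : ℝ))) + (((κ : E3) i : ℝ) : ℂ) • H s κ), ?_⟩,
      fun i κ m => ?_⟩
    · have hsum : Continuous fun κ : K =>
          unitLatOp i (W ((κ : E3), (s : ℝ))) + (((κ : E3) i : ℝ) : ℂ) • H s κ :=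
        ((unitLatOp i).continuous.comp hWs).add ((hκ i).smul (H s).continuous)
      exact hsum.const_smul ((Real.sqrt 2 / ‖packet K (H s)‖ : ℝ) : ℂ)
    · show (((Real.sqrt 2 / ‖packet K (H s)‖ : ℝ) : ℂ) •
        (unitLatOp i (W ((κ : E3), (s : ℝ))) + (((κ : E3) i : ℝ) : ℂ) • H s κ)) m
        = _ • (((Real.sqrt 2 / ‖packet K (H s)‖ : ℝ) : ℂ) • H s κ) m
      rw [lp.coeFn_smul, lp.coeFn_smul, Pi.smul_apply, Pi.smul_apply, lp.coeFn_add, Pi.add_apply,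
        unitLatOp_eq i _ (V ((κ : E3), (s : ℝ))), ← hHapp, lp.coeFn_smul, Pi.smul_apply, ← add_smul,
        smul_comm, Complex.ofReal_add]

end profiles

/-! ### Tightness of the family of packets -/

section tightness

/-- The restriction to the complement of a ball. -/
noncomputable def tailOp (R : ℝ) : L2C →L[ℂ] L2C :=
  multOp (fun x => (Metric.closedBall (0 : E3) R)ᶜ.indicator
      (fun _ => ContinuousLinearMap.id ℂ C3) x) 1
    (stronglyMeasurable_const.indicator
      Metric.isClosed_closedBall.measurableSet.compl).aestronglyMeasurable fun x => by
    by_cases h : x ∈ (Metric.closedBall (0 : E3) R)ᶜ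
    · rw [Set.indicator_of_mem h]
      exact ContinuousLinearMap.norm_id_le
    · rw [Set.indicator_of_notMem h, norm_zero]
      exact zero_le_one

theorem coeFn_tailOp (R : ℝ) (f : L2C) :
    tailOp R f =ᵐ[volume] (Metric.closedBall (0 : E3) R)ᶜ.indicator f := by
  have h : tailOp R f =ᵐ[volume] fun x => ((Metric.closedBall (0 : E3) R)ᶜ.indicator
      (fun _ => ContinuousLinearMap.id ℂ C3) x) (f x) := coeFn_multOp _ _ f
  filter_upwards [h] with x hx
  rw [hx]
  by_cases h : x ∈ (Metric.closedBall (0 : E3) R)ᶜ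
  · rw [Set.indicator_of_mem h, Set.indicator_of_mem h, ContinuousLinearMap.id_apply]
  · rw [Set.indicator_of_notMem h, Set.indicator_of_notMem h, zero_apply]

theorem norm_tailOp_anti {R R' : ℝ} (h : R ≤ R') (f : L2C) : ‖tailOp R' f‖ ≤ ‖tailOp R f‖ := by
  refine Lp.norm_le_norm_of_ae_le ?_
  filter_upwards [coeFn_tailOp R f, coeFn_tailOp R' f] with x h1 h2
  rw [h1, h2]
  exact norm_indicator_le_of_subset (Set.compl_subset_compl.mpr (Metric.closedBall_subset_closedBall h))
    _ _

theorem tendsto_tailOp (f : L2C) :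
    Filter.Tendsto (fun n : ℕ => ‖tailOp n f‖ ^ 2) Filter.atTop (nhds 0) := by
  have hint : Integrable fun x => ‖f x‖ ^ 2 :=
    (Lp.memLp f).integrable_norm_pow (by norm_num)
  have h1 : ∀ n : ℕ, ‖tailOp n f‖ ^ 2
      = ∫ x, (Metric.closedBall (0 : E3) n)ᶜ.indicator (fun x => ‖f x‖ ^ 2) x := fun n => by
    rw [norm_sq_eq_integral (F := C3)]
    refine integral_congr_ae ?_
    filter_upwards [coeFn_tailOp n f] with x hx
    rw [hx]
    by_cases h : x ∈ (Metric.closedBall (0 : E3) (n : ℝ))ᶜ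
    · rw [Set.indicator_of_mem h, Set.indicator_of_mem h]
    · rw [Set.indicator_of_notMem h, Set.indicator_of_notMem h, norm_zero]
      norm_num
  simp only [h1]
  rw [← integral_zero E3 ℝ (μ := volume)]
  refine tendsto_integral_of_dominated_convergence (fun x => ‖f x‖ ^ 2) (fun n => ?_) hint
    (fun n => ?_) ?_
  · exact hint.aestronglyMeasurable.indicator Metric.isClosed_closedBall.measurableSet.compl
  · refine Filter.Eventually.of_forall fun x => ?_
    refine (norm_indicator_le_norm_self _ _).trans (le_of_eq ?_)
    rw [Real.norm_of_nonneg (by positivity)]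
  · refine Filter.Eventually.of_forall fun x => ?_
    obtain ⟨N, hN⟩ := exists_nat_ge ‖x‖
    refine tendsto_const_nhds.congr' ?_
    filter_upwards [Filter.eventually_ge_atTop N] with n hn
    rw [Set.indicator_of_notMem]
    rw [Set.notMem_compl_iff, mem_closedBall_zero_iff]
    exact hN.trans (by exact_mod_cast hn)

/-- Compact subsets of `L²` are tight. -/
theorem exists_tail_le {X : Type*} [TopologicalSpace X] [CompactSpace X] {b : X → L2C}
    (hb : Continuous b) {δ : ℝ} (hδ : 0 < δ) :
    ∃ R : ℝ, 0 < R ∧ ∀ s, ‖tailOp R (b s)‖ ≤ δ := by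
  -- Dini's argument: the sets where the tail beyond radius n is below δ are open, increase with n
  -- and cover X.
  obtain ⟨n, hn⟩ := isCompact_univ.elim_directed_cover
    (fun n : ℕ => {s : X | ‖tailOp n (b s)‖ < δ})
    (fun n => isOpen_lt ((tailOp n).continuous.comp hb).norm continuous_const)
    (fun s _ => by
      have h := (tendsto_tailOp (b s)).eventually (gt_mem_nhds (pow_pos hδ 2))
      obtain ⟨n, hn⟩ := h.exists
      exact Set.mem_iUnion.mpr ⟨n, lt_of_pow_lt_pow_left₀ 2 hδ.le hn⟩)
    (directed_of_isDirected_le fun m n hmn s hs =>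
      lt_of_le_of_lt (norm_tailOp_anti (by exact_mod_cast hmn) (b s)) hs)
  refine ⟨n + 1, by positivity, fun s => ?_⟩
  exact (norm_tailOp_anti (by linarith) (b s)).trans (le_of_lt (hn (Set.mem_univ s)))

/-- For a ≤ 1 a point outside the ball of radius R is sent by x ↦ x/a to a point outside it, and the
dilation is isometric. -/
theorem norm_tailOp_dilation_le {R a : ℝ} (ha : 0 < a) (ha1 : a ≤ 1) (f : L2C) :
    ‖tailOp R (dilation a⁻¹ (inv_pos.mpr ha) f)‖ ≤ ‖tailOp R f‖ := by
  rw [← (dilation a⁻¹ (inv_pos.mpr ha)).norm_map (tailOp R f)]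
  refine Lp.norm_le_norm_of_ae_le ?_
  filter_upwards [coeFn_tailOp R (dilation a⁻¹ (inv_pos.mpr ha) f),
    coeFn_dilation (inv_pos.mpr ha) f, coeFn_dilation (inv_pos.mpr ha) (tailOp R f),
    (quasiMeasurePreserving_smul (inv_pos.mpr ha)).ae_eq_comp (coeFn_tailOp R f)] with x h1 h2 h3 h4
  simp only [Function.comp_apply] at h4
  rw [h1, h3, h4]
  by_cases h : x ∈ (Metric.closedBall (0 : E3) R)ᶜ
  · rw [Set.indicator_of_mem h, h2, Set.indicator_of_mem]
    rw [Set.mem_compl_iff, mem_closedBall_zero_iff, not_le] at h ⊢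
    refine h.trans_le ?_
    rw [norm_smul, Real.norm_of_nonneg (inv_pos.mpr ha).le]
    exact le_mul_of_one_le_left (norm_nonneg _) ((one_le_inv₀ ha).mpr ha1)
  · rw [Set.indicator_of_notMem h, norm_zero]
    exact norm_nonneg _

/-- Triangle inequality for the pieces inside and outside the ball; taking the real part does not
increase the outer piece. -/
theorem one_sub_le_eLpNorm_ball {g : L2C} (hg : ‖reOp g‖ = 1) {R δ : ℝ} (hR : ‖tailOp R g‖ ≤ δ) :
    1 - δ ≤ (eLpNorm (reOp g) 2 (volume.restrict (Metric.closedBall (0 : E3) R))).toReal := by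
  set B := Metric.closedBall (0 : E3) R with hB
  have hBm : MeasurableSet B := Metric.isClosed_closedBall.measurableSet
  have hF : MemLp (reOp g) 2 (volume : Measure E3) := Lp.memLp _
  have h1 : eLpNorm (reOp g) 2 volume ≤
      eLpNorm (reOp g) 2 (volume.restrict B) + eLpNorm (reOp g) 2 (volume.restrict Bᶜ) := by
    rw [← eLpNorm_indicator_eq_eLpNorm_restrict hBm,
      ← eLpNorm_indicator_eq_eLpNorm_restrict hBm.compl]
    refine le_trans (le_of_eq ?_) (eLpNorm_add_le (hF.aestronglyMeasurable.indicator hBm)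
      (hF.aestronglyMeasurable.indicator hBm.compl) (by norm_num))
    rw [Set.indicator_self_add_compl]
  have h2 : eLpNorm (reOp g) 2 (volume.restrict Bᶜ) ≤ eLpNorm (tailOp R g) 2 volume := by
    rw [← eLpNorm_indicator_eq_eLpNorm_restrict hBm.compl]
    refine eLpNorm_mono_ae ?_
    filter_upwards [coeFn_tailOp R g, coeFn_reOp g] with x h3 h4
    rw [h3]
    by_cases h : x ∈ Bᶜ
    · rw [Set.indicator_of_mem h, Set.indicator_of_mem h, h4]
      exact norm_reC3_le _
    · rw [Set.indicator_of_notMem h, norm_zero]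
      exact norm_nonneg _
  have h3 := ENNReal.toReal_mono (ENNReal.add_ne_top.mpr
    ⟨(hF.restrict B).eLpNorm_ne_top, (Lp.memLp (tailOp R g)).eLpNorm_ne_top⟩)
    (h1.trans (add_le_add_right h2 _))
  rw [ENNReal.toReal_add (hF.restrict B).eLpNorm_ne_top (Lp.memLp (tailOp R g)).eLpNorm_ne_top,
    ← Lp.norm_def, ← Lp.norm_def, hg] at h3
  linarith

end tightness

/-! ### Growth of the real wave packets -/

section growth

theorem profileScale_expProfile_zero {K : Set E3} [CompactSpace K] (h : C(K, Seq)) (lam : C(K, ℂ)) :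
    profileScale h (expProfile lam 0) = h := by
  ext1 κ
  rw [profileScale_apply, expProfile_apply, Complex.ofReal_zero, zero_mul, Complex.exp_zero,
    one_smul]

variable {U : E3 → E3} {κ₀ : E3} {ρ : ℝ} {h : C(Metric.closedBall κ₀ ρ, Seq)}
  {lam : C(Metric.closedBall κ₀ ρ, ℂ)}

theorem norm_sq_reOp_scaledPacket (h1 : ρ < ‖κ₀‖) (h2 : ‖κ₀‖ + ρ < 1 / 2) {a : ℝ} (ha : 0 < a)
    (H : C(Metric.closedBall κ₀ ρ, Seq)) :
    ‖reOp (fourierL2.symm (scaledPacket (Metric.closedBall κ₀ ρ) a ha H))‖ ^ 2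
      = 2⁻¹ * ‖scaledPacket (Metric.closedBall κ₀ ρ) a ha H‖ ^ 2 :=
  norm_sq_reOp (scaledPacket_zero_or_zero h1 h2 ha H)

theorem norm_reOp_scaledPacket (h1 : ρ < ‖κ₀‖) (h2 : ‖κ₀‖ + ρ < 1 / 2)
    (hn : ‖packet (Metric.closedBall κ₀ ρ) h‖ ^ 2 = 2) {a : ℝ} (ha : 0 < a) :
    ‖reOp (fourierL2.symm (scaledPacket (Metric.closedBall κ₀ ρ) a ha h))‖ = 1 := by
  have h3 := norm_sq_reOp_scaledPacket h1 h2 ha h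
  have h4 : ‖scaledPacket (Metric.closedBall κ₀ ρ) a ha h‖
      = ‖packet (Metric.closedBall κ₀ ρ) h‖ := (dilation a ha).norm_map _
  rw [h4, hn] at h3
  have h5 := norm_nonneg (reOp (fourierL2.symm (scaledPacket (Metric.closedBall κ₀ ρ) a ha h)))
  nlinarith

/-- The wave packets are divergence-free and grow exponentially. -/
theorem packet_unstable (hp : TorusPeriodic U) (hU : ContDiff ℝ ∞ U) {ε γ : ℝ} (hε : 0 < ε)
    (hγ : 0 < γ) (h1 : ρ < ‖κ₀‖) (h2 : ‖κ₀‖ + ρ < 1 / 2)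
    (hn : ‖packet (Metric.closedBall κ₀ ρ) h‖ ^ 2 = 2)
    (hlam : ∀ κ, γ ≤ (lam κ).re)
    (hmode : ∀ κ, IsMode (uhat U) (lam κ) ε (toC3 κ) (h κ))
    {g : Fin 3 → C(Metric.closedBall κ₀ ρ, Seq)}
    (hg : ∀ i κ m, g i κ m = (((m i : ℝ) + (κ : E3) i : ℝ) : ℂ) • h κ m)
    {a : ℝ} (ha : 0 < a) :
    WeaklyDivFree (reOp (fourierL2.symm (scaledPacket (Metric.closedBall κ₀ ρ) a ha h))) ∧
      ∀ t, 0 ≤ t → Real.exp (γ * t) ≤ ‖kdeFlow (fun x => a • U (a⁻¹ • x)) (a ^ 2 * ε) t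
        (reOp (fourierL2.symm (scaledPacket (Metric.closedBall κ₀ ρ) a ha h)))‖ := by
  have hsol := isKDESolution_packet hp hU hε hmode (fun κ => hγ.trans_le (hlam κ)) hg ha
  rw [profileScale_expProfile_zero] at hsol
  obtain ⟨B, hB, hBt⟩ : ∃ B, IsKDESolution (fun x => a • U (a⁻¹ • x)) (a ^ 2 * ε)
      (reOp (fourierL2.symm (scaledPacket (Metric.closedBall κ₀ ρ) a ha h))) B ∧
      ∀ t, B t = reOp (fourierL2.symm (scaledPacket (Metric.closedBall κ₀ ρ) a ha
        (profileScale h (expProfile lam t)))) := ⟨_, hsol, fun _ => rfl⟩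
  obtain ⟨C, -, hC⟩ := hp.bounded hU.continuous
  constructor
  · have h3 := hB.div_free 0 le_rfl
    rwa [hB.initial] at h3
  · intro t ht
    rw [kdeFlow_eq (continuous_rescale hU.continuous a) (norm_rescale_le hC ha) (by positivity) hB ht,
      hBt]
    have h3 := norm_packet_growth (h := h) hlam ha ht
    have h4 := norm_sq_reOp_scaledPacket h1 h2 ha (profileScale h (expProfile lam t))
    have h5 := norm_sq_reOp_scaledPacket h1 h2 ha h
    rw [norm_reOp_scaledPacket h1 h2 hn ha] at h5
    rw [profileScale_expProfile_zero] at h3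
    -- The real part halves the squared norm at time t exactly as at time 0, so the growth factor of
    -- the complex packet is inherited.
    have h6 := pow_le_pow_left₀ (mul_nonneg (Real.exp_pos _).le (norm_nonneg _)) h3 2
    rw [mul_pow] at h6
    refine (sq_le_sq₀ (Real.exp_pos _).le (norm_nonneg _)).mp ?_
    rw [h4]
    nlinarith [sq_nonneg (Real.exp (γ * t))]

end growth

end Dynamo

/-! ### The main theorem -/

theorem theorem2 (Ψ U : Dynamo.E3 → Dynamo.E3)
    (hΨ_smooth : ContDiff ℝ ∞ Ψ) (hΨ_periodic : Dynamo.TorusPeriodic Ψ)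
    (hU : ∀ x, U x = Dynamo.curl Ψ x)
    (hα : Dynamo.AlphaUnstable U) :
    ∃ ζ γ : ℝ, 1 / 2 < ζ ∧ ζ < 1 ∧ 0 < γ ∧
      (∀ (n : ℕ) (x : Dynamo.E3), Dynamo.rescaledField ζ n U x
          = Dynamo.curl (Dynamo.rescaledPotential ζ n Ψ) x) ∧
      ∃ F : ℝ → Dynamo.L2,
        (∀ ε : ℝ, 0 < ε → ε ≤ 1 →
          ‖F ε‖ = 1 ∧ Dynamo.WeaklyDivFree (F ε) ∧
          ∀ n : ℕ, ζ ^ (n + 1) < ε → ε ≤ ζ ^ n →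
            ∀ t : ℝ, 0 ≤ t →
              Real.exp (2 * γ * t)
                ≤ ‖Dynamo.kdeFlow (Dynamo.rescaledField ζ n U) ε t (F ε)‖) ∧
        (∀ δ : ℝ, 0 < δ → δ < 1 → ∃ R : ℝ, 0 < R ∧
          ∀ ε : ℝ, 0 < ε → ε ≤ 1 →
            1 - δ ≤ (eLpNorm (F ε) 2
              (volume.restrict (Metric.closedBall (0 : Dynamo.E3) R))).toReal) := by
  open Dynamo in
  obtain ⟨κ₀, ρ, ζ, γ, h1, h2, h3, h4, h5, lam, h, hfam⟩ := exists_profile_family hα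
  have hζ : 0 < ζ := by linarith
  have hb : Continuous fun s => fourierL2.symm (packet (Metric.closedBall κ₀ ρ) (h s)) :=
    fourierL2.symm.continuous.comp ((packet _).continuous.comp h.continuous)
  have key : ∀ ε : ℝ, 0 < ε ∧ ε ≤ 1 → ∃ f : L2, ‖f‖ = 1 ∧ WeaklyDivFree f ∧
      (∀ n : ℕ, ζ ^ (n + 1) < ε → ε ≤ ζ ^ n → ∀ t : ℝ, 0 ≤ t →
        Real.exp (2 * γ * t) ≤ ‖kdeFlow (rescaledField ζ n U) ε t f‖) ∧
      ∃ (a : ℝ) (ha : 0 < a) (s : Set.Icc ζ 1), a ≤ 1 ∧ f = reOp (dilation a⁻¹ (inv_pos.mpr ha)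
        (fourierL2.symm (packet (Metric.closedBall κ₀ ρ) (h s)))) := by
    rintro ε ⟨hε, hε1⟩
    obtain ⟨n, hn, hn'⟩ := exists_nat_pow_near_of_lt_one hε hε1 hζ h4
    have hpow : 0 < ζ ^ n := pow_pos hζ n
    -- After dilation by a = ζ^{n/2} the diffusivity a²(ε/ζ^n) equals ε, so the mode is taken at the
    -- parameter ε/ζ^n.
    have hs : ε / ζ ^ n ∈ Set.Icc ζ 1 := by
      refine ⟨(le_div_iff₀ hpow).mpr ?_, (div_le_one hpow).mpr hn'⟩
      rw [pow_succ'] at hn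
      exact hn.le
    have ha : 0 < ζ ^ ((n : ℝ) / 2) := Real.rpow_pos_of_pos hζ _
    have ha2 : (ζ ^ ((n : ℝ) / 2)) ^ 2 * (ε / ζ ^ n) = ε := by
      rw [← Real.rpow_natCast, ← Real.rpow_mul hζ.le]
      push_cast
      rw [div_mul_cancel₀ _ two_ne_zero, Real.rpow_natCast]
      field_simp
    obtain ⟨hnorm, hlam, hmode, g, hg⟩ := hfam ⟨_, hs⟩
    obtain ⟨hdiv, hgrow⟩ := packet_unstable hα.periodic hα.smooth (div_pos hε hpow) (by positivity)
      h1 h2 hnorm hlam hmode hg ha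
    refine ⟨_, norm_reOp_scaledPacket h1 h2 hnorm ha, hdiv, fun m hm hm' t ht => ?_, _, ha, ⟨_, hs⟩,
      Real.rpow_le_one hζ.le h4.le (by positivity), ?_⟩
    -- The intervals (ζ^{n+1}, ζ^n] are disjoint, so the given index is the one used in the
    -- construction.
    · obtain rfl := eq_of_pow_lt_of_le_pow hζ h4 hn hn' hm hm'
      have h6 := hgrow t ht
      rwa [ha2, ← rescaledField_eq hζ] at h6
    · rw [← fourierL2_symm_dilation ha]
      rfl
  choose! F hF using key
  refine ⟨ζ, γ, h3, h4, h5, fun n x => rescaledField_eq_curl hΨ_smooth hU hζ n x, F,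
    fun ε hε hε1 => ⟨(hF ε ⟨hε, hε1⟩).1, (hF ε ⟨hε, hε1⟩).2.1, (hF ε ⟨hε, hε1⟩).2.2.1⟩,
    fun δ hδ _ => ?_⟩
  -- The radius comes from the undilated packets over the compact interval [ζ, 1], hence does not
  -- depend on ε.
  obtain ⟨R, hR, hRb⟩ := exists_tail_le hb hδ
  refine ⟨R, hR, fun ε hε hε1 => ?_⟩
  obtain ⟨hnorm, -, -, a, ha, s, ha1, hFe⟩ := hF ε ⟨hε, hε1⟩
  rw [hFe] at hnorm ⊢
  exact one_sub_le_eLpNorm_ball hnorm ((norm_tailOp_dilation_le ha ha1 _).trans (hRb s))
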